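/- **Theorem 5.1.** *Setting.* Let $\mathcal X\subset\mathcal Y\subset\mathbb R^d$ be compact with Lebesgue measure $|\mathcal X|>0$, and let $d\mu=|\mathcal X|^{-1}dx$ (so $\mu(\mathcal X)=1$). Let $\mathcal U\subset\mathbb R^{n_u}$ be compact and convex with $0\in\operatorname{int}\mathcal U$, let $f,g_1,\dots,g_{n_u}:\mathbb R^d\to\mathbb R^d$ be $C^1$ on $\mathcal Y$, and $T>0$. (A function is $C^j$ on the compact set $\mathcal Y$ if it agrees on $\mathcal Y$ with a $C^j$ function on $\mathbb R^d$.) Assume that for every $x^0\in\mathcal X$ and every constant control $u\in\mathcal U$ the solution $x(\cdot;x^0,u)$ of $\dot x=f(x)+\sum_i u_ig_i(x)$, $x(0)=x^0$, exists on $[0,T]$ and stays in $\mathcal Y$; put $(K_u^t\psi)(x^0)=\psi(x(t;x^0,u))$. Let $\gamma_i=\inf\{\gamma>0:\gamma e_i\notin\mathcal U\}$, $\Gamma=\operatorname{diag}(\gamma_i)$, $\mathcal U_\partial=\{0,\gamma_1e_1,\dots,\gamma_{n_u}e_{n_u}\}$. Let $k:\mathcal Y\times\mathcal Y\to\mathbb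 R$ be a continuous symmetric positive definite kernel, $\varphi(x)=k(x,x)$, $\mathbb H_{\mathcal Y}$ its reproducing kernel Hilbert space (RKHS), $\mathbb H_{\mathcal X}$ the RKHS of its restriction to $\mathcal X$, $\Phi(x)=k(x,\cdot)$. Assume: if $\psi\in L^2(\mathcal Y;\mu)$ and $\iint k(x,y)\psi(x)\psi(y)\,d\mu\,d\mu=0$, then $\psi=0$ a.e.; and an element of $\mathbb H_{\mathcal Y}$ (of $\mathbb H_{\mathcal X}$) that vanishes $\mu$-a.e. on $\mathcal Y$ (on $\mathcal X$) is $0$. Let $\lambda_1\ge\lambda_2\ge\dots$ be the eigenvalues of $C_{\mathcal X}=\int_{\mathcal X}\Phi(x)\otimes\Phi(x)\,d\mu(x)$ on $\mathbb H_{\mathcal X}$, where $(a\otimes b)\psi=\langle\psi,b\rangle a$; for $r\ge1$ let $P_r$ be the orthogonal projection in $L^2(\mathcal X;\mu)$ onto the span of the eigenfunctions for $\lambda_1,\dots,\lambda_r$, and $$\delta_r=\min_{1\le j\le r}\frac{\lambda_j-\lambda_{j+1}}2,\qquad c_r=\frac1{\sqrt{\lambda_r}}+\frac{r+1}{\delta_r\lambda_r}\big(1+\|\varphi\|_{L^1(\mathcal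 Y;\mu)}\big)\|\varphi\|_{L^1(\mathcal X;\mu)}^{1/2}.$$ For points $x_0,\dots,x_{m-1}$ drawn i.i.d. from $\mu$ on $\mathcal X$ let $\widehat C^m_{\mathcal X}=\frac1m\sum_k\Phi(x_k)\otimes\Phi(x_k)$ with eigenvalues $\widehat\lambda_1\ge\widehat\lambda_2\ge\dots$, let $[\widehat C_{\mathcal X}^m]_r^\dagger=\sum_{j\le r}\widehat\lambda_j^{-1}\,\widehat v_j\otimes\widehat v_j$ ($\widehat v_j$ orthonormal eigenvectors for $\widehat\lambda_j$, $0^{-1}:=0$) be a rank-$r$ truncated pseudo-inverse, and $$\widehat K^{t}_{r,(v)}=[\widehat C_{\mathcal X}^m]_r^\dagger\,\frac1m\sum_k\Phi(x_k)\otimes\Phi(x(t;x_k,v))\quad(v\in\mathcal U_\partial),\qquad \widehat K_{r,u}=\widehat K^t_{r,(0)}+\sum_{i=1}^{n_u}\frac{u_i}{\gamma_i}\big(\widehat K^t_{r,(\gamma_ie_i)}-\widehat K^t_{r,(0)}\big).$$ *Claims.* $K_u^t$ maps $\mathbb H_{\mathcal Y}$ into $L^2(\mathcal X;\mu)$ for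 $u\in\mathcal U$, $t\in[0,T]$. If $K_v^t\mathbb H_{\mathcal Y}\subset\mathbb H_{\mathcal X}$ for the respective control $v$ in the bounds below, then $K_v^t:\mathbb H_{\mathcal Y}\to\mathbb H_{\mathcal X}$ is bounded. Moreover: (1) For every $\psi\in\mathbb H_{\mathcal Y}$ that is $C^2$ on $\mathcal Y$ there is $c_\psi\ge0$ such that for all $t\in[0,T]$, all $r\ge1$ with $\lambda_{j+1}<\lambda_j$ for $j=1,\dots,r$, all $\varepsilon\in(0,\delta_r)$, $\delta\in(0,1)$ and $m\ge\max\{r,8\|k\|_\infty^2\ln(4(n_u+1)/\delta)/\varepsilon^2\}$, with probability at least $1-\delta$ one has, for all $u\in\mathcal U$, $$\|P_rK_u^t\psi-\widehat K_{r,u}\psi\|_{L^2(\mathcal X;\mu)}\le(1+2\|\Gamma^{-1}u\|_1)\,c_r\varepsilon\,\|\psi\|_{\mathbb H_{\mathcal Y}}+c_\psi t^2,$$ and, if $K_v^t\mathbb H_{\mathcal Y}\subset\mathbb H_{\mathcal X}$ for all $v\in\mathcal U_\partial$, with $M=\max_{v\in\mathcal U_\partial}\|K_v^t\|_{\mathbb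 H_{\mathcal Y}\to\mathbb H_{\mathcal X}}$ also $$\|K_u^t\psi-\widehat K_{r,u}\psi\|_{L^2(\mathcal X;\mu)}\le(1+2\|\Gamma^{-1}u\|_1)\big(\sqrt{\lambda_{r+1}}M+c_r\varepsilon\big)\|\psi\|_{\mathbb H_{\mathcal Y}}+c_\psi t^2 .$$ (2) Let $k$ be a $C^2$ kernel, i.e. $k$ extends to a function on $\mathbb R^d\times\mathbb R^d$ whose mixed partial derivatives $\partial_x^\alpha\partial_y^\beta k$, $|\alpha|,|\beta|\le2$, exist and are continuous. Then there is $C_k\ge0$, depending only on $k$ and the system ($f,g_i,\mathcal U,\mathcal X,\mathcal Y,T$), such that for all $t,r,\varepsilon,\delta$ as in (1), all $m\ge\max\{r,8\|k\|_\infty^2\ln(4/\delta)/\varepsilon^2\}$ and every $u\in\mathcal U$, with probability at least $1-\delta$ one has $\widehat\lambda_r>0$ and $$\|P_rK_u^t-\widehat K_{r,u}\|_{\mathbb H_{\mathcal Y}\to L^2(\mathcal X;\mu)}\le c_r\varepsilon+t^2\,C_k\widehat\lambda_r^{-1};$$ if $K_u^t\mathbb H_{\mathcal Y}\subset\mathbb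 H_{\mathcal X}$, also $$\|K_u^t-\widehat K_{r,u}\|_{\mathbb H_{\mathcal Y}\to L^2(\mathcal X;\mu)}\le\sqrt{\lambda_{r+1}}\,\|K_u^t\|_{\mathbb H_{\mathcal Y}\to\mathbb H_{\mathcal X}}+c_r\varepsilon+t^2\,C_k\widehat\lambda_r^{-1};$$ and if $K_v^t\mathbb H_{\mathcal Y}\subset\mathbb H_{\mathcal X}$ for all $v\in\mathcal U_\partial$, also $$\|K_u^t-\widehat K_{r,u}\|_{\mathbb H_{\mathcal Y}\to L^2(\mathcal X;\mu)}\le\Big(\Big|1-\sum_i\frac{u_i}{\gamma_i}\Big|+\|\Gamma^{-1}u\|_1\Big)\sqrt{\lambda_{r+1}}\,M+c_r\varepsilon+t^2\,C_k\widehat\lambda_r^{-1},$$ where the factor in front of $\sqrt{\lambda_{r+1}}M$ equals $1$ for $u$ in the convex hull of $\mathcal U_\partial$. -/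

import Mathlib

open MeasureTheory Set

namespace KEDMD

noncomputable section

/-! ### Smoothness on a compact set and the sampling measure -/

/-- `h : Y → V` is of class `C^n` on the set `Y`: it is the restriction of a `C^n` function. -/
def CnOn {E V : Type*} [NormedAddCommGroup E] [NormedSpace ℝ E] [NormedAddCommGroup V]
    [NormedSpace ℝ V] (n : ℕ) {Y : Set E} (h : Y → V) : Prop :=
  ∃ h' : E → V, ContDiff ℝ n h' ∧ ∀ y : Y, h' y = h y

/-- A `C^2` kernel in the sense of kernel theory (the feature map is twice continuously
differentiable): `k` is the restriction of a function on `E × E` that can be differentiated up to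
two times in each of the two variables separately, with jointly continuous mixed derivatives
`∂_x^i ∂_y^j`, `i, j ≤ 2`. -/
def IsC2Kernel {E : Type*} [NormedAddCommGroup E] [NormedSpace ℝ E] {Y : Set E}
    (k : Y → Y → ℝ) : Prop :=
  ∃ k' : E → E → ℝ, (∀ x y : Y, k' x y = k x y) ∧
    (∀ x, ContDiff ℝ 2 (k' x)) ∧
    (∀ j : ℕ, j ≤ 2 → ∀ y, ContDiff ℝ 2 fun x => iteratedFDeriv ℝ j (k' x) y) ∧
    (∀ i j : ℕ, i ≤ 2 → j ≤ 2 → Continuous fun p : E × E =>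
      iteratedFDeriv ℝ i (fun x => iteratedFDeriv ℝ j (k' x) p.2) p.1)

/-- The measure `dμ = |X|⁻¹ dx` on the set `A`. -/
def sampleMeasure {d : ℕ} (X A : Set (EuclideanSpace ℝ (Fin d))) : Measure A :=
  (volume X)⁻¹ • Measure.comap (Subtype.val : A → EuclideanSpace ℝ (Fin d)) volume

open Classical in
/-- The class in `L²(μ)` of a square-integrable function. -/
def toL2 {Z : Type*} [MeasurableSpace Z] (μ : Measure Z) (g : Z → ℝ) : Lp ℝ 2 μ :=
  if h : MemLp g 2 μ then h.toLp g else 0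

/-! ### Eigenvalues and truncated pseudo-inverses of positive compact operators -/

section Spectral

variable {H : Type*} [NormedAddCommGroup H] [InnerProductSpace ℝ H]

/-- The `j`-th largest eigenvalue (`j = 1, 2, …`, counted with multiplicity) of a positive compact
operator: the largest `c` such that there are `j` orthonormal eigenvectors whose eigenvalues are all
at least `c`. (It is `0` if the dimension of the space is less than `j`.) -/
def eigval (A : H →L[ℝ] H) (j : ℕ) : ℝ :=
  sSup {c : ℝ | ∃ (v : Fin j → H) (κ : Fin j → ℝ),
    Orthonormal ℝ v ∧ ∀ i, A (v i) = κ i • v i ∧ c ≤ κ i}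

/-- `R` is the pseudo-inverse `[A]_r^†` of a rank-`r` truncation of the eigendecomposition of `A`:
`R = ∑_{j ≤ r} λ_j⁻¹ ⟨·, v_j⟩ v_j` with orthonormal eigenvectors `v_j` for the `r` largest
eigenvalues `λ_j` of `A` (and with `0⁻¹ = 0`, as usual for pseudo-inverses). -/
def IsTruncPinv (A : H →L[ℝ] H) (r : ℕ) (R : H →L[ℝ] H) : Prop :=
  ∃ v : Fin r → H, Orthonormal ℝ v ∧ (∀ j : Fin r, A (v j) = eigval A (j + 1) • v j) ∧
    R = ∑ j : Fin r, (eigval A (j + 1))⁻¹ • InnerProductSpace.rankOne ℝ (v j) (v j)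

end Spectral

/-! ### Covariance operators -/

section Covariance

variable {Z : Type*} (H : Type*) [NormedAddCommGroup H] [InnerProductSpace ℝ H] [CompleteSpace H]
  [RKHS ℝ H Z ℝ]

/-- The feature map `Φ(z) = k(z, ·)`. -/
def feature (z : Z) : H := RKHS.kerFun H z 1

variable [MeasurableSpace Z]

/-- The covariance operator `C = ∫ Φ(z) ⊗ Φ(z) dμ(z)`. -/
def covOp (μ : Measure Z) : H →L[ℝ] H :=
  ∫ z, InnerProductSpace.rankOne ℝ (feature H z) (feature H z) ∂μ

/-- The `j`-th Mercer eigenvalue `λ_j`, `j = 1, 2, …`. -/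
def mercer (μ : Measure Z) (j : ℕ) : ℝ := eigval (covOp H μ) j

/-- `δ_r = min_{1 ≤ j ≤ r} (λ_j - λ_{j+1}) / 2`. -/
def deltaR (μ : Measure Z) (r : ℕ) : ℝ :=
  ⨅ j : Fin r, (mercer H μ (j + 1) - mercer H μ (j + 2)) / 2

/-- The orthogonal projection `P_r` in `L²(μ)` onto the span of the eigenvectors of the covariance
operator for its `r` largest eigenvalues. -/
def projR (μ : Measure Z) (r : ℕ) : Lp ℝ 2 μ →L[ℝ] Lp ℝ 2 μ :=
  (Submodule.span ℝ {g : Lp ℝ 2 μ | ∃ j : ℕ, 1 ≤ j ∧ j ≤ r ∧ ∃ η : H,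
    covOp H μ η = mercer H μ j • η ∧ g = toL2 μ η}).topologicalClosure.starProjection

/-- The empirical covariance operator `m⁻¹ ∑_k Φ(x_k) ⊗ Φ(x_k)`. -/
def empCov {m : ℕ} (x : Fin m → Z) : H →L[ℝ] H :=
  (m : ℝ)⁻¹ • ∑ k, InnerProductSpace.rankOne ℝ (feature H (x k)) (feature H (x k))

/-- The empirical cross-covariance operator `m⁻¹ ∑_k Φ(x_k) ⊗ Φ(y_k) : H' → H`. -/
def empCross {Z' : Type*} (H' : Type*) [NormedAddCommGroup H'] [InnerProductSpace ℝ H']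
    [CompleteSpace H'] [RKHS ℝ H' Z' ℝ] {m : ℕ} (x : Fin m → Z) (y : Fin m → Z') : H' →L[ℝ] H :=
  (m : ℝ)⁻¹ • ∑ k, InnerProductSpace.rankOne ℝ (feature H (x k)) (feature H' (y k))

end Covariance

/-! ### The control system and the estimator -/

section Control

variable {d n : ℕ}

/-- `f_u = f + ∑ i, u_i g_i`. -/
def field (f : EuclideanSpace ℝ (Fin d) → EuclideanSpace ℝ (Fin d))
    (g : Fin n → EuclideanSpace ℝ (Fin d) → EuclideanSpace ℝ (Fin d)) (u : Fin n → ℝ)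
    (x : EuclideanSpace ℝ (Fin d)) : EuclideanSpace ℝ (Fin d) :=
  f x + ∑ i, u i • g i x

/-- `F u t x₀` is the value at time `t ∈ [0, T]` of the solution of `ẋ = f_u(x)`, `x(0) = x₀`, for
every constant control `u ∈ U` and every `x₀ ∈ X`; these solutions stay in `Y`. -/
def IsControlFlow {X Y : Set (EuclideanSpace ℝ (Fin d))}
    (f : EuclideanSpace ℝ (Fin d) → EuclideanSpace ℝ (Fin d))
    (g : Fin n → EuclideanSpace ℝ (Fin d) → EuclideanSpace ℝ (Fin d)) (U : Set (Fin n → ℝ))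
    (T : ℝ) (F : (Fin n → ℝ) → ℝ → X → Y) : Prop :=
  ∀ u ∈ U, ∀ x : X, (F u 0 x : EuclideanSpace ℝ (Fin d)) = x ∧
    ∀ t ∈ Icc (0 : ℝ) T, HasDerivWithinAt (fun s => (F u s x : EuclideanSpace ℝ (Fin d)))
      (field f g u (F u t x)) (Icc 0 T) t

/-- `γ_i = inf {γ > 0 : γ e_i ∉ U}`. -/
def gam (U : Set (Fin n → ℝ)) (i : Fin n) : ℝ := sInf {c : ℝ | 0 < c ∧ Pi.single i c ∉ U}

/-- The controls `0, γ_1 e_1, …, γ_n e_n`. -/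
def vertex (U : Set (Fin n → ℝ)) : Option (Fin n) → (Fin n → ℝ)
  | none => 0
  | some i => Pi.single i (gam U i)

/-- `‖Γ⁻¹ u‖₁` with `Γ = diag(γ_1, …, γ_n)`. -/
def gamNorm (U : Set (Fin n → ℝ)) (u : Fin n → ℝ) : ℝ := ∑ i, |u i / gam U i|

variable {X Y : Set (EuclideanSpace ℝ (Fin d))} (HX HY : Type*)
  [NormedAddCommGroup HX] [InnerProductSpace ℝ HX] [CompleteSpace HX] [RKHS ℝ HX X ℝ]
  [NormedAddCommGroup HY] [InnerProductSpace ℝ HY] [CompleteSpace HY] [RKHS ℝ HY Y ℝ]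

/-- The constant `c_r = λ_r^{-1/2} + (r+1)/(δ_r λ_r) (1 + ‖φ‖_{1,Y}) ‖φ‖_{1,X}^{1/2}`, where
`φ(x) = k(x, x)`. -/
def cR (k : Y → Y → ℝ) (hXY : X ⊆ Y) (r : ℕ) : ℝ :=
  1 / √(mercer HX (sampleMeasure X X) r) +
    (r + 1) / (deltaR HX (sampleMeasure X X) r * mercer HX (sampleMeasure X X) r) *
      (1 + ∫ y, k y y ∂(sampleMeasure X Y)) *
      √(∫ x, k (inclusion hXY x) (inclusion hXY x) ∂(sampleMeasure X X))

variable {HY} in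
/-- The Koopman operator `(K_u^t ψ)(x) = ψ(x(t; x, u))`. -/
def koop (F : (Fin n → ℝ) → ℝ → X → Y) (u : Fin n → ℝ) (t : ℝ) (ψ : HY) : X → ℝ :=
  fun x => ψ (F u t x)

/-- `K_u^t H_Y ⊆ H_X`. -/
def KoopInvariant (F : (Fin n → ℝ) → ℝ → X → Y) (u : Fin n → ℝ) (t : ℝ) : Prop :=
  ∀ ψ : HY, ∃ η : HX, ⇑η = koop F u t ψ

variable {HX HY} in
/-- `A` is `K_u^t` as a bounded operator from `H_Y` to `H_X`. -/
def IsKoopOp (F : (Fin n → ℝ) → ℝ → X → Y) (u : Fin n → ℝ) (t : ℝ) (A : HY →L[ℝ] HX) : Prop :=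
  ∀ ψ : HY, ⇑(A ψ) = koop F u t ψ

variable {HX} in
/-- The kEDMD estimator `[Ĉ_X^m]_r^† Ĉ_XY^{m,t}` of `K_v^t`, for the sample points `x_k` with
successors `y_k = x(t; x_k, v)`; here `R = [Ĉ_X^m]_r^†`. -/
def kedmd (F : (Fin n → ℝ) → ℝ → X → Y) (t : ℝ) {m : ℕ} (x : Fin m → X) (R : HX →L[ℝ] HX)
    (v : Fin n → ℝ) : HY →L[ℝ] HX :=
  R ∘L empCross HX HY x (fun k => F v t (x k))

variable {HX} in
/-- The estimator for the control `u`: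
`K̂_{r,u} = K̂_r + ∑ i, (u_i / γ_i) (K̂_{r, γ_i e_i} - K̂_r)`. -/
def controlEst (F : (Fin n → ℝ) → ℝ → X → Y) (U : Set (Fin n → ℝ)) (t : ℝ) {m : ℕ}
    (x : Fin m → X) (R : HX →L[ℝ] HX) (u : Fin n → ℝ) : HY →L[ℝ] HX :=
  kedmd HY F t x R (vertex U none) + ∑ i, (u i / gam U i) •
    (kedmd HY F t x R (vertex U (some i)) - kedmd HY F t x R (vertex U none))

end Control

end

end KEDMD

set_option linter.unusedSectionVars false

/-! Let `S` be the inclusion of `HX` into `L²(μ)`. Then `S* S` is the covariance operator `C`, and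
`S*` sends `K_u^t ψ` to `D ψ`, where `D = ∫ Φ(z) ⊗ Φ(F u t z) dμ(z)`. Hence `P_r K_u^t = S [C]_r^†
D` holds exactly, with or without invariance of the RKHS (`IsTopEigen.starProjection_eq`), and the
estimator replaces `C` and `D` by their empirical versions. Three errors remain.

Sampling. Write `q = ∫ φ dμ` over `X` and `K = ‖k‖_∞`. The empirical operators are means of
independent vectors in a Hilbert tensor product with variance at most `q K`. A Bernstein–Pinelis
bound, proved through the moment of `cosh ‖·‖`, keeps each of them within `s = ε √(q / (3K))` of its
mean up to probability `2 exp(-m ε² / (8K²))`; this is the origin of the sample size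
(`exists_event`). On that event Weyl's inequality and a `sin Θ` argument at the gap between `λ_r`
and `λ_{r+1}` compare the truncated pseudo-inverses (`IsSpectralSplit.norm_pinv_sub_le`), and
`norm_comp_pinv_sub_le` turns this into `c_r ε`.

Truncation. On the complement of the top eigenvectors `C` is bounded by `λ_{r+1}`, so `‖S η - P_r S
η‖ ≤ √λ_{r+1} ‖η‖`.

Control. The control `u` is an affine combination of the vertices and the vector field is affine in
the control. So the terms of order `0` and `1` in `t` cancel in the same combination of observables
along the flow, leaving `O(t²)` (`IsControlFlow.norm_sum_smul_le`). For one `C²` observable this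
defect lies outside the estimator and the vertex errors are added up. For a `C²` kernel the
expansion is applied in both kernel variables and bounds the defect of feature vectors. The combined
estimator is then compared with the estimator for `u` built on the same samples: only two operators
have to concentrate, but the defect passes through the empirical pseudo-inverse and picks up
`λ̂_r⁻¹`. -/

namespace KEDMD

open scoped InnerProductSpace

/-! ### Eigenvalues, Courant–Fischer, Weyl, and perturbation of truncated pseudo-inverses. -/

section SpectralTheory

variable {H : Type*} [NormedAddCommGroup H] [InnerProductSpace ℝ H]

/-- A self-adjoint operator has spectral radius equal to its norm, attained by a spectral value.
Compactness makes a nonzero spectral value an eigenvalue, and positivity fixes its sign. -/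
theorem exists_unit_eigenvector [CompleteSpace H] {A : H →L[ℝ] H} (hA : IsCompactOperator A)
    (hp : A.IsPositive) (h0 : A ≠ 0) : ∃ w : H, ‖w‖ = 1 ∧ A w = ‖A‖ • w := by
  have hs : spectralRadius ℝ A = ‖A‖₊ := A.spectralRadius_eq_nnnorm hp.isSelfAdjoint
  have hne : (spectrum ℝ A).Nonempty := by
    by_contra h
    rw [Set.not_nonempty_iff_eq_empty] at h
    rw [spectralRadius, h] at hs
    simp at hs
    exact h0 (nnnorm_eq_zero.1 hs.symm)
  obtain ⟨μ, hμ, hμn⟩ := spectrum.exists_nnnorm_eq_spectralRadius_of_nonempty hne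
  rw [hs] at hμn
  have hμn' : ‖μ‖ = ‖A‖ := by
    have : ‖μ‖₊ = ‖A‖₊ := by exact_mod_cast hμn
    exact congrArg NNReal.toReal this
  have hμ0 : μ ≠ 0 := by
    intro h
    rw [h, norm_zero] at hμn'
    exact h0 (norm_eq_zero.1 hμn'.symm)
  obtain ⟨w, hw⟩ := ((hA.hasEigenvalue_iff_mem_spectrum hμ0).2 hμ).exists_hasEigenvector
  have hw1 : A w = μ • w := hw.apply_eq_smul
  have hw0 : 0 < ‖w‖ := norm_pos_iff.2 hw.2
  have hμp : 0 ≤ μ := by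
    have h1 : 0 ≤ ⟪A w, w⟫_ℝ := hp.inner_nonneg_left w
    rw [hw1, real_inner_smul_left, real_inner_self_eq_norm_sq] at h1
    exact nonneg_of_mul_nonneg_left h1 (by positivity)
  have hμA : μ = ‖A‖ := by rw [← hμn', Real.norm_of_nonneg hμp]
  refine ⟨‖w‖⁻¹ • w, ?_, ?_⟩
  · rw [norm_smul, norm_inv, norm_norm, inv_mul_cancel₀ hw0.ne']
  · rw [map_smul, hw1, hμA, smul_comm]

/-- A positive compact operator on an invariant closed subspace either vanishes or has a unit
eigenvector for its norm on the subspace. -/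
theorem exists_top_eigenvector_of_invariant [CompleteSpace H] {A : H →L[ℝ] H}
    (hA : IsCompactOperator A) (hp : A.IsPositive) (W : Submodule ℝ H) (hW : IsClosed (W : Set H))
    (hAW : ∀ x ∈ W, A x ∈ W) :
    (∀ x ∈ W, A x = 0) ∨ ∃ ν > 0, ∃ w ∈ W, ‖w‖ = 1 ∧ A w = ν • w ∧ ∀ x ∈ W, ‖A x‖ ≤ ν * ‖x‖ := by
  have : CompleteSpace W := hW.completeSpace_coe
  have hsym : (A : H →ₗ[ℝ] H).IsSymmetric := hp.isSymmetric
  let T : W →L[ℝ] W := A.restrict hAW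
  have hT : ∀ x : W, (T x : H) = A x := fun x => rfl
  have hTc : IsCompactOperator T := hA.restrict' (f := (A : H →ₗ[ℝ] H)) hAW
  have hTp : T.IsPositive := by
    refine ⟨hsym.restrict_invariant hAW, fun x => ?_⟩
    exact hp.inner_nonneg_left (x : H)
  by_cases h0 : T = 0
  · left
    intro x hx
    have := hT ⟨x, hx⟩
    rw [h0] at this
    simpa using this.symm
  · right
    obtain ⟨w, hw1, hw2⟩ := exists_unit_eigenvector hTc hTp h0
    have hTpos : 0 < ‖T‖ := lt_of_le_of_ne (norm_nonneg T) fun h => h0 (T.opNorm_zero_iff.1 h.symm)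
    refine ⟨‖T‖, hTpos, w, w.2, hw1, ?_, fun x hx => ?_⟩
    · rw [← hT, hw2]; rfl
    · exact T.le_opNorm ⟨x, hx⟩

/-- The set of `c` such that `A` has `j` orthonormal eigenvectors with eigenvalues at least `c`. -/
def eigBounds (A : H →L[ℝ] H) (j : ℕ) : Set ℝ :=
  {c : ℝ | ∃ (v : Fin j → H) (κ : Fin j → ℝ),
    Orthonormal ℝ v ∧ ∀ i, A (v i) = κ i • v i ∧ c ≤ κ i}

theorem eigval_eq (A : H →L[ℝ] H) (j : ℕ) : eigval A j = sSup (eigBounds A j) := rfl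

theorem eigenvalue_le_norm {A : H →L[ℝ] H} {w : H} {κ : ℝ} (hw : ‖w‖ = 1) (h : A w = κ • w) :
    κ ≤ ‖A‖ := by
  have := A.le_opNorm w
  rw [h, norm_smul, hw, mul_one, mul_one] at this
  exact (le_abs_self κ).trans this

theorem bddAbove_eigBounds (A : H →L[ℝ] H) {j : ℕ} (hj : 1 ≤ j) : BddAbove (eigBounds A j) := by
  refine ⟨‖A‖, ?_⟩
  rintro c ⟨v, κ, hv, h⟩
  exact (h ⟨0, hj⟩).2.trans (eigenvalue_le_norm (hv.1 _) (h _).1)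

theorem le_eigval {A : H →L[ℝ] H} {j : ℕ} (hj : 1 ≤ j) {c : ℝ} (v : Fin j → H) (κ : Fin j → ℝ)
    (hv : Orthonormal ℝ v) (h : ∀ i, A (v i) = κ i • v i ∧ c ≤ κ i) : c ≤ eigval A j :=
  le_csSup (bddAbove_eigBounds A hj) ⟨v, κ, hv, h⟩

theorem eigenvalue_nonneg {A : H →L[ℝ] H} (hp : A.IsPositive) {w : H} {κ : ℝ} (hw : ‖w‖ = 1)
    (h : A w = κ • w) : 0 ≤ κ := by
  have h1 : 0 ≤ ⟪A w, w⟫_ℝ := hp.inner_nonneg_left w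
  rw [h, real_inner_smul_left, real_inner_self_eq_norm_sq, hw] at h1
  simpa using h1

theorem eigval_nonneg {A : H →L[ℝ] H} (hp : A.IsPositive) (j : ℕ) : 0 ≤ eigval A j := by
  -- For `j = 0` every real is admissible, and `sSup` of an unbounded set is `0` by convention; the
  -- same default covers an empty set of bounds.
  rcases Nat.eq_zero_or_pos j with rfl | hj
  · rw [eigval_eq]
    have : eigBounds A 0 = univ := by
      ext c
      simp only [eigBounds, mem_ofPred_eq, mem_univ, iff_true]
      exact ⟨fun i => i.elim0, fun i => i.elim0, ⟨fun i => i.elim0, fun i => i.elim0⟩,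
        fun i => i.elim0⟩
    rw [this, Real.sSup_univ]
  · by_cases h : (eigBounds A j).Nonempty
    · obtain ⟨c, v, κ, hv, h⟩ := h
      exact le_eigval hj v κ hv fun i => ⟨(h i).1, eigenvalue_nonneg hp (hv.1 i) (h i).1⟩
    · rw [Set.not_nonempty_iff_eq_empty] at h
      rw [eigval_eq, h, Real.sSup_empty]

theorem eigval_succ_le {A : H →L[ℝ] H} (hp : A.IsPositive) {j : ℕ} (hj : 1 ≤ j) :
    eigval A (j + 1) ≤ eigval A j := by
  rw [eigval_eq A (j + 1)]
  refine Real.sSup_le ?_ (eigval_nonneg hp j)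
  rintro c ⟨v, κ, hv, h⟩
  exact le_eigval hj (v ∘ Fin.castSucc) (κ ∘ Fin.castSucc)
    (hv.comp _ (Fin.castSucc_injective j)) fun i => h _

theorem eigval_anti {A : H →L[ℝ] H} (hp : A.IsPositive) {i j : ℕ} (hi : 1 ≤ i) (hij : i ≤ j) :
    eigval A j ≤ eigval A i := by
  induction j, hij using Nat.le_induction with
  | base => exact le_rfl
  | succ j hj ih => exact (eigval_succ_le hp (hi.trans hj)).trans ih

/-- The upper bound in the Courant–Fischer principle. -/
theorem eigval_le_of_forall_orthogonal {A : H →L[ℝ] H} {r : ℕ} (u : Fin r → H) {c : ℝ}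
    (hc : 0 ≤ c) (h : ∀ x, (∀ i, ⟪u i, x⟫_ℝ = 0) → ⟪A x, x⟫_ℝ ≤ c * ‖x‖ ^ 2) :
    eigval A (r + 1) ≤ c := by
  rw [eigval_eq]
  refine Real.sSup_le ?_ hc
  rintro b ⟨v, κ, hv, hvκ⟩
  -- Orthogonality to the `u i` imposes `r` linear conditions on the `r + 1` coefficients, so some
  -- nonzero combination of the `v j` satisfies them; on it the quadratic form is at least `b ‖x‖²`.
  let L : (Fin (r + 1) → ℝ) →ₗ[ℝ] (Fin r → ℝ) :=
    { toFun := fun a i => ⟪u i, ∑ j, a j • v j⟫_ℝ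
      map_add' := by
        intro a a'
        ext i
        simp [add_smul, Finset.sum_add_distrib, inner_add_right]
      map_smul' := by
        intro t a
        ext i
        simp [mul_smul, ← Finset.smul_sum, real_inner_smul_right] }
  have hker : LinearMap.ker L ≠ ⊥ := LinearMap.ker_ne_bot_of_finrank_lt (by simp)
  obtain ⟨a, ha, ha0⟩ := Submodule.exists_mem_ne_zero_of_ne_bot hker
  have hx := h (∑ j, a j • v j) fun i => congrFun (LinearMap.mem_ker.1 ha) i
  have hAx : A (∑ j, a j • v j) = ∑ j, (a j * κ j) • v j := by
    rw [map_sum]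
    exact Finset.sum_congr rfl fun j _ => by rw [map_smul, (hvκ j).1, smul_smul]
  rw [hAx, ← real_inner_self_eq_norm_sq, hv.inner_sum, hv.inner_sum] at hx
  simp only [conj_trivial] at hx
  have hpos : 0 < ∑ j, a j * a j := by
    obtain ⟨j, hj⟩ := Function.ne_iff.1 ha0
    exact Finset.sum_pos' (fun i _ => mul_self_nonneg _)
      ⟨j, Finset.mem_univ _, mul_self_pos.2 hj⟩
  have hb : b * ∑ j, a j * a j ≤ ∑ j, a j * κ j * a j := by
    rw [Finset.mul_sum]
    refine Finset.sum_le_sum fun j _ => ?_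
    nlinarith [mul_le_mul_of_nonneg_right (hvκ j).2 (mul_self_nonneg (a j))]
  exact le_of_mul_le_mul_right (hb.trans hx) hpos

theorem orthonormal_snoc {r : ℕ} {v : Fin r → H} (hv : Orthonormal ℝ v) {w : H} (hw : ‖w‖ = 1)
    (h : ∀ i, ⟪v i, w⟫_ℝ = 0) : Orthonormal ℝ (Fin.snoc v w : Fin (r + 1) → H) := by
  rw [orthonormal_iff_ite] at hv ⊢
  intro i j
  refine Fin.lastCases ?_ (fun i => ?_) i <;> refine Fin.lastCases ?_ (fun j => ?_) j
  · simp [hw]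
  · simp [real_inner_comm (v j) w, h, (Fin.castSucc_ne_last j).symm]
  · simp [h, Fin.castSucc_ne_last]
  · simp [hv]

/-- Orthonormal eigenvectors for the `r` largest eigenvalues. -/
def IsTopEigen (A : H →L[ℝ] H) (r : ℕ) (v : Fin r → H) : Prop :=
  Orthonormal ℝ v ∧ ∀ j : Fin r, A (v j) = eigval A (j + 1) • v j

theorem IsTopEigen.castLE {A : H →L[ℝ] H} {r s : ℕ} {v : Fin r → H} (hv : IsTopEigen A r v)
    (h : s ≤ r) : IsTopEigen A s (v ∘ Fin.castLE h) :=
  ⟨hv.1.comp _ (Fin.castLE_injective h), fun j => hv.2 (Fin.castLE h j)⟩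

theorem IsTopEigen.mem_orthogonal {A : H →L[ℝ] H} (hp : A.IsPositive) {r : ℕ} {v : Fin r → H}
    (hv : IsTopEigen A r v) {x : H} (hx : ∀ i, ⟪v i, x⟫_ℝ = 0) (i : Fin r) :
    ⟪v i, A x⟫_ℝ = 0 := by
  have hsym : ⟪A (v i), x⟫_ℝ = ⟪v i, A x⟫_ℝ := hp.isSymmetric (v i) x
  rw [← hsym, hv.2 i, real_inner_smul_left, hx i, mul_zero]

/-- Otherwise take the first `s` with `λ_{s+1} < ν`. The vectors `v_1, …, v_s` and `w` are then `s +
1` orthonormal eigenvectors with eigenvalues at least `ν`, which forces `ν ≤ λ_{s+1}`. -/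
theorem le_eigval_of_orthogonal {A : H →L[ℝ] H} {r : ℕ} {v : Fin r → H}
    (hv : IsTopEigen A r v) {w : H} (hw : ‖w‖ = 1) (hvw : ∀ i, ⟪v i, w⟫_ℝ = 0) {ν : ℝ}
    (h : A w = ν • w) : ν ≤ eigval A (r + 1) := by
  by_contra hlt
  push Not at hlt
  have hex : ∃ s, s ≤ r ∧ eigval A (s + 1) < ν := ⟨r, le_rfl, hlt⟩
  classical
  set s := Nat.find hex with hs
  obtain ⟨hsr, hsν⟩ := Nat.find_spec hex
  rw [← hs] at hsr hsν
  refine absurd (le_eigval (A := A) (c := ν) (Nat.le_add_left 1 s)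
    (Fin.snoc (v ∘ Fin.castLE hsr) w) (Fin.snoc (fun i : Fin s => eigval A (i + 1)) ν)
    (orthonormal_snoc (hv.castLE hsr).1 hw fun i => hvw _) fun i => ?_) (not_le.2 hsν)
  refine Fin.lastCases ?_ (fun i => ?_) i
  · simpa using h
  · simp only [Fin.snoc_castSucc]
    refine ⟨(hv.castLE hsr).2 i, ?_⟩
    by_contra hi
    exact Nat.find_min hex i.2 ⟨i.2.le.trans hsr, not_le.1 hi⟩

/-- The complement of the `v i` is invariant, so unless `A` vanishes there, the norm of its
restriction is an eigenvalue `ν`. `le_eigval_of_orthogonal` and the Courant–Fischer upper bound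
squeeze `ν` to `λ_{r+1}`. -/
theorem IsTopEigen.exists_top [CompleteSpace H] {A : H →L[ℝ] H} (hA : IsCompactOperator A)
    (hp : A.IsPositive) {r : ℕ} {v : Fin r → H} (hv : IsTopEigen A r v) :
    (∀ x, (∀ i, ⟪v i, x⟫_ℝ = 0) → A x = 0) ∨ ∃ w, ‖w‖ = 1 ∧ (∀ i, ⟪v i, w⟫_ℝ = 0) ∧
      A w = eigval A (r + 1) • w ∧
      ∀ x, (∀ i, ⟪v i, x⟫_ℝ = 0) → ‖A x‖ ≤ eigval A (r + 1) * ‖x‖ := by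
  let W : Submodule ℝ H := (Submodule.span ℝ (range v))ᗮ
  have hW : ∀ x, x ∈ W ↔ ∀ i, ⟪v i, x⟫_ℝ = 0 := by
    intro x
    rw [Submodule.mem_orthogonal]
    constructor
    · exact fun h i => h _ (Submodule.subset_span ⟨i, rfl⟩)
    · intro h u hu
      induction hu using Submodule.span_induction with
      | mem u hu => obtain ⟨i, rfl⟩ := hu; exact h i
      | zero => simp
      | add a b _ _ ha hb => rw [inner_add_left, ha, hb, add_zero]
      | smul a b _ hb => rw [real_inner_smul_left, hb, mul_zero]
  have hinv : ∀ x ∈ W, A x ∈ W := fun x hx => (hW _).2 fun i =>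
    hv.mem_orthogonal hp ((hW x).1 hx) i
  rcases exists_top_eigenvector_of_invariant hA hp W (Submodule.isClosed_orthogonal _) hinv with
    h | ⟨ν, hν, w, hwW, hw, hAw, hb⟩
  · exact Or.inl fun x hx => h x ((hW x).2 hx)
  · have hvw := (hW w).1 hwW
    have hle : ν ≤ eigval A (r + 1) := le_eigval_of_orthogonal hv hw hvw hAw
    have hge : eigval A (r + 1) ≤ ν := by
      refine eigval_le_of_forall_orthogonal v hν.le fun x hx => ?_
      calc ⟪A x, x⟫_ℝ ≤ ‖A x‖ * ‖x‖ := real_inner_le_norm _ _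
        _ ≤ ν * ‖x‖ * ‖x‖ := by gcongr; exact hb x ((hW x).2 hx)
        _ = ν * ‖x‖ ^ 2 := by ring
    obtain rfl := le_antisymm hle hge
    exact Or.inr ⟨w, hw, hvw, hAw, fun x hx => hb x ((hW x).2 hx)⟩

theorem IsTopEigen.norm_apply_le [CompleteSpace H] {A : H →L[ℝ] H} (hA : IsCompactOperator A)
    (hp : A.IsPositive) {r : ℕ} {v : Fin r → H} (hv : IsTopEigen A r v) {x : H}
    (hx : ∀ i, ⟪v i, x⟫_ℝ = 0) : ‖A x‖ ≤ eigval A (r + 1) * ‖x‖ := by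
  rcases hv.exists_top hA hp with h | ⟨w, -, -, -, h⟩
  · rw [h x hx, norm_zero]
    exact mul_nonneg (eigval_nonneg hp _) (norm_nonneg _)
  · exact h x hx

/-- The eigenvectors are picked greedily. Were `A` to vanish on the complement of fewer than `r` of
them, Courant–Fischer would give `λ_r = 0`. -/
theorem exists_isTopEigen [CompleteSpace H] {A : H →L[ℝ] H} (hA : IsCompactOperator A)
    (hp : A.IsPositive) : ∀ {r : ℕ}, (r = 0 ∨ 0 < eigval A r) → ∃ v, IsTopEigen A r v
  | 0, _ => ⟨fun i => i.elim0, ⟨fun i => i.elim0, fun i => i.elim0⟩, fun i => i.elim0⟩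
  | r + 1, h => by
    have hpos : 0 < eigval A (r + 1) := h.resolve_left (Nat.succ_ne_zero r)
    obtain ⟨v, hv⟩ : ∃ v, IsTopEigen A r v := by
      refine exists_isTopEigen hA hp ?_
      rcases Nat.eq_zero_or_pos r with h0 | h0
      · exact Or.inl h0
      · exact Or.inr (hpos.trans_le (eigval_succ_le hp h0))
    rcases hv.exists_top hA hp with h' | ⟨w, hw, hvw, hAw, -⟩
    · refine absurd (eigval_le_of_forall_orthogonal (A := A) v le_rfl fun x hx => ?_)
        (not_le.2 hpos)
      rw [h' x hx, inner_zero_left, zero_mul]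
    · refine ⟨Fin.snoc v w, orthonormal_snoc hv.1 hw hvw, fun j => ?_⟩
      refine Fin.lastCases ?_ (fun i => ?_) j
      · simpa using hAw
      · simpa using hv.2 i

/-- The attained lower bound in the Courant–Fischer principle. -/
theorem exists_forall_orthogonal_norm_le [CompleteSpace H] {A : H →L[ℝ] H}
    (hA : IsCompactOperator A) (hp : A.IsPositive) : ∀ r : ℕ, ∃ u : Fin r → H,
      ∀ x, (∀ i, ⟪u i, x⟫_ℝ = 0) → ‖A x‖ ≤ eigval A (r + 1) * ‖x‖
  | 0 => by
    obtain ⟨v, hv⟩ := exists_isTopEigen hA hp (r := 0) (Or.inl rfl)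
    exact ⟨v, fun x hx => hv.norm_apply_le hA hp hx⟩
  | r + 1 => by
    by_cases h : 0 < eigval A (r + 1)
    · obtain ⟨v, hv⟩ := exists_isTopEigen hA hp (Or.inr h)
      exact ⟨v, fun x hx => hv.norm_apply_le hA hp hx⟩
    -- If `λ_{r+1} = 0`, the vectors for `r` already force `A x = 0`; a zero vector, which imposes
    -- no condition, fills the extra slot.
    · obtain ⟨u, hu⟩ := exists_forall_orthogonal_norm_le hA hp r
      refine ⟨Fin.snoc u 0, fun x hx => (hu x fun i => ?_).trans ?_⟩
      · simpa using hx i.castSucc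
      · exact mul_le_mul_of_nonneg_right ((not_lt.1 h).trans (eigval_nonneg hp _)) (norm_nonneg _)

/-- **Weyl's inequality**. -/
theorem eigval_le_add_norm_sub [CompleteSpace H] {A B : H →L[ℝ] H}
    (hB : IsCompactOperator B) (hBp : B.IsPositive) {j : ℕ} (hj : 1 ≤ j) :
    eigval A j ≤ eigval B j + ‖A - B‖ := by
  obtain ⟨r, rfl⟩ := Nat.exists_eq_add_of_le' hj
  -- The optimal test vectors of `B` serve as test vectors for `A`.
  obtain ⟨u, hu⟩ := exists_forall_orthogonal_norm_le hB hBp r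
  refine eigval_le_of_forall_orthogonal u (add_nonneg (eigval_nonneg hBp _) (norm_nonneg _))
    fun x hx => ?_
  calc ⟪A x, x⟫_ℝ ≤ ‖A x‖ * ‖x‖ := real_inner_le_norm _ _
    _ = ‖B x + (A - B) x‖ * ‖x‖ := by simp
    _ ≤ (eigval B (r + 1) * ‖x‖ + ‖A - B‖ * ‖x‖) * ‖x‖ := by
        gcongr
        exact (norm_add_le _ _).trans (add_le_add (hu x hx) ((A - B).le_opNorm x))
    _ = (eigval B (r + 1) + ‖A - B‖) * ‖x‖ ^ 2 := by ring

/-- The operator `∑ j, c j ⟨·, v j⟩ v j`. -/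
noncomputable def diagOp {r : ℕ} (v : Fin r → H) (c : Fin r → ℝ) : H →L[ℝ] H :=
  ∑ j, c j • InnerProductSpace.rankOne ℝ (v j) (v j)

theorem diagOp_apply {r : ℕ} (v : Fin r → H) (c : Fin r → ℝ) (x : H) :
    diagOp v c x = ∑ j, (c j * ⟪v j, x⟫_ℝ) • v j := by
  simp [diagOp, mul_smul]

theorem inner_diagOp {r : ℕ} {v : Fin r → H} (hv : Orthonormal ℝ v) (c : Fin r → ℝ) (x : H)
    (i : Fin r) : ⟪v i, diagOp v c x⟫_ℝ = c i * ⟪v i, x⟫_ℝ := by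
  rw [diagOp_apply, hv.inner_right_fintype]

theorem diagOp_mul {r : ℕ} {v : Fin r → H} (hv : Orthonormal ℝ v) (c e : Fin r → ℝ) :
    diagOp v c * diagOp v e = diagOp v fun j => c j * e j := by
  ext x
  rw [mul_apply_eq_comp, diagOp_apply, diagOp_apply v (fun j => c j * e j)]
  simp_rw [inner_diagOp hv, mul_assoc]

theorem norm_diagOp_le {r : ℕ} {v : Fin r → H} (hv : Orthonormal ℝ v) {c : Fin r → ℝ} {M : ℝ}
    (hM : 0 ≤ M) (hc : ∀ j, |c j| ≤ M) : ‖diagOp v c‖ ≤ M := by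
  refine ContinuousLinearMap.opNorm_le_bound _ hM fun x => ?_
  refine abs_le_of_sq_le_sq' ?_ (by positivity) |>.2
  rw [← real_inner_self_eq_norm_sq, diagOp_apply, hv.inner_sum, mul_pow]
  calc ∑ j, (starRingEnd ℝ) (c j * ⟪v j, x⟫_ℝ) * (c j * ⟪v j, x⟫_ℝ)
      ≤ ∑ j, M ^ 2 * ‖⟪v j, x⟫_ℝ‖ ^ 2 := by
        refine Finset.sum_le_sum fun j _ => ?_
        rw [conj_trivial, ← sq, mul_pow, Real.norm_eq_abs, sq_abs]
        exact mul_le_mul_of_nonneg_right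
          (sq_le_sq' (abs_le.1 (hc j)).1 (abs_le.1 (hc j)).2) (sq_nonneg _)
    _ ≤ M ^ 2 * ‖x‖ ^ 2 := by
        rw [← Finset.mul_sum]
        gcongr
        exact hv.sum_inner_products_le x

theorem inner_sub_diagOp_one {r : ℕ} {v : Fin r → H} (hv : Orthonormal ℝ v) (x : H) (i : Fin r) :
    ⟪v i, (1 - diagOp v fun _ => 1) x⟫_ℝ = 0 := by
  rw [sub_apply, inner_sub_right, inner_diagOp hv]
  simp

theorem norm_one_sub_diagOp_le {r : ℕ} {v : Fin r → H} (hv : Orthonormal ℝ v) :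
    ‖1 - diagOp v fun _ => (1 : ℝ)‖ ≤ 1 := by
  refine ContinuousLinearMap.opNorm_le_bound _ zero_le_one fun x => ?_
  rw [one_mul]
  have h : ⟪(1 - diagOp v fun _ => (1 : ℝ)) x, diagOp v (fun _ => 1) x⟫_ℝ = 0 := by
    rw [diagOp_apply v _ x, inner_sum]
    refine Finset.sum_eq_zero fun j _ => ?_
    rw [real_inner_smul_right, real_inner_comm (v j), inner_sub_diagOp_one hv, mul_zero]
  have h2 := norm_add_sq_real ((1 - diagOp v fun _ => (1 : ℝ)) x) (diagOp v (fun _ => 1) x)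
  rw [h, sub_apply, one_apply_eq_self, sub_add_cancel] at h2
  rw [sub_apply, one_apply_eq_self]
  refine abs_le_of_sq_le_sq' ?_ (norm_nonneg _) |>.2
  nlinarith [sq_nonneg ‖diagOp v (fun _ => (1 : ℝ)) x‖]

/-- `X` inverts `A` on the range of the projection `P` that commutes with `A`, where `A ≥ a` on the
range of `P` and `A ≤ a'` on its complement. -/
structure IsSpectralSplit {R : Type*} [NormedRing R] (A X P : R) (a a' : ℝ) : Prop where
  mul_left : X * A = P
  mul_right : A * X = P
  mul_proj : X * P = X
  proj_mul : P * X = X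
  idem : P * P = P
  norm_inv : ‖X‖ ≤ a⁻¹
  norm_proj : ‖P‖ ≤ 1
  norm_compl : ‖1 - P‖ ≤ 1
  norm_rest : ‖A * (1 - P)‖ ≤ a'

theorem IsTopEigen.isSpectralSplit [CompleteSpace H] {A : H →L[ℝ] H} (hA : IsCompactOperator A)
    (hp : A.IsPositive) {r : ℕ} {v : Fin r → H} (hv : IsTopEigen A r v)
    (hpos : 0 < eigval A r) :
    IsSpectralSplit A (diagOp v fun j => (eigval A (j + 1))⁻¹) (diagOp v fun _ => 1)
      (eigval A r) (eigval A (r + 1)) := by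
  have hle : ∀ j : Fin r, eigval A r ≤ eigval A (j + 1) := fun j =>
    eigval_anti hp (Nat.le_add_left 1 _) j.2
  have hne : ∀ j : Fin r, eigval A (j + 1) ≠ 0 := fun j => (hpos.trans_le (hle j)).ne'
  have hcomp : ∀ x, (∀ i, ⟪v i, x⟫_ℝ = 0) → ∀ c, diagOp v c x = 0 := fun x hx c => by
    rw [diagOp_apply]
    exact Finset.sum_eq_zero fun j _ => by rw [hx, mul_zero, zero_smul]
  refine ⟨?_, ?_, ?_, ?_, ?_, ?_, ?_, norm_one_sub_diagOp_le hv.1, ?_⟩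
  · ext x
    rw [mul_apply_eq_comp, diagOp_apply, diagOp_apply]
    refine Finset.sum_congr rfl fun j _ => ?_
    have hsym : ⟪A (v j), x⟫_ℝ = ⟪v j, A x⟫_ℝ := hp.isSymmetric (v j) x
    rw [← hsym, hv.2 j, real_inner_smul_left, inv_mul_cancel_left₀ (hne j), one_mul]
  · ext x
    rw [mul_apply_eq_comp, diagOp_apply, diagOp_apply, map_sum]
    refine Finset.sum_congr rfl fun j _ => ?_
    rw [map_smul, hv.2 j, smul_smul, mul_right_comm, inv_mul_cancel₀ (hne j)]
  · simp [diagOp_mul hv.1]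
  · simp [diagOp_mul hv.1]
  · simp [diagOp_mul hv.1]
  · refine norm_diagOp_le hv.1 (by positivity) fun j => ?_
    rw [abs_of_nonneg (inv_nonneg.2 (eigval_nonneg hp _))]
    exact inv_anti₀ hpos (hle j)
  · exact norm_diagOp_le hv.1 zero_le_one (by simp)
  · refine ContinuousLinearMap.opNorm_le_bound _ (eigval_nonneg hp _) fun x => ?_
    rw [mul_apply_eq_comp]
    refine (hv.norm_apply_le hA hp (inner_sub_diagOp_one hv.1 x)).trans ?_
    exact mul_le_mul_of_nonneg_left (by
      simpa using (1 - diagOp v fun _ => (1 : ℝ)).le_of_opNorm_le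
        (norm_one_sub_diagOp_le hv.1) x) (eigval_nonneg hp _)

/-- A `sin Θ` estimate and the resulting perturbation bound for truncated pseudo-inverses. -/
theorem IsSpectralSplit.norm_pinv_sub_le {R : Type*} [NormedRing R] {A X P B Y Q : R}
    {a a' b b' η : ℝ} (hA : IsSpectralSplit A X P a a') (hB : IsSpectralSplit B Y Q b b')
    (ha : 0 < a) (hb : 0 < b) (hab : b' < a) (hba : a' < b) (hη : ‖B - A‖ ≤ η) :
    ‖X - Y‖ ≤ η / (a * b) + η / (a * (a - b')) + η / (b * (b - a')) := by
  have hη0 : 0 ≤ η := (norm_nonneg _).trans hη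
  have hPA : A * P = P * A := by rw [← hA.mul_left, ← mul_assoc, hA.mul_right, hA.mul_left]
  have hQB : B * Q = Q * B := by rw [← hB.mul_left, ← mul_assoc, hB.mul_right, hB.mul_left]
  -- Expanding `P = X A` with `A = B - (B - A)` expresses `P (1 - Q)` through itself with factor `b'
  -- / a < 1`, plus a term of size `η / a`; absorbing the former gives the bound. The block `(1 - P)
  -- Q` is treated in the same way with `B Y = Q`.
  have hW : ‖P * (1 - Q)‖ ≤ η / (a - b') := by
    have e1 : B * (1 - Q) = (1 - Q) * (B * (1 - Q)) := by
      simp only [mul_sub, sub_mul, mul_one, one_mul, ← mul_assoc, ← hQB]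
      simp only [mul_assoc, hB.idem]
      abel
    have e : P * (1 - Q) = X * (P * (1 - Q)) * (B * (1 - Q)) - X * (B - A) * (1 - Q) := by
      rw [← mul_assoc X P, hA.mul_proj, mul_assoc X, ← e1, mul_sub X B A, hA.mul_left]
      noncomm_ring
    have h1 : ‖P * (1 - Q)‖ ≤ a⁻¹ * ‖P * (1 - Q)‖ * b' + a⁻¹ * η * 1 := by
      nth_rewrite 1 [e]
      refine (norm_sub_le _ _).trans (add_le_add ?_ ?_)
      · exact norm_mul_le_of_le (norm_mul_le_of_le hA.norm_inv le_rfl) hB.norm_rest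
      · exact norm_mul_le_of_le (norm_mul_le_of_le hA.norm_inv hη) hB.norm_compl
    rw [le_div_iff₀ (sub_pos.2 hab)]
    have h2 := mul_le_mul_of_nonneg_left h1 ha.le
    field_simp at h2
    linarith
  have hV : ‖(1 - P) * Q‖ ≤ η / (b - a') := by
    have e1 : (1 - P) * A * Y = A * (1 - P) * ((1 - P) * Q) * Y := by
      have : (1 - P) * A = A * (1 - P) * (1 - P) := by
        simp only [mul_sub, sub_mul, mul_one, one_mul, hPA]
        simp only [mul_assoc, hPA]
        simp only [← mul_assoc, hA.idem]
        abel
      rw [this, mul_assoc _ _ Y, mul_assoc _ _ Y, mul_assoc _ Q, hB.proj_mul, mul_assoc]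
    have e : (1 - P) * Q = (1 - P) * (B - A) * Y + A * (1 - P) * ((1 - P) * Q) * Y := by
      rw [← e1, ← hB.mul_right]
      noncomm_ring
    have h1 : ‖(1 - P) * Q‖ ≤ 1 * η * b⁻¹ + a' * ‖(1 - P) * Q‖ * b⁻¹ := by
      nth_rewrite 1 [e]
      refine (norm_add_le _ _).trans (add_le_add ?_ ?_)
      · exact norm_mul_le_of_le (norm_mul_le_of_le hA.norm_compl hη) hB.norm_inv
      · exact norm_mul_le_of_le (norm_mul_le_of_le hA.norm_rest le_rfl) hB.norm_inv
    rw [le_div_iff₀ (sub_pos.2 hba)]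
    have h2 := mul_le_mul_of_nonneg_left h1 hb.le
    field_simp at h2
    linarith
  -- The resolvent identity for pseudo-inverses: the last two terms account for `P ≠ Q`.
  have e : X - Y = X * (B - A) * Y + X * (P * (1 - Q)) - (1 - P) * Q * Y := by
    rw [← mul_assoc X P, hA.mul_proj, mul_assoc _ Q Y, hB.proj_mul, mul_sub X, hA.mul_left,
      sub_mul, mul_assoc X B, hB.mul_right]
    noncomm_ring
  rw [e]
  calc ‖X * (B - A) * Y + X * (P * (1 - Q)) - (1 - P) * Q * Y‖
      ≤ a⁻¹ * η * b⁻¹ + a⁻¹ * (η / (a - b')) + η / (b - a') * b⁻¹ :=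
        (norm_sub_le _ _).trans (add_le_add ((norm_add_le _ _).trans (add_le_add
          (norm_mul_le_of_le (norm_mul_le_of_le hA.norm_inv hη) hB.norm_inv)
          (norm_mul_le_of_le hA.norm_inv hW))) (norm_mul_le_of_le hV hB.norm_inv))
    _ = η / (a * b) + η / (a * (a - b')) + η / (b * (b - a')) := by
        have := (sub_pos.2 hab).ne'
        have := (sub_pos.2 hba).ne'
        field_simp

end SpectralTheory

/-! ### Exponential tail bounds for sums of independent vectors in a Hilbert space. -/

section Bernstein

/-- The argument of the root is the convex combination of `(a + b)²` and `(a - b)²` with weights `(1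
± p) / 2`, and `s ↦ cosh √s = ∑ sⁿ / (2n)!` is convex term by term. -/
theorem cosh_sqrt_le {a b p : ℝ} (hp : |p| ≤ 1) :
    Real.cosh √(a ^ 2 + b ^ 2 + 2 * (a * b * p)) ≤
      Real.cosh a * Real.cosh b + p * (Real.sinh a * Real.sinh b) := by
  obtain ⟨hp1, hp2⟩ := abs_le.1 hp
  set s := a ^ 2 + b ^ 2 + 2 * (a * b * p) with hs
  have hs' : s = (1 + p) / 2 * (a + b) ^ 2 + (1 - p) / 2 * (a - b) ^ 2 := by rw [hs]; ring
  have hs0 : 0 ≤ s := by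
    rw [hs']
    have : 0 ≤ (1 + p) / 2 := by linarith
    have : 0 ≤ (1 - p) / 2 := by linarith
    positivity
  have hrhs : Real.cosh a * Real.cosh b + p * (Real.sinh a * Real.sinh b) =
      (1 + p) / 2 * Real.cosh (a + b) + (1 - p) / 2 * Real.cosh (a - b) := by
    rw [Real.cosh_add, Real.cosh_sub]; ring
  rw [hrhs]
  refine hasSum_le (fun n => ?_) (Real.hasSum_cosh _)
    (((Real.hasSum_cosh (a + b)).mul_left ((1 + p) / 2)).add
      ((Real.hasSum_cosh (a - b)).mul_left ((1 - p) / 2)))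
  have hconv := (convexOn_pow (𝕜 := ℝ) n).2 (mem_Ici.2 (sq_nonneg (a + b)))
    (mem_Ici.2 (sq_nonneg (a - b))) (show 0 ≤ (1 + p) / 2 by linarith)
    (show 0 ≤ (1 - p) / 2 by linarith) (by ring)
  simp only [smul_eq_mul, ← hs', ← pow_mul] at hconv
  rw [pow_mul, Real.sq_sqrt hs0, ← mul_div_assoc, ← mul_div_assoc, ← add_div]
  gcongr

theorem exp_le_one_add_add_sq {b : ℝ} (h0 : 0 ≤ b) (h1 : b ≤ 1 / 2) :
    Real.exp b ≤ 1 + b + 2 / 3 * b ^ 2 := by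
  have h := Real.exp_bound' h0 (h1.trans (by norm_num)) (n := 3) (by norm_num)
  simp only [Finset.sum_range_succ, Finset.sum_range_zero] at h
  norm_num [Nat.factorial] at h
  nlinarith [mul_nonneg (sq_nonneg b) (sub_nonneg.2 h1)]

variable {G : Type*} [NormedAddCommGroup G] [InnerProductSpace ℝ G]

/-- The right side splits off a term linear in `ξ`, which vanishes in the mean. With `p` the cosine
of the angle, `cosh_sqrt_le` applies; replacing `sinh ‖ξ‖` by `‖ξ‖` in the `p`-term costs at most
`cosh ‖x‖ (sinh ‖ξ‖ - ‖ξ‖)`, and the remainder is `cosh ‖x‖ (e^b - b)` with `b = ‖ξ‖ ≤ 1/2`. -/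
theorem cosh_norm_add_le (x ξ : G) (hξ : ‖ξ‖ ≤ 1 / 2) :
    Real.cosh ‖x + ξ‖ ≤ Real.cosh ‖x‖ * (1 + 2 / 3 * ‖ξ‖ ^ 2) +
      Real.sinh ‖x‖ / ‖x‖ * ⟪x, ξ⟫_ℝ := by
  have hb0 := norm_nonneg ξ
  have hexp := exp_le_one_add_add_sq hb0 hξ
  have hcs := Real.cosh_add_sinh ‖ξ‖
  have hsb : ‖ξ‖ ≤ Real.sinh ‖ξ‖ := Real.self_le_sinh_iff.2 hb0
  rcases eq_or_ne x 0 with rfl | hx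
  · simp only [zero_add, norm_zero, Real.cosh_zero, inner_zero_left, mul_zero]
    linarith
  rcases eq_or_ne ξ 0 with rfl | hξ0
  · simp
  have ha : 0 < ‖x‖ := norm_pos_iff.2 hx
  have hb : 0 < ‖ξ‖ := norm_pos_iff.2 hξ0
  set p := ⟪x, ξ⟫_ℝ / (‖x‖ * ‖ξ‖) with hp
  have hp1 : |p| ≤ 1 := abs_real_inner_div_norm_mul_norm_le_one x ξ
  have hin : ⟪x, ξ⟫_ℝ = ‖x‖ * ‖ξ‖ * p := by rw [hp]; field_simp
  have hnorm : ‖x + ξ‖ = √(‖x‖ ^ 2 + ‖ξ‖ ^ 2 + 2 * (‖x‖ * ‖ξ‖ * p)) := by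
    rw [← hin, ← Real.sqrt_sq (norm_nonneg (x + ξ)), norm_add_sq_real]
    congr 1; ring
  rw [hnorm]
  refine (cosh_sqrt_le hp1).trans ?_
  rw [hin]
  have e : Real.sinh ‖x‖ / ‖x‖ * (‖x‖ * ‖ξ‖ * p) = p * (Real.sinh ‖x‖ * ‖ξ‖) := by field_simp
  rw [e]
  have h1 : p * (Real.sinh ‖x‖ * (Real.sinh ‖ξ‖ - ‖ξ‖)) ≤
      Real.cosh ‖x‖ * (Real.sinh ‖ξ‖ - ‖ξ‖) := by
    have h2 : 0 ≤ Real.sinh ‖x‖ := Real.sinh_nonneg_iff.2 ha.le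
    have h3 := (Real.sinh_lt_cosh ‖x‖).le
    have h4 : p * Real.sinh ‖x‖ ≤ Real.cosh ‖x‖ :=
      (mul_le_of_le_one_left h2 (abs_le.1 hp1).2).trans h3
    nlinarith [mul_le_mul_of_nonneg_right h4 (sub_nonneg.2 hsb)]
  have h5 : Real.cosh ‖x‖ * (Real.exp ‖ξ‖ - ‖ξ‖) ≤ Real.cosh ‖x‖ * (1 + 2 / 3 * ‖ξ‖ ^ 2) :=
    mul_le_mul_of_nonneg_left (by linarith) (Real.cosh_pos _).le
  rw [← hcs] at h5
  nlinarith

variable [CompleteSpace G] {Z : Type*} [MeasurableSpace Z] {μ : Measure Z} [IsProbabilityMeasure μ]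

theorem lintegral_cosh_norm_add_le {ξ : Z → G} (hξm : StronglyMeasurable ξ)
    (hξ : ∀ z, ‖ξ z‖ ≤ 1 / 2) (h0 : ∫ z, ξ z ∂μ = 0) {v : ℝ} (hv : ∫ z, ‖ξ z‖ ^ 2 ∂μ ≤ v) (x : G) :
    ∫⁻ z, ENNReal.ofReal (Real.cosh ‖x + ξ z‖) ∂μ ≤
      ENNReal.ofReal (Real.cosh ‖x‖ * Real.exp (2 / 3 * v)) := by
  have hint : Integrable ξ μ :=
    Integrable.of_bound hξm.aestronglyMeasurable (1 / 2) (Filter.Eventually.of_forall hξ)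
  have hint2 : Integrable (fun z => ‖ξ z‖ ^ 2) μ :=
    Integrable.of_bound (hξm.norm.pow 2).aestronglyMeasurable ((1 / 2) ^ 2)
      (Filter.Eventually.of_forall fun z => by
        rw [Real.norm_of_nonneg (by positivity)]; gcongr; exact hξ z)
  set h : Z → ℝ := fun z => Real.cosh ‖x‖ * (1 + 2 / 3 * ‖ξ z‖ ^ 2) +
      Real.sinh ‖x‖ / ‖x‖ * ⟪x, ξ z⟫_ℝ with hh
  have hle : ∀ z, Real.cosh ‖x + ξ z‖ ≤ h z := fun z => cosh_norm_add_le x (ξ z) (hξ z)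
  have hi1 : Integrable (fun z => Real.cosh ‖x‖ * (1 + 2 / 3 * ‖ξ z‖ ^ 2)) μ :=
    ((integrable_const _).add (hint2.const_mul _)).const_mul _
  have hi2 : Integrable (fun z => Real.sinh ‖x‖ / ‖x‖ * ⟪x, ξ z⟫_ℝ) μ :=
    (hint.const_inner x).const_mul _
  have hhi : Integrable h μ := hi1.add hi2
  calc ∫⁻ z, ENNReal.ofReal (Real.cosh ‖x + ξ z‖) ∂μ
      ≤ ∫⁻ z, ENNReal.ofReal (h z) ∂μ :=
        lintegral_mono fun z => ENNReal.ofReal_le_ofReal (hle z)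
    _ = ENNReal.ofReal (∫ z, h z ∂μ) := (ofReal_integral_eq_lintegral_ofReal hhi
        (Filter.Eventually.of_forall fun z => (Real.cosh_pos _).le.trans (hle z))).symm
    _ ≤ _ := by
        refine ENNReal.ofReal_le_ofReal ?_
        rw [hh, integral_add hi1 hi2, integral_const_mul, integral_const_mul,
          integral_add (integrable_const _) (hint2.const_mul _), integral_const_mul,
          integral_inner hint, h0, inner_zero_right, mul_zero, add_zero]
        refine mul_le_mul_of_nonneg_left ?_ (Real.cosh_pos _).le
        simp only [integral_const, probReal_univ, smul_eq_mul, one_mul]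
        have := Real.add_one_le_exp (2 / 3 * v)
        linarith

/-- The starting point `x` is arbitrary so that Fubini can move one sample at a time into it. -/
theorem lintegral_cosh_norm_sum_le {ξ : Z → G} (hξm : StronglyMeasurable ξ)
    (hξ : ∀ z, ‖ξ z‖ ≤ 1 / 2) (h0 : ∫ z, ξ z ∂μ = 0) {v : ℝ} (hv : ∫ z, ‖ξ z‖ ^ 2 ∂μ ≤ v)
    (m : ℕ) (x : G) :
    ∫⁻ ω : Fin m → Z, ENNReal.ofReal (Real.cosh ‖x + ∑ k, ξ (ω k)‖) ∂Measure.pi (fun _ => μ) ≤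
      ENNReal.ofReal (Real.cosh ‖x‖ * Real.exp (2 / 3 * v) ^ m) := by
  induction m generalizing x with
  | zero => simp
  | succ m ih =>
    have hmp := measurePreserving_piFinSuccAbove (fun _ : Fin (m + 1) => μ) 0
    have hmeas : Measurable fun p : Z × (Fin m → Z) =>
        ENNReal.ofReal (Real.cosh ‖x + ξ p.1 + ∑ k, ξ (p.2 k)‖) := by
      have h1 : StronglyMeasurable fun p : Z × (Fin m → Z) => x + ξ p.1 + ∑ k, ξ (p.2 k) := by
        refine (stronglyMeasurable_const.add (hξm.comp_measurable measurable_fst)).add ?_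
        exact Finset.stronglyMeasurable_fun_sum _ fun k _ =>
          hξm.comp_measurable ((measurable_pi_apply k).comp measurable_snd)
      exact (Real.continuous_cosh.measurable.comp h1.norm.measurable).ennreal_ofReal
    calc ∫⁻ ω : Fin (m + 1) → Z, ENNReal.ofReal (Real.cosh ‖x + ∑ k, ξ (ω k)‖)
          ∂Measure.pi (fun _ => μ)
        = ∫⁻ p : Z × (Fin m → Z), ENNReal.ofReal (Real.cosh ‖x + ξ p.1 + ∑ k, ξ (p.2 k)‖)
            ∂(μ.prod (Measure.pi fun _ => μ)) := by
          rw [← hmp.lintegral_comp hmeas]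
          refine lintegral_congr fun ω => ?_
          simp [Fin.sum_univ_succ, MeasurableEquiv.piFinSuccAbove, add_assoc, Fin.tail,
            Fin.insertNthEquiv]
      _ = ∫⁻ z, ∫⁻ ω : Fin m → Z, ENNReal.ofReal (Real.cosh ‖x + ξ z + ∑ k, ξ (ω k)‖)
            ∂(Measure.pi fun _ => μ) ∂μ := lintegral_prod _ hmeas.aemeasurable
      _ ≤ ∫⁻ z, ENNReal.ofReal (Real.exp (2 / 3 * v) ^ m) *
            ENNReal.ofReal (Real.cosh ‖x + ξ z‖) ∂μ := by
          refine lintegral_mono fun z => (ih (x + ξ z)).trans_eq ?_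
          rw [mul_comm, ENNReal.ofReal_mul (by positivity)]
      _ ≤ ENNReal.ofReal (Real.exp (2 / 3 * v) ^ m) *
            ENNReal.ofReal (Real.cosh ‖x‖ * Real.exp (2 / 3 * v)) := by
          rw [lintegral_const_mul' _ _ ENNReal.ofReal_ne_top]
          gcongr
          exact lintegral_cosh_norm_add_le hξm hξ h0 hv x
      _ = _ := by
          rw [← ENNReal.ofReal_mul (by positivity)]
          congr 1; ring

/-- An exponential tail bound of Bernstein–Pinelis type for sums of independent bounded centred
vectors in a Hilbert space. -/
theorem measure_norm_sum_ge_le {ξ : Z → G} (hξm : StronglyMeasurable ξ) {B : ℝ}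
    (hξ : ∀ z, ‖ξ z‖ ≤ B) (h0 : ∫ z, ξ z ∂μ = 0) {v : ℝ} (hv : ∫ z, ‖ξ z‖ ^ 2 ∂μ ≤ v)
    (m : ℕ) {l : ℝ} (hl : 0 ≤ l) (hlB : l * B ≤ 1 / 2) (R : ℝ) :
    Measure.pi (fun _ => μ) {ω : Fin m → Z | R ≤ ‖∑ k, ξ (ω k)‖} ≤
      ENNReal.ofReal (2 * Real.exp (2 / 3 * (m * l ^ 2 * v) - l * R)) := by
  have hmom := lintegral_cosh_norm_sum_le (μ := μ) (ξ := fun z => l • ξ z) (hξm.const_smul l)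
    (fun z => by
      rw [norm_smul, Real.norm_of_nonneg hl]
      exact (mul_le_mul_of_nonneg_left (hξ z) hl).trans hlB)
    (by rw [integral_smul, h0, smul_zero]) (v := l ^ 2 * v)
    (by
      simp_rw [norm_smul, mul_pow, Real.norm_eq_abs, sq_abs]
      rw [integral_const_mul]
      gcongr) m 0
  simp only [zero_add, norm_zero, Real.cosh_zero, one_mul, ← Finset.smul_sum, norm_smul,
    Real.norm_of_nonneg hl, ← Real.exp_nat_mul] at hmom
  have hmeas : AEMeasurable (fun ω : Fin m → Z => ENNReal.ofReal (Real.cosh (l * ‖∑ k, ξ (ω k)‖)))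
      (Measure.pi fun _ => μ) := by
    have h1 : StronglyMeasurable fun ω : Fin m → Z => ∑ k, ξ (ω k) :=
      Finset.stronglyMeasurable_fun_sum _ fun k _ => hξm.comp_measurable (measurable_pi_apply k)
    exact (Real.continuous_cosh.measurable.comp
      (h1.norm.measurable.const_mul l)).ennreal_ofReal.aemeasurable
  have hmark := mul_meas_ge_le_lintegral₀ hmeas (ENNReal.ofReal (Real.exp (l * R) / 2))
  -- Markov's inequality is applied to `cosh y ≥ e^y / 2`, whence the factor `2` in the tail.
  have hsub : {ω : Fin m → Z | R ≤ ‖∑ k, ξ (ω k)‖} ⊆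
      {ω | ENNReal.ofReal (Real.exp (l * R) / 2) ≤
        ENNReal.ofReal (Real.cosh (l * ‖∑ k, ξ (ω k)‖))} := by
    intro ω hω
    refine ENNReal.ofReal_le_ofReal ?_
    have h1 : Real.exp (l * R) ≤ Real.exp (l * ‖∑ k, ξ (ω k)‖) :=
      Real.exp_le_exp.2 (mul_le_mul_of_nonneg_left hω hl)
    rw [Real.cosh_eq]
    have := Real.exp_pos (-(l * ‖∑ k, ξ (ω k)‖))
    linarith
  have hpos : 0 < Real.exp (l * R) / 2 := by positivity
  calc Measure.pi (fun _ => μ) {ω : Fin m → Z | R ≤ ‖∑ k, ξ (ω k)‖}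
      ≤ _ := measure_mono hsub
    _ ≤ ENNReal.ofReal (Real.exp (m * (2 / 3 * (l ^ 2 * v)))) /
          ENNReal.ofReal (Real.exp (l * R) / 2) := by
        rw [ENNReal.le_div_iff_mul_le (Or.inl (by simpa using hpos))
          (Or.inl ENNReal.ofReal_ne_top), mul_comm]
        exact hmark.trans hmom
    _ = _ := by
        rw [← ENNReal.ofReal_div_of_pos hpos, Real.exp_sub]
        congr 1
        rw [show 2 / 3 * (m * l ^ 2 * v) = m * (2 / 3 * (l ^ 2 * v)) by ring]
        field_simp

end Bernstein

/-! ### Concentration of empirical covariance operators. -/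

section Covariance

variable {H H' : Type*} [NormedAddCommGroup H] [InnerProductSpace ℝ H] [CompleteSpace H]
  [NormedAddCommGroup H'] [InnerProductSpace ℝ H']
  {Z : Type*} [MeasurableSpace Z] {μ : Measure Z} [IsProbabilityMeasure μ]

open TensorProduct in
/-- Concentration of empirical covariance operators around their mean. -/
theorem measure_norm_empirical_sub_ge_le {a : Z → H} {b : Z → H'} (ha : StronglyMeasurable a)
    (hb : StronglyMeasurable b) {K q : ℝ} (hKa : ∀ z, ‖a z‖ ^ 2 ≤ K) (hKb : ∀ z, ‖b z‖ ^ 2 ≤ K)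
    (hq : ∫ z, ‖a z‖ ^ 2 ∂μ = q) (hq0 : 0 < q) (hqK : q ≤ K) {s : ℝ} (hs : 0 ≤ s) (hsq : s ≤ q / 3)
    {m : ℕ} (hm : 0 < m) :
    Measure.pi (fun _ => μ) {ω : Fin m → Z |
        s < ‖(m : ℝ)⁻¹ • ∑ k, InnerProductSpace.rankOne ℝ (a (ω k)) (b (ω k)) -
          ∫ z, InnerProductSpace.rankOne ℝ (a z) (b z) ∂μ‖} ≤
      ENNReal.ofReal (2 * Real.exp (-(3 * m * s ^ 2 / (8 * q * K)))) := by
  have hK : 0 < K := hq0.trans_le hqK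
  -- The Bernstein bound needs a Hilbert norm, so `a ⊗ b` is taken as a vector of the completed
  -- tensor product; its norm is the Hilbert–Schmidt norm and dominates the operator norm.
  let G := UniformSpace.Completion (H ⊗[ℝ] H')
  let ζ : Z → G := fun z => ((a z ⊗ₜ[ℝ] b z : H ⊗[ℝ] H') : G)
  have hζn : ∀ z, ‖ζ z‖ = ‖a z‖ * ‖b z‖ := fun z =>
    (UniformSpace.Completion.norm_coe _).trans (TensorProduct.norm_tmul _ _)
  have hζm : StronglyMeasurable ζ :=
    ((UniformSpace.Completion.continuous_coe _).comp
      (TensorProduct.continuous_tmul (𝕜 := ℝ) (E := H) (F := H'))).comp_stronglyMeasurable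
      (ha.prodMk hb)
  have hK' : √K * √K = K := Real.mul_self_sqrt hK.le
  have han : ∀ z, ‖a z‖ ≤ √K := fun z => Real.le_sqrt_of_sq_le (hKa z)
  have hbn : ∀ z, ‖b z‖ ≤ √K := fun z => Real.le_sqrt_of_sq_le (hKb z)
  have hζK : ∀ z, ‖ζ z‖ ≤ K := fun z => by
    rw [hζn, ← hK']
    exact mul_le_mul (han z) (hbn z) (norm_nonneg _) (Real.sqrt_nonneg _)
  have hζi : Integrable ζ μ :=
    Integrable.of_bound hζm.aestronglyMeasurable K (Filter.Eventually.of_forall hζK)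
  set E : G := ∫ z, ζ z ∂μ with hE
  have hEK : ‖E‖ ≤ K := by
    have := norm_integral_le_of_norm_le_const (μ := μ) (Filter.Eventually.of_forall hζK)
    simpa using this
  let ξ : Z → G := fun z => ζ z - E
  have hξm : StronglyMeasurable ξ := hζm.sub stronglyMeasurable_const
  have hξB : ∀ z, ‖ξ z‖ ≤ 2 * K := fun z => by
    refine (norm_sub_le _ _).trans ?_
    linarith [hζK z]
  have hξ0 : ∫ z, ξ z ∂μ = 0 := by
    rw [integral_sub hζi (integrable_const _)]
    simp [hE]
  have hζi2 : Integrable (fun z => ‖ζ z‖ ^ 2) μ :=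
    Integrable.of_bound (hζm.norm.pow 2).aestronglyMeasurable (K ^ 2)
      (Filter.Eventually.of_forall fun z => by
        rw [Real.norm_of_nonneg (by positivity)]; gcongr; exact hζK z)
  have hai2 : Integrable (fun z => ‖a z‖ ^ 2) μ :=
    Integrable.of_bound (ha.norm.pow 2).aestronglyMeasurable K
      (Filter.Eventually.of_forall fun z => by
        rw [Real.norm_of_nonneg (by positivity)]; exact hKa z)
  -- Bounding only `‖b‖²` by `K` and integrating `‖a‖²` gives the variance `q K` in place of `K²`.
  have hvar : ∫ z, ‖ξ z‖ ^ 2 ∂μ ≤ q * K := by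
    have h1 : ∀ z, ‖ξ z‖ ^ 2 = ‖ζ z‖ ^ 2 - 2 * ⟪E, ζ z⟫_ℝ + ‖E‖ ^ 2 := fun z => by
      rw [norm_sub_sq_real, real_inner_comm]
    have h2 : ∫ z, ‖ξ z‖ ^ 2 ∂μ = ∫ z, ‖ζ z‖ ^ 2 ∂μ - ‖E‖ ^ 2 := by
      simp_rw [h1]
      have hi : Integrable (fun z => 2 * ⟪E, ζ z⟫_ℝ) μ := (hζi.const_inner E).const_mul 2
      rw [integral_add (f := fun z => ‖ζ z‖ ^ 2 - 2 * ⟪E, ζ z⟫_ℝ) (hζi2.sub hi)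
        (integrable_const _), integral_sub hζi2 hi, integral_const_mul, integral_inner hζi, ← hE, real_inner_self_eq_norm_sq]
      simp
      ring
    rw [h2]
    have h3 : ∫ z, ‖ζ z‖ ^ 2 ∂μ ≤ q * K := by
      rw [← hq, ← integral_mul_const]
      refine integral_mono hζi2 (hai2.mul_const K) fun z => ?_
      simp only [hζn, mul_pow]
      exact mul_le_mul_of_nonneg_left (hKb z) (sq_nonneg _)
    linarith [sq_nonneg ‖E‖]
  have hm' : (0 : ℝ) < m := Nat.cast_pos.2 hm
  have hri : Integrable (fun z => InnerProductSpace.rankOne ℝ (a z) (b z)) μ := by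
    refine Integrable.of_bound ?_ K (Filter.Eventually.of_forall fun z => ?_)
    · have hc : Continuous fun p : H × H' => InnerProductSpace.rankOne ℝ p.1 p.2 :=
        ((InnerProductSpace.rankOne ℝ).continuous.comp continuous_fst).clm_apply continuous_snd
      exact (hc.comp_stronglyMeasurable (ha.prodMk hb)).aestronglyMeasurable
    · rw [InnerProductSpace.norm_rankOne, ← hζn]
      exact hζK z
  -- The matrix coefficient `⟪D w, u⟫` is the pairing of the tensor mean with `u ⊗ w`; taking `u = D
  -- w` compares the norms.
  have hkey : ∀ ω : Fin m → Z, ‖(m : ℝ)⁻¹ • ∑ k, InnerProductSpace.rankOne ℝ (a (ω k)) (b (ω k)) -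
      ∫ z, InnerProductSpace.rankOne ℝ (a z) (b z) ∂μ‖ ≤ (m : ℝ)⁻¹ * ‖∑ k, ξ (ω k)‖ := by
    intro ω
    set D := (m : ℝ)⁻¹ • ∑ k, InnerProductSpace.rankOne ℝ (a (ω k)) (b (ω k)) -
      ∫ z, InnerProductSpace.rankOne ℝ (a z) (b z) ∂μ with hD
    have hDi : ∀ (u : H) (w : H'), ⟪D w, u⟫_ℝ =
        ⟪(m : ℝ)⁻¹ • ∑ k, ξ (ω k), ((u ⊗ₜ[ℝ] w : H ⊗[ℝ] H') : G)⟫_ℝ := by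
      intro u w
      have hζin : ∀ z, ⟪ζ z, ((u ⊗ₜ[ℝ] w : H ⊗[ℝ] H') : G)⟫_ℝ = ⟪a z, u⟫_ℝ * ⟪b z, w⟫_ℝ :=
        fun z => (UniformSpace.Completion.inner_coe _ _).trans (TensorProduct.inner_tmul _ _ _ _ _)
      have hEin : ⟪E, ((u ⊗ₜ[ℝ] w : H ⊗[ℝ] H') : G)⟫_ℝ =
          ⟪(∫ z, InnerProductSpace.rankOne ℝ (a z) (b z) ∂μ) w, u⟫_ℝ := by
        rw [ContinuousLinearMap.integral_apply hri, real_inner_comm, hE, ← integral_inner hζi,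
          real_inner_comm, ← integral_inner (hri.apply_continuousLinearMap w)]
        refine integral_congr_ae (Filter.Eventually.of_forall fun z => ?_)
        simp only [InnerProductSpace.rankOne_apply, real_inner_smul_right]
        rw [real_inner_comm, hζin, real_inner_comm (a z), mul_comm]
      have hsum : (m : ℝ)⁻¹ • ∑ k, ξ (ω k) = (m : ℝ)⁻¹ • ∑ k, ζ (ω k) - E := by
        simp only [ξ, Finset.sum_sub_distrib, Finset.sum_const, Finset.card_univ,
          Fintype.card_fin, smul_sub]
        rw [← Nat.cast_smul_eq_nsmul ℝ, smul_smul, inv_mul_cancel₀ hm'.ne', one_smul]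
      rw [hsum, inner_sub_left, hEin, hD, sub_apply, inner_sub_left]
      congr 1
      rw [real_inner_smul_left, sum_inner]
      simp only [hζin, smul_apply, sum_apply, InnerProductSpace.rankOne_apply,
        real_inner_smul_left, sum_inner]
      congr 1
      exact Finset.sum_congr rfl fun k _ => mul_comm _ _
    have hn : ‖(m : ℝ)⁻¹ • ∑ k, ξ (ω k)‖ = (m : ℝ)⁻¹ * ‖∑ k, ξ (ω k)‖ := by
      rw [norm_smul, Real.norm_of_nonneg (by positivity)]
    rw [← hn]
    refine ContinuousLinearMap.opNorm_le_bound _ (norm_nonneg _) fun w => ?_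
    rcases eq_or_ne (D w) 0 with h | h
    · rw [h, norm_zero]; positivity
    · have h1 : ‖D w‖ * ‖D w‖ ≤ ‖(m : ℝ)⁻¹ • ∑ k, ξ (ω k)‖ * ‖w‖ * ‖D w‖ := by
        rw [← real_inner_self_eq_norm_mul_norm, hDi]
        refine (real_inner_le_norm _ _).trans_eq ?_
        rw [UniformSpace.Completion.norm_coe, TensorProduct.norm_tmul]
        ring
      exact le_of_mul_le_mul_right h1 (norm_pos_iff.2 h)
  -- This `l` minimises the exponent `(2/3) m l² q K - l m s`; its admissibility `l · 2K ≤ 1/2` is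
  -- exactly `s ≤ q / 3`.
  refine (measure_mono (t := {ω : Fin m → Z | m * s ≤ ‖∑ k, ξ (ω k)‖}) fun ω hω => ?_).trans
    ((measure_norm_sum_ge_le hξm hξB hξ0 hvar m (l := 3 * s / (4 * q * K)) (by positivity) ?_
      (m * s)).trans_eq ?_)
  · have h1 : s ≤ (m : ℝ)⁻¹ * ‖∑ k, ξ (ω k)‖ := (le_of_lt hω).trans (hkey ω)
    rwa [inv_mul_eq_div, le_div_iff₀ hm', mul_comm] at h1
  · rw [div_mul_eq_mul_div, div_le_iff₀ (by positivity)]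
    nlinarith [mul_le_mul_of_nonneg_right hsq hK.le]
  · congr 3
    field_simp
    ring

end Covariance

/-! ### Projection, truncation error and pseudo-inverse perturbation, for fixed operators. -/

section Truncation

variable {H H' L : Type*} [NormedAddCommGroup H] [InnerProductSpace ℝ H] [CompleteSpace H]
  [NormedAddCommGroup H'] [InnerProductSpace ℝ H']
  [NormedAddCommGroup L] [InnerProductSpace ℝ L]

/-- The part of `η` outside the range of the projection is again an eigenvector for `λ_j`, but there
`C` has norm at most `λ_{r+1} < λ_j`. So all eigenvectors for the top eigenvalues lie in the span of
the chosen `v`. -/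
theorem IsTopEigen.proj_eq_self {C : H →L[ℝ] H} (hC : IsCompactOperator C) (hp : C.IsPositive)
    {r : ℕ} {v : Fin r → H} (hv : IsTopEigen C r v) (hgap : eigval C (r + 1) < eigval C r)
    {j : ℕ} (hj1 : 1 ≤ j) (hjr : j ≤ r) {η : H} (hη : C η = eigval C j • η) :
    diagOp v (fun _ => 1) η = η := by
  have hpos : 0 < eigval C r := (eigval_nonneg hp _).trans_lt hgap
  have hs := hv.isSpectralSplit hC hp hpos
  set P := diagOp v fun _ => (1 : ℝ) with hP
  have hPC : C * P = P * C := by rw [← hs.mul_left, ← mul_assoc, hs.mul_right, hs.mul_left]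
  have hw : C ((1 - P) η) = eigval C j • (1 - P) η := by
    have h1 : C (P η) = P (C η) := congrArg (fun T : H →L[ℝ] H => T η) hPC
    rw [sub_apply, one_apply_eq_self, map_sub, h1, hη, map_smul, smul_sub]
  have h2 := hv.norm_apply_le hC hp (inner_sub_diagOp_one hv.1 η)
  rw [← hP, hw, norm_smul, Real.norm_of_nonneg (eigval_nonneg hp _)] at h2
  have h3 : eigval C (r + 1) < eigval C j := hgap.trans_le (eigval_anti hp hj1 hjr)
  have h4 : (1 - P) η = 0 := by
    by_contra h
    exact absurd (le_of_mul_le_mul_right h2 (norm_pos_iff.2 h)) (not_le.2 h3)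
  rw [sub_apply, one_apply_eq_self, sub_eq_zero] at h4
  exact h4.symm

/-- If `S* S = C`, the projection onto the span of the images of the top eigenvectors of `C` is
given by the truncated pseudo-inverse of `C`. -/
theorem IsTopEigen.starProjection_eq [CompleteSpace L] {C : H →L[ℝ] H} (hC : IsCompactOperator C)
    (hp : C.IsPositive) {S : H →L[ℝ] L} (hS : ∀ f g, ⟪S f, S g⟫_ℝ = ⟪C f, g⟫_ℝ) {r : ℕ}
    {v : Fin r → H} (hv : IsTopEigen C r v)
    (hgap : eigval C (r + 1) < eigval C r) {κ : L} {d : H} (hκ : ∀ f, ⟪S f, κ⟫_ℝ = ⟪f, d⟫_ℝ) :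
    (Submodule.span ℝ {g : L | ∃ j : ℕ, 1 ≤ j ∧ j ≤ r ∧ ∃ η : H, C η = eigval C j • η ∧
      g = S η}).topologicalClosure.starProjection κ =
      S (diagOp v (fun j => (eigval C (j + 1))⁻¹) d) := by
  have hpos : 0 < eigval C r := (eigval_nonneg hp _).trans_lt hgap
  have hs := hv.isSpectralSplit hC hp hpos
  set P := diagOp v fun _ => (1 : ℝ) with hP
  refine Submodule.eq_starProjection_of_mem_orthogonal ?_ ?_
  · refine Submodule.le_topologicalClosure _ ?_
    rw [diagOp_apply, map_sum]
    refine Submodule.sum_mem _ fun j _ => ?_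
    rw [map_smul]
    exact Submodule.smul_mem _ _ (Submodule.subset_span
      ⟨j + 1, Nat.le_add_left 1 _, j.2, v j, hv.2 j, rfl⟩)
  -- Writing `d = S* κ`, the residual pairs with `S η` as `⟪η, d - C X d⟫ = ⟪η, (1 - P) d⟫`, which
  -- is `0` since `P η = η`.
  · rw [Submodule.orthogonal_closure, Submodule.mem_orthogonal]
    intro u hu
    induction hu using Submodule.span_induction with
    | mem u hu =>
      obtain ⟨j, hj1, hjr, η, hη, rfl⟩ := hu
      have hPη := hv.proj_eq_self hC hp hgap hj1 hjr hη
      have hsym : ∀ z, ⟪C η, z⟫_ℝ = ⟪η, C z⟫_ℝ := fun z => hp.isSymmetric η z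
      have hCX : C (diagOp v (fun j => (eigval C (j + 1))⁻¹) d) = P d :=
        congrArg (fun T : H →L[ℝ] H => T d) hs.mul_right
      rw [inner_sub_right, hκ, hS, hsym, hCX, ← inner_sub_right, ← hPη, diagOp_apply, sum_inner]
      refine Finset.sum_eq_zero fun i _ => ?_
      have := inner_sub_diagOp_one hv.1 d i
      rw [sub_apply, one_apply_eq_self] at this
      rw [real_inner_smul_left, this, mul_zero]
    | zero => rw [inner_zero_left]
    | add a b _ _ ha hb => rw [inner_add_left, ha, hb, add_zero]
    | smul a b _ hb => rw [real_inner_smul_left, hb, mul_zero]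

/-- Here `‖S X d‖² = ⟪C X d, X d⟫ = ⟪P d, X d⟫`, so only one inverse eigenvalue enters the square.
-/
theorem IsTopEigen.norm_comp_pinv_le {C : H →L[ℝ] H} (hC : IsCompactOperator C)
    (hp : C.IsPositive) {S : H →L[ℝ] L} (hS : ∀ f g, ⟪S f, S g⟫_ℝ = ⟪C f, g⟫_ℝ) {r : ℕ}
    {v : Fin r → H} (hv : IsTopEigen C r v) (hpos : 0 < eigval C r) (d : H) :
    ‖S (diagOp v (fun j => (eigval C (j + 1))⁻¹) d)‖ ≤ 1 / √(eigval C r) * ‖d‖ := by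
  have hs := hv.isSpectralSplit hC hp hpos
  set X := diagOp v fun j => (eigval C (j + 1))⁻¹ with hX
  set P := diagOp v fun _ => (1 : ℝ) with hP
  have hCX : C (X d) = P d := congrArg (fun T : H →L[ℝ] H => T d) hs.mul_right
  have h1 : ‖S (X d)‖ ^ 2 ≤ (1 / √(eigval C r) * ‖d‖) ^ 2 := by
    rw [← real_inner_self_eq_norm_sq, hS, hCX, mul_pow, div_pow, Real.sq_sqrt hpos.le]
    calc ⟪P d, X d⟫_ℝ ≤ ‖P d‖ * ‖X d‖ := real_inner_le_norm _ _
      _ ≤ (1 * ‖d‖) * ((eigval C r)⁻¹ * ‖d‖) := mul_le_mul (P.le_of_opNorm_le hs.norm_proj d)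
          (X.le_of_opNorm_le hs.norm_inv d) (norm_nonneg _) (by positivity)
      _ = _ := by ring
  exact abs_le_of_sq_le_sq' h1 (by positivity) |>.2

/-- The difference is `S (1 - P) η`, and its squared norm is the quadratic form of `C` on the
complement of the top eigenvectors. -/
theorem IsTopEigen.norm_sub_starProjection_le [CompleteSpace L] {C : H →L[ℝ] H} (hC : IsCompactOperator C)
    (hp : C.IsPositive) {S : H →L[ℝ] L} (hS : ∀ f g, ⟪S f, S g⟫_ℝ = ⟪C f, g⟫_ℝ) {r : ℕ}
    {v : Fin r → H} (hv : IsTopEigen C r v)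
    (hgap : eigval C (r + 1) < eigval C r) (η : H) :
    ‖S η - (Submodule.span ℝ {g : L | ∃ j : ℕ, 1 ≤ j ∧ j ≤ r ∧ ∃ η : H, C η = eigval C j • η ∧
      g = S η}).topologicalClosure.starProjection (S η)‖ ≤ √(eigval C (r + 1)) * ‖η‖ := by
  have hpos : 0 < eigval C r := (eigval_nonneg hp _).trans_lt hgap
  have hs := hv.isSpectralSplit hC hp hpos
  rw [hv.starProjection_eq hC hp hS hgap (d := C η)
    (fun f => (hS f η).trans (hp.isSymmetric f η))]
  set X := diagOp v fun j => (eigval C (j + 1))⁻¹ with hX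
  set P := diagOp v fun _ => (1 : ℝ) with hP
  have hXC : X (C η) = P η := congrArg (fun T : H →L[ℝ] H => T η) hs.mul_left
  have he : S η - S (X (C η)) = S ((1 - P) η) := by
    rw [hXC, sub_apply, one_apply_eq_self, map_sub]
  rw [he]
  have h1 : ‖(1 - P) η‖ ≤ ‖η‖ := by simpa using (1 - P).le_of_opNorm_le hs.norm_compl η
  have h2 : ‖S ((1 - P) η)‖ ^ 2 ≤ (√(eigval C (r + 1)) * ‖η‖) ^ 2 := by
    rw [← real_inner_self_eq_norm_sq, hS, mul_pow, Real.sq_sqrt (eigval_nonneg hp _)]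
    calc ⟪C ((1 - P) η), (1 - P) η⟫_ℝ ≤ ‖C ((1 - P) η)‖ * ‖(1 - P) η‖ := real_inner_le_norm _ _
      _ ≤ (eigval C (r + 1) * ‖(1 - P) η‖) * ‖(1 - P) η‖ := by
          gcongr
          exact hv.norm_apply_le hC hp (inner_sub_diagOp_one hv.1 η)
      _ ≤ (eigval C (r + 1) * ‖η‖) * ‖η‖ := by
          have := eigval_nonneg hp (r + 1)
          gcongr
      _ = _ := by ring
  exact abs_le_of_sq_le_sq' h2 (by positivity) |>.2

/-- From `s ≤ (3/5) δ` and `2 δ ≤ a - a'`, both separations stay at least `(7/5) δ` and `b ≥ (7/10)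
a`. The three terms add up to `120/49 < 49/20` times `s / (δ a)`. -/
theorem truncation_constant_le {a a' b b' s ε δ : ℝ} (hδ : 0 < δ) (ha' : 0 ≤ a') (hs0 : 0 ≤ s)
    (hsε : s ≤ 3 / 5 * ε) (hεδ : ε ≤ δ) (hgap : 2 * δ ≤ a - a') (hb : a - s ≤ b)
    (hb' : b' ≤ a' + s) :
    0 < b ∧ b' < a ∧ a' < b ∧
      s / (a * b) + s / (a * (a - b')) + s / (b * (b - a')) ≤ 49 / 20 * (s / (δ * a)) := by
  have ha : 0 < a := by linarith
  have hb1 : 7 / 10 * a ≤ b := by linarith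
  have hb2 : 7 / 5 * δ ≤ b := by linarith
  have hb0 : 0 < b := by linarith
  have h1 : 7 / 5 * δ ≤ a - b' := by linarith
  have h2 : 7 / 5 * δ ≤ b - a' := by linarith
  refine ⟨by linarith, by linarith, by linarith, ?_⟩
  calc s / (a * b) + s / (a * (a - b')) + s / (b * (b - a'))
      ≤ s / (a * (7 / 5 * δ)) + s / (a * (7 / 5 * δ)) + s / (7 / 10 * a * (7 / 5 * δ)) := by
        gcongr
    _ = (5 / 7 + 5 / 7 + 50 / 49) * (s / (δ * a)) := by field_simp; ring
    _ ≤ 49 / 20 * (s / (δ * a)) := by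
        refine mul_le_mul_of_nonneg_right (by norm_num) (by positivity)

/-- The deterministic error bound for the truncated estimator `[Ĉ]_r^† D̂` of `[C]_r^† D`. -/
theorem norm_comp_pinv_sub_le {C B : H →L[ℝ] H} (hC : IsCompactOperator C) (hCp : C.IsPositive)
    (hB : IsCompactOperator B) (hBp : B.IsPositive) {S : H →L[ℝ] L}
    (hS : ∀ f g, ⟪S f, S g⟫_ℝ = ⟪C f, g⟫_ℝ) {r : ℕ} (hr : 1 ≤ r) {v w : Fin r → H}
    (hv : IsTopEigen C r v) {q K s ε δ t : ℝ} (hq0 : 0 < q) (hqK : q ≤ K)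
    (hSq : ∀ f, ‖S f‖ ≤ √q * ‖f‖) (hs : s = ε * √(q / (3 * K))) (hε : 0 < ε) (hεδ : ε < δ)
    (hgap : 2 * δ ≤ eigval C r - eigval C (r + 1)) (hrq : eigval C r ≤ q) (hqt : q ≤ t)
    (hBC : ‖B - C‖ ≤ s) :
    0 < eigval B r ∧ (IsTopEigen B r w → ∀ D D' : H' →L[ℝ] H, ‖D‖ ≤ √(q * K) → ‖D' - D‖ ≤ s → ∀ ψ,
      ‖S (diagOp v (fun j => (eigval C (j + 1))⁻¹) (D ψ) -
        diagOp w (fun j => (eigval B (j + 1))⁻¹) (D' ψ))‖ ≤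
      (1 / √(eigval C r) + (r + 1) / (δ * eigval C r) * (1 + t) * √q) * ε * ‖ψ‖) := by
  have hK : 0 < K := hq0.trans_le hqK
  have hδ : 0 < δ := hε.trans hεδ
  have hs0 : 0 ≤ s := by rw [hs]; positivity
  have hsqrt : √(q / (3 * K)) ≤ 29 / 50 := by
    rw [Real.sqrt_le_left (by norm_num), div_le_iff₀ (by positivity)]
    nlinarith
  have hsε : s ≤ 29 / 50 * ε := by rw [hs]; nlinarith
  have h0 := eigval_nonneg hCp (r + 1)
  have hBC' : ‖C - B‖ ≤ s := by rwa [norm_sub_rev]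
  have hb := eigval_le_add_norm_sub (A := C) hB hBp hr
  have hb' := eigval_le_add_norm_sub (A := B) hC hCp (Nat.le_add_left 1 r)
  obtain ⟨hbpos, hba, hab, hconst⟩ := truncation_constant_le hδ h0 hs0
    (show s ≤ 3 / 5 * ε by linarith) hεδ.le hgap (b := eigval B r) (b' := eigval B (r + 1))
    (by linarith) (by linarith)
  have hpos : 0 < eigval C r := by linarith
  refine ⟨hbpos, fun hw D D' hD hDD ψ => ?_⟩
  have hX := hv.isSpectralSplit hC hCp hpos
  have hY := hw.isSpectralSplit hB hBp hbpos
  have hXY := (hX.norm_pinv_sub_le hY hpos hbpos hba hab hBC).trans hconst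
  set X := diagOp v fun j => (eigval C (j + 1))⁻¹ with hXdef
  set Y := diagOp w fun j => (eigval B (j + 1))⁻¹ with hYdef
  -- The first term carries the exact pseudo-inverse and yields `λ_r^{-1/2}`; the second yields the
  -- term of `c_r` with the spectral gap.
  have e : X (D ψ) - Y (D' ψ) = -X ((D' - D) ψ) + (X - Y) (D' ψ) := by
    simp only [sub_apply, map_sub]
    abel
  have hD' : ‖D'‖ ≤ √(q * K) + s := by
    calc ‖D'‖ = ‖D + (D' - D)‖ := by rw [add_sub_cancel]
      _ ≤ _ := (norm_add_le _ _).trans (add_le_add hD hDD)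
  -- The choice of `s` cancels `K`: `s √(q K) = ε q / √3`, and `s² ≤ ε q / 6` because `ε ≤ K / 2`.
  -- The sum is below `(29/50 + 1/6) ε q`.
  have hprod : s * (√(q * K) + s) ≤ 3 / 4 * (ε * q) := by
    have h1 : √(q / (3 * K)) * √(q * K) = q * √(1 / 3) := by
      rw [← Real.sqrt_mul (by positivity), show q / (3 * K) * (q * K) = q ^ 2 * (1 / 3) by
        field_simp, Real.sqrt_mul (by positivity), Real.sqrt_sq hq0.le]
    have h2 : √(1 / 3 : ℝ) ≤ 29 / 50 := by
      rw [Real.sqrt_le_left (by norm_num)]; norm_num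
    have h3 : s * s ≤ ε * (q / 6) := by
      have : s * s = ε * (ε * (q / (3 * K))) := by
        rw [hs, mul_mul_mul_comm, Real.mul_self_sqrt (by positivity)]; ring
      rw [this]
      refine mul_le_mul_of_nonneg_left ?_ hε.le
      have h4 : ε ≤ K / 2 := by linarith
      calc ε * (q / (3 * K)) ≤ K / 2 * (q / (3 * K)) := by gcongr
        _ = q / 6 := by field_simp; norm_num
    have h4 : s * √(q * K) ≤ 29 / 50 * (ε * q) := by
      rw [hs, mul_assoc, h1]
      nlinarith [mul_le_mul_of_nonneg_left h2 (mul_pos hε hq0).le]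
    have := mul_pos hε hq0
    nlinarith
  rw [e, map_add, map_neg]
  refine (norm_add_le _ _).trans ?_
  rw [norm_neg]
  have hfirst : ‖S (X ((D' - D) ψ))‖ ≤ 1 / √(eigval C r) * (ε * ‖ψ‖) := by
    refine (hv.norm_comp_pinv_le hC hCp hS hpos _).trans ?_
    gcongr
    refine ((D' - D).le_of_opNorm_le hDD ψ).trans ?_
    gcongr
    linarith
  have hr' : (1 : ℝ) ≤ r := by exact_mod_cast hr
  have hsecond : ‖S ((X - Y) (D' ψ))‖ ≤
      (r + 1) / (δ * eigval C r) * (1 + t) * √q * (ε * ‖ψ‖) := by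
    calc ‖S ((X - Y) (D' ψ))‖ ≤ √q * ‖(X - Y) (D' ψ)‖ := hSq _
      _ ≤ √q * (49 / 20 * (s / (δ * eigval C r)) * ((√(q * K) + s) * ‖ψ‖)) := by
          gcongr
          exact ((X - Y).le_of_opNorm_le hXY _).trans (by
            gcongr
            exact D'.le_of_opNorm_le hD' ψ)
      _ = 49 / 20 * (s * (√(q * K) + s)) * (√q / (δ * eigval C r) * ‖ψ‖) := by ring
      _ ≤ 49 / 20 * (3 / 4 * (ε * q)) * (√q / (δ * eigval C r) * ‖ψ‖) := by gcongr
      _ ≤ (r + 1) * ((1 + t) * ε) * (√q / (δ * eigval C r) * ‖ψ‖) := by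
          refine mul_le_mul_of_nonneg_right ?_ (by positivity)
          have : 0 < ε * q := mul_pos hε hq0
          have : ε * q ≤ ε * t := mul_le_mul_of_nonneg_left hqt hε.le
          -- The accumulated constant `(49/20)(3/4)` is below `2`, and `2 ≤ r + 1`.
          have h5 : 2 * ((1 + t) * ε) ≤ (r + 1) * ((1 + t) * ε) :=
            mul_le_mul_of_nonneg_right (by linarith) (by nlinarith)
          nlinarith
      _ = _ := by ring
  calc _ ≤ _ := add_le_add hfirst hsecond
    _ = _ := by ring

end Truncation

/-! ### Compactness of finite-rank operators. -/

section RankOne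

variable {H : Type*} [NormedAddCommGroup H] [InnerProductSpace ℝ H]

theorem isCompactOperator_rankOne {H' : Type*} [NormedAddCommGroup H'] [InnerProductSpace ℝ H']
    (a : H) (b : H') : IsCompactOperator (InnerProductSpace.rankOne ℝ a b) := by
  rw [InnerProductSpace.rankOne_def']
  exact ((isCompactOperator_id (E := ℝ)).comp_clm (innerSL ℝ b)).clm_comp
    (ContinuousLinearMap.toSpanSingleton ℝ a)

theorem isCompactOperator_finset_sum {ι : Type*} {H' : Type*} [NormedAddCommGroup H']
    [InnerProductSpace ℝ H'] (s : Finset ι) (A : ι → H' →L[ℝ] H)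
    (h : ∀ i ∈ s, IsCompactOperator (A i)) : IsCompactOperator (∑ i ∈ s, A i : H' →L[ℝ] H) := by
  classical
  induction s using Finset.induction_on with
  | empty => simpa using isCompactOperator_zero
  | insert i s hi ih =>
    rw [Finset.sum_insert hi]
    exact (h i (Finset.mem_insert_self i s)).add
      (ih fun j hj => h j (Finset.mem_insert_of_mem hj))

end RankOne

/-! ### Classes of square-integrable functions. -/

section SquareIntegrable

variable {Z : Type*} [MeasurableSpace Z] {μ : Measure Z}

theorem toL2_eq {g : Z → ℝ} (h : MemLp g 2 μ) : toL2 μ g = h.toLp g := dif_pos h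

theorem toL2_add {f g : Z → ℝ} (hf : MemLp f 2 μ) (hg : MemLp g 2 μ) :
    toL2 μ (f + g) = toL2 μ f + toL2 μ g := by
  rw [toL2_eq hf, toL2_eq hg, toL2_eq (hf.add hg), MemLp.toLp_add]

theorem toL2_sub {f g : Z → ℝ} (hf : MemLp f 2 μ) (hg : MemLp g 2 μ) :
    toL2 μ (f - g) = toL2 μ f - toL2 μ g := by
  rw [toL2_eq hf, toL2_eq hg, toL2_eq (hf.sub hg), MemLp.toLp_sub]

theorem toL2_smul {f : Z → ℝ} (hf : MemLp f 2 μ) (c : ℝ) :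
    toL2 μ (c • f) = c • toL2 μ f := by
  rw [toL2_eq hf, toL2_eq (hf.const_smul c), MemLp.toLp_const_smul]

theorem inner_toL2 {f g : Z → ℝ} (hf : MemLp f 2 μ) (hg : MemLp g 2 μ) :
    ⟪toL2 μ f, toL2 μ g⟫_ℝ = ∫ z, f z * g z ∂μ := by
  rw [toL2_eq hf, toL2_eq hg, L2.inner_def]
  refine integral_congr_ae ?_
  filter_upwards [hf.coeFn_toLp, hg.coeFn_toLp] with z h1 h2
  rw [h1, h2]
  simp [mul_comm]

theorem norm_toL2_le [IsProbabilityMeasure μ] {g : Z → ℝ} {c : ℝ} (hc : 0 ≤ c)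
    (h : ∀ z, |g z| ≤ c) : ‖toL2 μ g‖ ≤ c := by
  by_cases hg : MemLp g 2 μ
  · rw [toL2_eq hg]
    have := Lp.norm_le_of_ae_bound (p := 2) (f := hg.toLp g) hc (by
      filter_upwards [hg.coeFn_toLp] with z h1
      rw [h1]
      exact h z)
    simpa [measureUnivNNReal] using this
  · rw [toL2, dif_neg hg, norm_zero]
    exact hc

end SquareIntegrable

/-! ### Feature maps, inclusion into `L²`, and covariance operators of an RKHS. -/

section ReproducingKernel

variable {Z : Type*} {H : Type*} [NormedAddCommGroup H] [InnerProductSpace ℝ H] [CompleteSpace H]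
  [RKHS ℝ H Z ℝ]

theorem inner_feature (z : Z) (f : H) : ⟪feature H z, f⟫_ℝ = f z := by
  rw [feature, RKHS.kerFun_inner]
  simp

theorem inner_feature_feature (x y : Z) :
    ⟪feature H x, feature H y⟫_ℝ = RKHS.kernel H x y 1 := by
  rw [inner_feature, feature, RKHS.kerFun_apply]

theorem continuous_feature [TopologicalSpace Z] {k : Z → Z → ℝ}
    (hk : Continuous fun p : Z × Z => k p.1 p.2) (h : ∀ x y, RKHS.kernel H x y 1 = k x y) :
    Continuous (feature H : Z → H) := by
  rw [continuous_iff_continuousAt]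
  intro x
  rw [ContinuousAt, tendsto_iff_norm_sub_tendsto_zero]
  have h1 : ∀ y, ‖feature H y - feature H x‖ = √(k y y - 2 * k y x + k x x) := fun y => by
    rw [← Real.sqrt_sq (norm_nonneg (feature H y - feature H x)), norm_sub_sq_real,
      ← real_inner_self_eq_norm_sq, ← real_inner_self_eq_norm_sq, inner_feature_feature,
      inner_feature_feature, inner_feature_feature, h, h, h]
  simp_rw [h1]
  have hc : Continuous fun y => √(k y y - 2 * k y x + k x x) := by
    have h2 : Continuous fun y => k y y := hk.comp (continuous_id.prodMk continuous_id)
    have h3 : Continuous fun y => k y x := hk.comp (continuous_id.prodMk continuous_const)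
    fun_prop
  have := hc.tendsto x
  rwa [show k x x - 2 * k x x + k x x = 0 by ring, Real.sqrt_zero] at this

theorem abs_apply_le (f : H) (z : Z) : |f z| ≤ ‖feature H z‖ * ‖f‖ := by
  rw [← inner_feature]
  exact abs_real_inner_le_norm _ _

theorem continuous_coe_of_feature [TopologicalSpace Z] (hc : Continuous (feature H : Z → H))
    (f : H) : Continuous (f : Z → ℝ) := by
  have : (f : Z → ℝ) = fun z => ⟪feature H z, f⟫_ℝ := funext fun z => (inner_feature z f).symm
  rw [this]
  fun_prop

/-- The closed graph theorem for composition operators between RKHSs. -/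
theorem exists_compositionOperator {Z' H' : Type*} [NormedAddCommGroup H'] [InnerProductSpace ℝ H']
    [CompleteSpace H'] [RKHS ℝ H' Z' ℝ] (y : Z → Z')
    (h : ∀ ψ : H', ∃ η : H, ⇑η = fun z => ψ (y z)) :
    ∃ A : H' →L[ℝ] H, ∀ ψ : H', ⇑(A ψ) = fun z => ψ (y z) := by
  choose a ha using h
  let A₀ : H' →ₗ[ℝ] H :=
    { toFun := a
      map_add' := fun ψ ψ' => DFunLike.coe_injective (by
        rw [ha, RKHS.coe_add, RKHS.coe_add, ha, ha]; rfl)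
      map_smul' := fun c ψ => DFunLike.coe_injective (by
        rw [ha, RingHom.id_apply, RKHS.coe_smul, RKHS.coe_smul, ha]; rfl) }
  -- The graph is closed because point evaluations are continuous on both spaces and determine the
  -- functions.
  have hcont : Continuous A₀ := by
    refine A₀.continuous_of_seq_closed_graph fun u ψ η hu hη => ?_
    refine DFunLike.coe_injective (funext fun z => ?_)
    have h1 : Filter.Tendsto (fun i => (A₀ (u i)) z) Filter.atTop (nhds (η z)) :=
      ((RKHS.continuous_eval z).tendsto η).comp hη
    have h2 : Filter.Tendsto (fun i => (u i) (y z)) Filter.atTop (nhds (ψ (y z))) :=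
      ((RKHS.continuous_eval (y z)).tendsto ψ).comp hu
    have h3 : ∀ i, (A₀ (u i)) z = (u i) (y z) := fun i => congrFun (ha (u i)) z
    have h4 : (A₀ ψ) z = ψ (y z) := congrFun (ha ψ) z
    simp_rw [h3] at h1
    rw [h4]
    exact tendsto_nhds_unique h1 h2
  exact ⟨⟨A₀, hcont⟩, ha⟩

theorem isPositive_empCov {m : ℕ} (x : Fin m → Z) : (empCov H x).IsPositive := by
  rw [empCov]
  refine ContinuousLinearMap.IsPositive.smul_of_nonneg ?_ (by positivity)
  exact ContinuousLinearMap.isPositive_sum _ fun k _ =>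
    InnerProductSpace.isPositive_rankOne_self _

theorem isCompactOperator_empCov {m : ℕ} (x : Fin m → Z) : IsCompactOperator (empCov H x) := by
  rw [empCov]
  exact (isCompactOperator_finset_sum _ _ fun k _ => isCompactOperator_rankOne _ _).smul
    (m : ℝ)⁻¹

variable [TopologicalSpace Z] [SecondCountableTopology Z] [MeasurableSpace Z] [BorelSpace Z]
  {μ : Measure Z} [IsProbabilityMeasure μ]

theorem memLp_of_continuous_of_bound {g : Z → ℝ} (hg : Continuous g) {c : ℝ}
    (h : ∀ z, |g z| ≤ c) : MemLp g 2 μ :=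
  MemLp.of_bound hg.aestronglyMeasurable c (Filter.Eventually.of_forall h)

theorem integrable_rankOne {H' : Type*} [NormedAddCommGroup H'] [InnerProductSpace ℝ H']
    {a : Z → H} {b : Z → H'} (ha : Continuous a) (hb : Continuous b) {K : ℝ}
    (hKa : ∀ z, ‖a z‖ ^ 2 ≤ K) (hKb : ∀ z, ‖b z‖ ^ 2 ≤ K) :
    Integrable (fun z => InnerProductSpace.rankOne ℝ (a z) (b z)) μ := by
  have hc : Continuous fun z => InnerProductSpace.rankOne ℝ (a z) (b z) :=
    ((InnerProductSpace.rankOne ℝ).continuous.comp ha).clm_apply hb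
  refine Integrable.of_bound hc.aestronglyMeasurable K (Filter.Eventually.of_forall fun z => ?_)
  rw [InnerProductSpace.norm_rankOne]
  nlinarith [hKa z, hKb z, sq_nonneg (‖a z‖ - ‖b z‖)]

theorem inner_integral_rankOne {H' : Type*} [NormedAddCommGroup H'] [InnerProductSpace ℝ H']
    [CompleteSpace H'] {a : Z → H} {b : Z → H'} (ha : Continuous a) (hb : Continuous b) {K : ℝ}
    (hKa : ∀ z, ‖a z‖ ^ 2 ≤ K) (hKb : ∀ z, ‖b z‖ ^ 2 ≤ K) (f : H) (ψ : H') :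
    ⟪f, (∫ z, InnerProductSpace.rankOne ℝ (a z) (b z) ∂μ) ψ⟫_ℝ =
      ∫ z, ⟪a z, f⟫_ℝ * ⟪b z, ψ⟫_ℝ ∂μ := by
  have hi := integrable_rankOne (μ := μ) ha hb hKa hKb
  rw [ContinuousLinearMap.integral_apply hi, ← integral_inner (hi.apply_continuousLinearMap ψ)]
  refine integral_congr_ae (Filter.Eventually.of_forall fun z => ?_)
  simp only [InnerProductSpace.rankOne_apply, real_inner_smul_right]
  rw [mul_comm, real_inner_comm (a z) f]

variable {K : ℝ}

theorem memLp_coe (hc : Continuous (feature H : Z → H)) (hK : ∀ z, ‖feature H z‖ ^ 2 ≤ K) (f : H) :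
    MemLp f 2 μ :=
  memLp_of_continuous_of_bound (continuous_coe_of_feature hc f) (c := √K * ‖f‖) fun z =>
    (abs_apply_le f z).trans (mul_le_mul_of_nonneg_right (Real.le_sqrt_of_sq_le (hK z))
      (norm_nonneg _))

/-- The inclusion of an RKHS with bounded continuous kernel into `L²`. -/
theorem exists_inclusion (hc : Continuous (feature H : Z → H))
    (hK : ∀ z, ‖feature H z‖ ^ 2 ≤ K) : ∃ S : H →L[ℝ] Lp ℝ 2 μ, ∀ f : H, S f = toL2 μ f := by
  let S₀ : H →ₗ[ℝ] Lp ℝ 2 μ :=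
    { toFun := fun f => toL2 μ f
      map_add' := fun f g => by
        rw [RKHS.coe_add, toL2_add (memLp_coe hc hK f) (memLp_coe hc hK g)]
      map_smul' := fun c f => by
        rw [RKHS.coe_smul, toL2_smul (memLp_coe hc hK f), RingHom.id_apply] }
  refine ⟨S₀.mkContinuous √K fun f => ?_, fun f => rfl⟩
  refine norm_toL2_le (by positivity) fun z => ?_
  exact (abs_apply_le f z).trans (mul_le_mul_of_nonneg_right (Real.le_sqrt_of_sq_le (hK z))
      (norm_nonneg _))

theorem inner_covOp (hc : Continuous (feature H : Z → H)) (hK : ∀ z, ‖feature H z‖ ^ 2 ≤ K)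
    (f g : H) : ⟪covOp H μ f, g⟫_ℝ = ∫ z, f z * g z ∂μ := by
  rw [real_inner_comm, covOp, inner_integral_rankOne hc hc hK hK]
  simp_rw [inner_feature, mul_comm]

theorem isPositive_covOp (hc : Continuous (feature H : Z → H))
    (hK : ∀ z, ‖feature H z‖ ^ 2 ≤ K) : (covOp H μ).IsPositive := by
  refine ⟨fun f g => ?_, fun f => ?_⟩
  · change ⟪covOp H μ f, g⟫_ℝ = ⟪f, covOp H μ g⟫_ℝ
    rw [inner_covOp hc hK, real_inner_comm, inner_covOp hc hK]
    simp_rw [mul_comm]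
  · change 0 ≤ ⟪covOp H μ f, f⟫_ℝ
    rw [inner_covOp hc hK]
    exact integral_nonneg fun z => mul_self_nonneg _

/-- A Bochner integral over a probability measure stays in the closed convex set of compact
operators, which contains the rank-one integrands. -/
theorem isCompactOperator_covOp (hc : Continuous (feature H : Z → H))
    (hK : ∀ z, ‖feature H z‖ ^ 2 ≤ K) : IsCompactOperator (covOp H μ) := by
  have hconv : Convex ℝ {A : H →L[ℝ] H | IsCompactOperator A} := fun A hA B hB s t _ _ _ =>
    (IsCompactOperator.smul hA s).add (IsCompactOperator.smul hB t)
  exact hconv.integral_mem isClosed_setOfPred_isCompactOperator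
    (Filter.Eventually.of_forall fun z => isCompactOperator_rankOne _ _)
    (integrable_rankOne hc hc hK hK)

theorem integrable_norm_feature_sq (hc : Continuous (feature H : Z → H))
    (hK : ∀ z, ‖feature H z‖ ^ 2 ≤ K) : Integrable (fun z => ‖feature H z‖ ^ 2) μ :=
  Integrable.of_bound (hc.norm.pow 2).aestronglyMeasurable K
    (Filter.Eventually.of_forall fun z => by
      rw [Real.norm_of_nonneg (by positivity)]; exact hK z)

theorem norm_covOp_le : ‖covOp H μ‖ ≤ ∫ z, ‖feature H z‖ ^ 2 ∂μ := by
  refine (norm_integral_le_integral_norm _).trans_eq ?_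
  simp_rw [InnerProductSpace.norm_rankOne, sq]

theorem mercer_le {j : ℕ} (hj : 1 ≤ j) : mercer H μ j ≤ ∫ z, ‖feature H z‖ ^ 2 ∂μ := by
  rw [mercer, eigval_eq]
  refine Real.sSup_le ?_ (integral_nonneg fun z => by positivity)
  rintro c ⟨v, κ, hv, h⟩
  exact ((h ⟨0, hj⟩).2.trans (eigenvalue_le_norm (hv.1 _) (h _).1)).trans norm_covOp_le

/-- The cross-covariance operator `∫ Φ(z) ⊗ Φ(y(z)) dμ(z)`. -/
noncomputable def crossOp {Z' : Type*} (H : Type*) [NormedAddCommGroup H] [InnerProductSpace ℝ H]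
    [CompleteSpace H] [RKHS ℝ H Z ℝ] (H' : Type*) [NormedAddCommGroup H'] [InnerProductSpace ℝ H']
    [CompleteSpace H'] [RKHS ℝ H' Z' ℝ] (μ : Measure Z) (y : Z → Z') : H' →L[ℝ] H :=
  ∫ z, InnerProductSpace.rankOne ℝ (feature H z) (feature H' (y z)) ∂μ

variable {Z' H' : Type*} [NormedAddCommGroup H'] [InnerProductSpace ℝ H']
    [CompleteSpace H'] [RKHS ℝ H' Z' ℝ] {y : Z → Z'}

theorem inner_crossOp (hc : Continuous (feature H : Z → H)) (hK : ∀ z, ‖feature H z‖ ^ 2 ≤ K)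
    (hc' : Continuous fun z => feature H' (y z)) (hK' : ∀ z, ‖feature H' z‖ ^ 2 ≤ K) (f : H)
    (ψ : H') : ⟪f, crossOp H H' μ y ψ⟫_ℝ = ∫ z, f z * ψ (y z) ∂μ := by
  rw [crossOp, inner_integral_rankOne hc hc' hK fun z => hK' (y z)]
  simp_rw [inner_feature]

/-- One factor is bounded by `√K`; the other is integrated, with `(∫ ‖Φ‖)² ≤ ∫ ‖Φ‖²` from the
nonnegativity of the variance. This `√(q K)`, rather than `K`, is what `norm_comp_pinv_sub_le`
requires. -/
theorem norm_crossOp_le (hc : Continuous (feature H : Z → H)) (hK : ∀ z, ‖feature H z‖ ^ 2 ≤ K)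
    (hK' : ∀ z, ‖feature H' z‖ ^ 2 ≤ K) :
    ‖crossOp H H' μ y‖ ≤ √((∫ z, ‖feature H z‖ ^ 2 ∂μ) * K) := by
  set q := ∫ z, ‖feature H z‖ ^ 2 ∂μ with hq
  have hq0 : 0 ≤ q := integral_nonneg fun z => by positivity
  have hi := integrable_norm_feature_sq (μ := μ) hc hK
  have hi1 : Integrable (fun z => ‖feature H z‖) μ :=
    Integrable.of_bound hc.norm.aestronglyMeasurable √K (Filter.Eventually.of_forall fun z => by
      rw [norm_norm]; exact Real.le_sqrt_of_sq_le (hK z))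
  have h1 : ‖crossOp H H' μ y‖ ≤ √K * ∫ z, ‖feature H z‖ ∂μ := by
    rw [← integral_const_mul]
    refine norm_integral_le_of_norm_le (hi1.const_mul _) (Filter.Eventually.of_forall fun z => ?_)
    rw [InnerProductSpace.norm_rankOne, mul_comm]
    gcongr
    exact Real.le_sqrt_of_sq_le (hK' (y z))
  have h2 : ∫ z, ‖feature H z‖ ∂μ ≤ √q := by
    refine Real.le_sqrt_of_sq_le ?_
    have h3 : 0 ≤ ∫ z, (‖feature H z‖ - ∫ w, ‖feature H w‖ ∂μ) ^ 2 ∂μ :=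
      integral_nonneg fun z => sq_nonneg _
    set e := ∫ w, ‖feature H w‖ ∂μ with he
    have h4 : ∀ z, (‖feature H z‖ - e) ^ 2 = ‖feature H z‖ ^ 2 - 2 * e * ‖feature H z‖ + e ^ 2 :=
      fun z => by ring
    simp_rw [h4] at h3
    rw [integral_add (f := fun z => ‖feature H z‖ ^ 2 - 2 * e * ‖feature H z‖)
      (hi.sub (hi1.const_mul _)) (integrable_const _), integral_sub hi (hi1.const_mul _),
      integral_const_mul, ← he, ← hq] at h3
    simp at h3
    nlinarith
  rw [Real.sqrt_mul hq0, mul_comm (√q)]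
  exact h1.trans (mul_le_mul_of_nonneg_left h2 (Real.sqrt_nonneg _))

theorem memLp_comp (hc' : Continuous fun z => feature H' (y z))
    (hK' : ∀ z, ‖feature H' z‖ ^ 2 ≤ K) (ψ : H') : MemLp (fun z => ψ (y z)) 2 μ := by
  refine memLp_of_continuous_of_bound ?_ (c := √K * ‖ψ‖) fun z =>
    (abs_apply_le ψ (y z)).trans (mul_le_mul_of_nonneg_right (Real.le_sqrt_of_sq_le (hK' (y z)))
      (norm_nonneg _))
  simp_rw [← inner_feature]
  fun_prop

end ReproducingKernel

/-! ### Second-order expansion along a trajectory. -/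

section Taylor

variable {E V : Type*} [NormedAddCommGroup E] [NormedSpace ℝ E] [NormedAddCommGroup V]
  [NormedSpace ℝ V]

/-- Second-order Taylor expansion of an observable along a trajectory. -/
theorem norm_observable_sub_taylor_le {φ : E → E} (hφ : ContDiff ℝ 1 φ) {ψ : E → V}
    (hψ : ContDiff ℝ 2 ψ) {Y : Set E} {T : ℝ} {x : ℝ → E} (hxY : ∀ t ∈ Icc (0 : ℝ) T, x t ∈ Y)
    (hx : ∀ t ∈ Icc (0 : ℝ) T, HasDerivWithinAt x (φ (x t)) (Icc 0 T) t) {B M : ℝ}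
    (hM : 0 ≤ M) (hφB : ∀ y ∈ Y, ‖φ y‖ ≤ B ∧ ‖fderiv ℝ φ y‖ ≤ B)
    (hψM : ∀ y ∈ Y, ‖iteratedFDeriv ℝ 1 ψ y‖ ≤ M ∧ ‖iteratedFDeriv ℝ 2 ψ y‖ ≤ M) {t : ℝ}
    (ht : t ∈ Icc (0 : ℝ) T) :
    ‖ψ (x t) - ψ (x 0) - t • fderiv ℝ ψ (x 0) (φ (x 0))‖ ≤ 2 * M * B ^ 2 * t ^ 2 := by
  have ht0 := ht.1
  have hsub : Icc (0 : ℝ) t ⊆ Icc 0 T := Icc_subset_Icc_right ht.2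
  have h0 : (0 : ℝ) ∈ Icc (0 : ℝ) t := ⟨le_rfl, ht0⟩
  have htt : t ∈ Icc (0 : ℝ) t := ⟨ht0, le_rfl⟩
  have hψ1 : ContDiff ℝ 1 (fderiv ℝ ψ) := hψ.fderiv_right (by norm_num)
  have hd : ∀ s ∈ Icc (0 : ℝ) t, HasDerivWithinAt (fun s => ψ (x s))
      (fderiv ℝ ψ (x s) (φ (x s))) (Icc 0 t) s := fun s hs =>
    ((hψ.differentiable (by norm_num)).differentiableAt.hasFDerivAt).comp_hasDerivWithinAt s
      ((hx s (hsub hs)).mono hsub)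
  -- A `C¹` field suffices: along a solution the derivative of `ψ ∘ x` is a `C¹` function of the
  -- state and can be differentiated again. The mean value inequality is then used twice, so no
  -- factor `1/2` appears.
  have hd2 : ∀ s ∈ Icc (0 : ℝ) t, HasDerivWithinAt (fun s => fderiv ℝ ψ (x s) (φ (x s)))
      (fderiv ℝ (fderiv ℝ ψ) (x s) (φ (x s)) (φ (x s)) +
        fderiv ℝ ψ (x s) (fderiv ℝ φ (x s) (φ (x s)))) (Icc 0 t) s := fun s hs =>
    HasDerivWithinAt.clm_apply
      (((hψ1.differentiable (by norm_num)).differentiableAt.hasFDerivAt).comp_hasDerivWithinAt s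
        ((hx s (hsub hs)).mono hsub))
      (((hφ.differentiable (by norm_num)).differentiableAt.hasFDerivAt).comp_hasDerivWithinAt s
        ((hx s (hsub hs)).mono hsub))
  have hbound : ∀ s ∈ Icc (0 : ℝ) t, ‖fderiv ℝ (fderiv ℝ ψ) (x s) (φ (x s)) (φ (x s)) +
        fderiv ℝ ψ (x s) (fderiv ℝ φ (x s) (φ (x s)))‖ ≤ 2 * M * B ^ 2 := fun s hs => by
    have hy := hxY s (hsub hs)
    obtain ⟨h1, h2⟩ := hφB _ hy
    obtain ⟨h3, h4⟩ := hψM _ hy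
    rw [norm_iteratedFDeriv_one] at h3
    rw [← norm_iteratedFDeriv_fderiv (n := 1), norm_iteratedFDeriv_one] at h4
    calc _ ≤ M * B * B + M * (B * B) := by
          refine (norm_add_le _ _).trans (add_le_add ?_ ?_)
          · exact ContinuousLinearMap.le_of_opNorm_le_of_le _
              (ContinuousLinearMap.le_of_opNorm_le_of_le _ h4 h1) h1
          · exact ContinuousLinearMap.le_of_opNorm_le_of_le _ h3
              (ContinuousLinearMap.le_of_opNorm_le_of_le _ h2 h1)
      _ = _ := by ring
  have hlip : ∀ s ∈ Icc (0 : ℝ) t, ‖fderiv ℝ ψ (x s) (φ (x s)) -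
      fderiv ℝ ψ (x 0) (φ (x 0))‖ ≤ 2 * M * B ^ 2 * t := fun s hs => by
    refine ((convex_Icc (0 : ℝ) t).norm_image_sub_le_of_norm_hasDerivWithin_le hd2 hbound h0
      hs).trans ?_
    rw [sub_zero, Real.norm_of_nonneg hs.1]
    exact mul_le_mul_of_nonneg_left hs.2 (by positivity)
  have hd3 : ∀ s ∈ Icc (0 : ℝ) t, HasDerivWithinAt
      (fun s => ψ (x s) - s • fderiv ℝ ψ (x 0) (φ (x 0)))
      (fderiv ℝ ψ (x s) (φ (x s)) - fderiv ℝ ψ (x 0) (φ (x 0))) (Icc 0 t) s := fun s hs => by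
    have := (hd s hs).sub ((hasDerivWithinAt_id s (Icc 0 t)).smul_const
      (fderiv ℝ ψ (x 0) (φ (x 0))))
    rw [one_smul] at this
    exact this
  have hfin := (convex_Icc (0 : ℝ) t).norm_image_sub_le_of_norm_hasDerivWithin_le hd3 hlip h0 htt
  rw [sub_zero, Real.norm_of_nonneg ht0, zero_smul, sub_zero] at hfin
  calc _ = ‖ψ (x t) - t • fderiv ℝ ψ (x 0) (φ (x 0)) - ψ (x 0)‖ := by congr 1; abel
    _ ≤ _ := hfin
    _ = _ := by ring

end Taylor

/-! ### Continuity of the flow and affine dependence on the control up to second order. -/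

section Flow

variable {d n : ℕ} {X Y : Set (EuclideanSpace ℝ (Fin d))} {U : Set (Fin n → ℝ)} {T : ℝ}
  {f : EuclideanSpace ℝ (Fin d) → EuclideanSpace ℝ (Fin d)}
  {g : Fin n → EuclideanSpace ℝ (Fin d) → EuclideanSpace ℝ (Fin d)}
  {F : (Fin n → ℝ) → ℝ → X → Y}

theorem contDiff_field (hf : ContDiff ℝ 1 f) (hg : ∀ i, ContDiff ℝ 1 (g i)) (u : Fin n → ℝ) :
    ContDiff ℝ 1 (field f g u) := by
  unfold field
  exact hf.add (ContDiff.sum fun i _ => (hg i).const_smul (u i))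

theorem fderiv_field (hf : ContDiff ℝ 1 f) (hg : ∀ i, ContDiff ℝ 1 (g i)) (u : Fin n → ℝ)
    (y : EuclideanSpace ℝ (Fin d)) :
    fderiv ℝ (field f g u) y = fderiv ℝ f y + ∑ i, u i • fderiv ℝ (g i) y := by
  have h1 := (hf.differentiable (by norm_num) y).hasFDerivAt
  have h2 := HasFDerivAt.fun_sum (u := Finset.univ) fun i (_ : i ∈ Finset.univ) =>
    ((hg i).differentiable (by norm_num) y).hasFDerivAt.const_smul (u i)
  exact (h1.add h2).fderiv

theorem exists_field_bound (hU : IsCompact U) (hY : IsCompact Y) (hf : ContDiff ℝ 1 f)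
    (hg : ∀ i, ContDiff ℝ 1 (g i)) :
    ∃ B, 0 ≤ B ∧ ∀ u ∈ U, ∀ y ∈ Y, ‖field f g u y‖ ≤ B ∧ ‖fderiv ℝ (field f g u) y‖ ≤ B := by
  have hK := hU.prod hY
  have hf' := hf.continuous_fderiv (by norm_num)
  have hg' := fun i => (hg i).continuous_fderiv (by norm_num)
  have hfc := hf.continuous
  have hgc := fun i => (hg i).continuous
  have hc1 : Continuous fun p : (Fin n → ℝ) × EuclideanSpace ℝ (Fin d) => field f g p.1 p.2 := by
    unfold field
    fun_prop
  have hc2 : Continuous fun p : (Fin n → ℝ) × EuclideanSpace ℝ (Fin d) =>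
      fderiv ℝ (field f g p.1) p.2 := by
    simp_rw [fderiv_field hf hg]
    fun_prop
  obtain ⟨B1, hB1⟩ := hK.exists_bound_of_continuousOn hc1.continuousOn
  obtain ⟨B2, hB2⟩ := hK.exists_bound_of_continuousOn hc2.continuousOn
  exact ⟨max 0 (max B1 B2), le_max_left _ _, fun u hu y hy =>
    ⟨(hB1 (u, y) ⟨hu, hy⟩).trans ((le_max_left _ _).trans (le_max_right _ _)),
      (hB2 (u, y) ⟨hu, hy⟩).trans ((le_max_right _ _).trans (le_max_right _ _))⟩⟩

/-- Solutions stay in `Y`, so the vector fields may be replaced by their `C¹` extensions. -/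
theorem IsControlFlow.congr {f' : EuclideanSpace ℝ (Fin d) → EuclideanSpace ℝ (Fin d)}
    {g' : Fin n → EuclideanSpace ℝ (Fin d) → EuclideanSpace ℝ (Fin d)}
    (hF : IsControlFlow f g U T F) (hf : ∀ y : Y, f' y = f y) (hg : ∀ i, ∀ y : Y, g' i y = g i y) :
    IsControlFlow f' g' U T F := by
  refine fun u hu x => ⟨(hF u hu x).1, fun t ht => ?_⟩
  have h : field f' g' u (F u t x) = field f g u (F u t x) := by
    simp only [field, hf, hg]
  rw [h]
  exact (hF u hu x).2 t ht

/-- Grönwall's estimate: trajectories remain in the compact set `Y`, on which the field is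
Lipschitz. -/
theorem IsControlFlow.continuous (hF : IsControlFlow f g U T F) (hY : IsCompact Y)
    (hf : ContDiff ℝ 1 f) (hg : ∀ i, ContDiff ℝ 1 (g i)) {u : Fin n → ℝ} (hu : u ∈ U) {t : ℝ}
    (ht : t ∈ Icc (0 : ℝ) T) : Continuous (F u t) := by
  obtain ⟨K, hK⟩ := (contDiff_field hf hg u).locallyLipschitz.locallyLipschitzOn.exists_lipschitzOnWith_of_compact hY
  have hcont : ∀ x : X, ContinuousOn (fun s => (F u s x : EuclideanSpace ℝ (Fin d))) (Icc 0 T) :=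
    fun x s hs => ((hF u hu x).2 s hs).continuousWithinAt
  have hder : ∀ x : X, ∀ s ∈ Ico (0 : ℝ) T,
      HasDerivWithinAt (fun s => (F u s x : EuclideanSpace ℝ (Fin d)))
        (field f g u (F u s x)) (Ici s) s := fun x s hs =>
    ((hF u hu x).2 s ⟨hs.1, hs.2.le⟩).mono_of_mem_nhdsWithin
      (Filter.mem_of_superset (Icc_mem_nhdsGE hs.2) (Icc_subset_Icc_left hs.1))
  refine LipschitzWith.continuous (K := Real.toNNReal (Real.exp (K * (t - 0)))) ?_
  refine LipschitzWith.of_dist_le_mul fun x x' => ?_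
  rw [Real.coe_toNNReal _ (Real.exp_pos _).le, mul_comm]
  refine dist_le_of_trajectories_ODE_of_mem (v := fun _ => field f g u) (s := fun _ => Y)
    (fun _ _ => hK) (hcont x) (hder x) (fun s _ => (F u s x).2) (hcont x') (hder x')
    (fun s _ => (F u s x').2) (le_of_eq ?_) t ht
  rw [(hF u hu x).1, (hF u hu x').1]
  rfl

variable {V : Type*} [NormedAddCommGroup V] [NormedSpace ℝ V]

/-- An affine relation between controls holds for the evolution of smooth observables up to an
error of second order in time. -/
theorem IsControlFlow.norm_sum_smul_le (hF : IsControlFlow f g U T F) (hf : ContDiff ℝ 1 f)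
    (hg : ∀ i, ContDiff ℝ 1 (g i)) {B : ℝ}
    (hfB : ∀ u ∈ U, ∀ y ∈ Y, ‖field f g u y‖ ≤ B ∧ ‖fderiv ℝ (field f g u) y‖ ≤ B)
    {ψ : EuclideanSpace ℝ (Fin d) → V} (hψ : ContDiff ℝ 2 ψ) {M : ℝ} (hM : 0 ≤ M)
    (hψM : ∀ y ∈ Y, ‖iteratedFDeriv ℝ 1 ψ y‖ ≤ M ∧ ‖iteratedFDeriv ℝ 2 ψ y‖ ≤ M)
    {ι : Type*} [Fintype ι] {c : ι → Fin n → ℝ} (hc : ∀ a, c a ∈ U) {w : ι → ℝ}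
    (hw : ∑ a, w a = 0) (hwc : ∑ a, w a • c a = 0) {t : ℝ} (ht : t ∈ Icc (0 : ℝ) T) (x : X) :
    ‖∑ a, w a • ψ (F (c a) t x)‖ ≤ (∑ a, |w a|) * (2 * M * B ^ 2 * t ^ 2) := by
  -- The two relations on the weights cancel `f` and the `g i` respectively, hence the whole
  -- first-order term; the zeroth-order term cancels because the weights sum to `0`.
  have hfield : ∑ a, w a • field f g (c a) (x : EuclideanSpace ℝ (Fin d)) = 0 := by
    simp only [field, smul_add, Finset.sum_add_distrib, ← Finset.sum_smul, hw, zero_smul, zero_add,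
      Finset.smul_sum]
    rw [Finset.sum_comm]
    refine Finset.sum_eq_zero fun i _ => ?_
    simp_rw [smul_smul]
    rw [← Finset.sum_smul]
    have := congrFun hwc i
    simp only [Finset.sum_apply, Pi.smul_apply, smul_eq_mul, Pi.zero_apply] at this
    rw [this, zero_smul]
  have hrest : ∑ a, w a • ψ (F (c a) t x) = ∑ a, w a • (ψ (F (c a) t x) - ψ x -
      t • fderiv ℝ ψ x (field f g (c a) x)) := by
    have h1 : ∑ a, w a • t • fderiv ℝ ψ x (field f g (c a) x) = 0 := by
      simp_rw [smul_comm _ t, ← map_smul]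
      rw [← map_sum, ← Finset.smul_sum, hfield, smul_zero, map_zero]
    simp only [smul_sub, Finset.sum_sub_distrib, ← Finset.sum_smul, hw, zero_smul, h1, sub_zero]
  rw [hrest, Finset.sum_mul]
  refine (norm_sum_le _ _).trans (Finset.sum_le_sum fun a _ => ?_)
  rw [norm_smul, Real.norm_eq_abs]
  refine mul_le_mul_of_nonneg_left ?_ (abs_nonneg _)
  have := norm_observable_sub_taylor_le (contDiff_field hf hg (c a)) hψ
    (x := fun s => (F (c a) s x : EuclideanSpace ℝ (Fin d))) (fun s _ => (F (c a) s x).2)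
    (hF (c a) (hc a) x).2 hM (hfB _ (hc a)) hψM ht
  simpa only [(hF (c a) (hc a) x).1] using this

theorem exists_norm_iteratedFDeriv_bound (hY : IsCompact Y) {ψ : EuclideanSpace ℝ (Fin d) → V}
    (hψ : ContDiff ℝ 2 ψ) : ∃ M, 0 ≤ M ∧
      ∀ y ∈ Y, ‖iteratedFDeriv ℝ 1 ψ y‖ ≤ M ∧ ‖iteratedFDeriv ℝ 2 ψ y‖ ≤ M := by
  obtain ⟨M1, h1⟩ := hY.exists_bound_of_continuousOn
    (hψ.continuous_iteratedFDeriv (m := 1) (by norm_num)).continuousOn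
  obtain ⟨M2, h2⟩ := hY.exists_bound_of_continuousOn
    (hψ.continuous_iteratedFDeriv (m := 2) le_rfl).continuousOn
  exact ⟨max 0 (max M1 M2), le_max_left _ _, fun y hy =>
    ⟨(h1 y hy).trans ((le_max_left _ _).trans (le_max_right _ _)),
      (h2 y hy).trans ((le_max_right _ _).trans (le_max_right _ _))⟩⟩

end Flow

/-! ### Second-order expansion of feature vectors. -/

section FlowFeature

variable {d n : ℕ} {X Y : Set (EuclideanSpace ℝ (Fin d))} {U : Set (Fin n → ℝ)} {T : ℝ}
  {f : EuclideanSpace ℝ (Fin d) → EuclideanSpace ℝ (Fin d)}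
  {g : Fin n → EuclideanSpace ℝ (Fin d) → EuclideanSpace ℝ (Fin d)}
  {F : (Fin n → ℝ) → ℝ → X → Y} {HY : Type*} [NormedAddCommGroup HY] [InnerProductSpace ℝ HY]
  [CompleteSpace HY] [RKHS ℝ HY Y ℝ]

/-- For a `C²` kernel, an affine relation between controls holds for the feature vectors along the
flow up to an error of second order in time. -/
theorem IsControlFlow.exists_norm_sum_feature_le (hF : IsControlFlow f g U T F)
    (hY : IsCompact Y) (hf : ContDiff ℝ 1 f) (hg : ∀ i, ContDiff ℝ 1 (g i)) {B : ℝ}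
    (hfB : ∀ u ∈ U, ∀ y ∈ Y, ‖field f g u y‖ ≤ B ∧ ‖fderiv ℝ (field f g u) y‖ ≤ B)
    {k : Y → Y → ℝ} (hHY : ∀ x y : Y, RKHS.kernel HY x y 1 = k x y) (hk : IsC2Kernel k) :
    ∃ c, 0 ≤ c ∧ ∀ (ι : Type) [Fintype ι] (u : ι → Fin n → ℝ) (w : ι → ℝ), (∀ a, u a ∈ U) →
      ∑ a, w a = 0 → ∑ a, w a • u a = 0 → ∀ t ∈ Icc (0 : ℝ) T, ∀ x : X,
        ‖∑ a, w a • feature HY (F (u a) t x)‖ ≤ (∑ a, |w a|) * c * t ^ 2 := by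
  obtain ⟨k', hkk, hk1, hk2, hk3⟩ := hk
  have hbd : ∀ i j : ℕ, i ≤ 2 → j ≤ 2 → ∃ M, ∀ x ∈ Y, ∀ z ∈ Y,
      ‖iteratedFDeriv ℝ i (fun x => iteratedFDeriv ℝ j (k' x) z) x‖ ≤ M := fun i j hi hj => by
    obtain ⟨M, hM⟩ := (hY.prod hY).exists_bound_of_continuousOn (hk3 i j hi hj).continuousOn
    exact ⟨M, fun x hx z hz => hM (x, z) ⟨hx, hz⟩⟩
  obtain ⟨M11, h11⟩ := hbd 1 1 (by norm_num) (by norm_num)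
  obtain ⟨M12, h12⟩ := hbd 1 2 (by norm_num) (by norm_num)
  obtain ⟨M21, h21⟩ := hbd 2 1 (by norm_num) (by norm_num)
  obtain ⟨M22, h22⟩ := hbd 2 2 (by norm_num) (by norm_num)
  set M := |M11| + |M12| + |M21| + |M22| with hM
  have hM0 : 0 ≤ M := by positivity
  have hMb : ∀ j, j = 1 ∨ j = 2 → ∀ z ∈ Y, ∀ x ∈ Y,
      ‖iteratedFDeriv ℝ 1 (fun x => iteratedFDeriv ℝ j (k' x) z) x‖ ≤ M ∧
      ‖iteratedFDeriv ℝ 2 (fun x => iteratedFDeriv ℝ j (k' x) z) x‖ ≤ M := by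
    intro j hj z hz x hx
    have a1 := le_abs_self M11
    have a2 := le_abs_self M12
    have a3 := le_abs_self M21
    have a4 := le_abs_self M22
    have b1 := abs_nonneg M11
    have b2 := abs_nonneg M12
    have b3 := abs_nonneg M21
    have b4 := abs_nonneg M22
    rcases hj with rfl | rfl
    · exact ⟨(h11 x hx z hz).trans (by linarith), (h21 x hx z hz).trans (by linarith)⟩
    · exact ⟨(h12 x hx z hz).trans (by linarith), (h22 x hx z hz).trans (by linarith)⟩
  refine ⟨√M * (2 * B ^ 2), by positivity, fun ι _ u w hu hw hwu t ht x => ?_⟩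
  set W := ∑ a, |w a| with hW
  have hW0 : 0 ≤ W := Finset.sum_nonneg fun a _ => abs_nonneg _
  set p : ι → EuclideanSpace ℝ (Fin d) := fun a => F (u a) t x with hp
  -- On `Y` this is the function represented by the defect vector, so the squared norm of that
  -- vector is the same combination of values of `b`.
  set b : EuclideanSpace ℝ (Fin d) → ℝ := fun z => ∑ a, w a • k' (p a) z with hb
  have hbC : ContDiff ℝ 2 b := ContDiff.sum fun a _ => (hk1 (p a)).const_smul (w a)
  have hbj : ∀ j : ℕ, j ≤ 2 → ∀ z,
      iteratedFDeriv ℝ j b z = ∑ a, w a • iteratedFDeriv ℝ j (k' (p a)) z := by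
    intro j hj z
    have hj' : ∀ a, ContDiff ℝ j (k' (p a)) := fun a => (hk1 (p a)).of_le (by exact_mod_cast hj)
    rw [hb, iteratedFDeriv_fun_sum_apply fun a _ => ((hj' a).const_smul (w a)).contDiffAt]
    exact Finset.sum_congr rfl fun a _ => iteratedFDeriv_const_smul_apply' (hj' a).contDiffAt
  -- First use of the expansion, in the first variable: `D^j b(z)` is itself the defect of the
  -- observable `x ↦ ∂_y^j k'(x, z)`, hence of order `t²`.
  have hbM : ∀ j, j = 1 ∨ j = 2 → ∀ z ∈ Y, ‖iteratedFDeriv ℝ j b z‖ ≤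
      W * (2 * M * B ^ 2 * t ^ 2) := by
    intro j hj z hz
    have hj2 : j ≤ 2 := by omega
    rw [hbj j hj2]
    exact hF.norm_sum_smul_le hf hg hfB (hk2 j hj2 z) hM0 (hMb j hj z hz) hu hw hwu ht x
  -- Second use, in the other variable: an observable with derivatives of order `t²` has a defect of
  -- order `t⁴`, and the square root restores `t²`.
  have hmain := hF.norm_sum_smul_le hf hg hfB hbC (by positivity)
    (fun z hz => ⟨hbM 1 (Or.inl rfl) z hz, hbM 2 (Or.inr rfl) z hz⟩) hu hw hwu ht x
  have hnorm : ‖∑ a, w a • feature HY (F (u a) t x)‖ ^ 2 = ∑ a, w a • b (F (u a) t x) := by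
    rw [← real_inner_self_eq_norm_sq, sum_inner]
    refine Finset.sum_congr rfl fun a _ => ?_
    rw [real_inner_smul_left, inner_sum, smul_eq_mul, hb]
    congr 1
    refine Finset.sum_congr rfl fun a' _ => ?_
    rw [real_inner_smul_right, real_inner_comm, inner_feature_feature, hHY, ← hkk, smul_eq_mul]
  refine abs_le_of_sq_le_sq' ?_ (by positivity) |>.2
  rw [hnorm]
  refine (le_abs_self _).trans (hmain.trans_eq ?_)
  rw [mul_pow, mul_pow, mul_pow, Real.sq_sqrt hM0]
  ring

end FlowFeature

/-! ### The good event and the estimator's error on it. -/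

section Estimator

theorem norm_inv_smul_sum_rankOne_le {H H' : Type*} [NormedAddCommGroup H] [InnerProductSpace ℝ H]
    [NormedAddCommGroup H'] [InnerProductSpace ℝ H'] {m : ℕ} {a : Fin m → H} {b : Fin m → H'}
    {α β : ℝ} (hα : 0 ≤ α) (hβ : 0 ≤ β) (ha : ∀ k, ‖a k‖ ≤ α) (hb : ∀ k, ‖b k‖ ≤ β) :
    ‖(m : ℝ)⁻¹ • ∑ k, InnerProductSpace.rankOne ℝ (a k) (b k)‖ ≤ α * β := by
  rw [norm_smul, Real.norm_of_nonneg (by positivity)]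
  have h : ‖∑ k, InnerProductSpace.rankOne ℝ (a k) (b k)‖ ≤ m * (α * β) := by
    refine (norm_sum_le_of_le (f := fun k => InnerProductSpace.rankOne ℝ (a k) (b k))
      (n := fun _ => α * β) Finset.univ fun k _ => ?_).trans (by simp)
    rw [InnerProductSpace.norm_rankOne]
    exact mul_le_mul (ha k) (hb k) (norm_nonneg _) hα
  rcases Nat.eq_zero_or_pos m with rfl | hm
  · simp only [Nat.cast_zero, inv_zero, zero_mul]
    positivity
  · rw [inv_mul_le_iff₀ (Nat.cast_pos.2 hm)]
    exact h

variable {Z Z' H H' : Type*} [NormedAddCommGroup H] [InnerProductSpace ℝ H] [CompleteSpace H]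
  [RKHS ℝ H Z ℝ] [NormedAddCommGroup H'] [InnerProductSpace ℝ H'] [CompleteSpace H']
  [RKHS ℝ H' Z' ℝ] [TopologicalSpace Z] [SecondCountableTopology Z] [MeasurableSpace Z]
  [BorelSpace Z] {μ : Measure Z} [IsProbabilityMeasure μ] {K q : ℝ}

/-- The threshold is tuned so that `3 m s² / (8 q K)` becomes `m ε² / (8 K²)`; `ε ≤ q / 2` ensures
`s ≤ q / 3`. -/
theorem measure_norm_empCross_sub_le (hc : Continuous (feature H : Z → H))
    (hK : ∀ z, ‖feature H z‖ ^ 2 ≤ K) (hq : ∫ z, ‖feature H z‖ ^ 2 ∂μ = q) (hq0 : 0 < q)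
    (hqK : q ≤ K) (hK' : ∀ z, ‖feature H' z‖ ^ 2 ≤ K) {y : Z → Z'}
    (hy : Continuous fun z => feature H' (y z)) {ε : ℝ} (hε : 0 < ε) (hεq : ε ≤ q / 2) {m : ℕ}
    (hm : 0 < m) :
    Measure.pi (fun _ => μ) {x : Fin m → Z | ε * √(q / (3 * K)) <
        ‖empCross H H' x (fun k => y (x k)) - crossOp H H' μ y‖} ≤
      ENNReal.ofReal (2 * Real.exp (-(m * ε ^ 2 / (8 * K ^ 2)))) := by
  have hK0 : 0 < K := hq0.trans_le hqK
  have hsqrt : √(q / (3 * K)) ≤ 2 / 3 := by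
    rw [Real.sqrt_le_left (by norm_num), div_le_iff₀ (by positivity)]
    nlinarith
  refine (measure_norm_empirical_sub_ge_le hc.stronglyMeasurable hy.stronglyMeasurable hK
    (fun z => hK' (y z)) hq hq0 hqK (s := ε * √(q / (3 * K))) (by positivity) (by nlinarith)
    hm).trans_eq ?_
  congr 4
  rw [mul_pow, Real.sq_sqrt (by positivity)]
  field_simp

theorem continuous_empCross (hc : Continuous (feature H : Z → H)) {y : Z → Z'}
    (hy : Continuous fun z => feature H' (y z)) {m : ℕ} :
    Continuous fun x : Fin m → Z => empCross H H' x (fun k => y (x k)) := by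
  unfold empCross
  have h : Continuous fun x : Fin m → Z => ∑ k, InnerProductSpace.rankOne ℝ (feature H (x k))
      (feature H' (y (x k))) := by
    refine continuous_finsetSum _ fun k _ => ?_
    exact ((InnerProductSpace.rankOne ℝ).continuous.comp
      (hc.comp (continuous_apply k))).clm_apply (hy.comp (continuous_apply k))
  exact h.const_smul ((m : ℝ)⁻¹)

/-- The event that all empirical (cross-)covariance operators are close to their means. -/
theorem exists_event (hc : Continuous (feature H : Z → H))
    (hK : ∀ z, ‖feature H z‖ ^ 2 ≤ K) (hq : ∫ z, ‖feature H z‖ ^ 2 ∂μ = q) (hq0 : 0 < q)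
    (hqK : q ≤ K) (hK' : ∀ z, ‖feature H' z‖ ^ 2 ≤ K) {ι : Type*} [Fintype ι] {y : ι → Z → Z'}
    (hy : ∀ i, Continuous fun z => feature H' (y i z)) {ε : ℝ} (hε : 0 < ε) (hεq : ε ≤ q / 2)
    {δ : ℝ} (hδ : 0 < δ) {c : ℝ} (hcι : 2 * ((Fintype.card ι : ℝ) + 1) ≤ c) {m : ℕ}
    (hm : 0 < m) (hmε : 8 * K ^ 2 * Real.log (c / δ) / ε ^ 2 ≤ m) :
    ∃ S : Set (Fin m → Z), MeasurableSet S ∧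
      ENNReal.ofReal (1 - δ) ≤ Measure.pi (fun _ => μ) S ∧
      ∀ x ∈ S, ‖empCov H x - covOp H μ‖ ≤ ε * √(q / (3 * K)) ∧
        ∀ i, ‖empCross H H' x (fun k => y i (x k)) - crossOp H H' μ (y i)‖ ≤
          ε * √(q / (3 * K)) := by
  have hK0 : 0 < K := hq0.trans_le hqK
  set s := ε * √(q / (3 * K)) with hs
  have hc0 : 0 < c := lt_of_lt_of_le (by positivity) hcι
  have hexp : Real.exp (-(m * ε ^ 2 / (8 * K ^ 2))) ≤ δ / c := by
    have h1 : Real.log (c / δ) ≤ m * ε ^ 2 / (8 * K ^ 2) := by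
      rw [div_le_iff₀ (by positivity)] at hmε
      rw [le_div_iff₀ (by positivity)]
      linarith
    calc Real.exp (-(m * ε ^ 2 / (8 * K ^ 2))) ≤ Real.exp (-Real.log (c / δ)) :=
          Real.exp_le_exp.2 (by linarith)
      _ = δ / c := by
          rw [Real.exp_neg, Real.exp_log (by positivity), inv_div]
  -- The covariance is the cross-covariance for the identity map. With it there are `card ι + 1` bad
  -- events, each of probability at most `2 δ / c`.
  set A : Set (Fin m → Z) := {x | s < ‖empCross H H x (fun k => x k) - crossOp H H μ id‖} with hA
  set A' : ι → Set (Fin m → Z) := fun i =>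
    {x | s < ‖empCross H H' x (fun k => y i (x k)) - crossOp H H' μ (y i)‖} with hA'
  have hAm : MeasurableSet A := (isOpen_lt continuous_const
    ((continuous_empCross (y := id) hc hc).sub continuous_const).norm).measurableSet
  have hA'm : ∀ i, MeasurableSet (A' i) := fun i => (isOpen_lt continuous_const
    ((continuous_empCross hc (hy i)).sub continuous_const).norm).measurableSet
  have hAμ : Measure.pi (fun _ => μ) A ≤ ENNReal.ofReal (2 * (δ / c)) :=
    (measure_norm_empCross_sub_le (y := id) hc hK hq hq0 hqK hK hc hε hεq hm).trans
      (ENNReal.ofReal_le_ofReal (by linarith))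
  have hA'μ : ∀ i, Measure.pi (fun _ => μ) (A' i) ≤ ENNReal.ofReal (2 * (δ / c)) := fun i =>
    (measure_norm_empCross_sub_le hc hK hq hq0 hqK hK' (hy i) hε hεq hm).trans
      (ENNReal.ofReal_le_ofReal (by linarith))
  refine ⟨(A ∪ ⋃ i, A' i)ᶜ, (hAm.union (MeasurableSet.iUnion hA'm)).compl, ?_, fun x hx => ?_⟩
  · have hbad : Measure.pi (fun _ => μ) (A ∪ ⋃ i, A' i) ≤ ENNReal.ofReal δ := by
      calc Measure.pi (fun _ => μ) (A ∪ ⋃ i, A' i)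
          ≤ Measure.pi (fun _ => μ) A + ∑ i, Measure.pi (fun _ => μ) (A' i) :=
            (measure_union_le _ _).trans (add_le_add le_rfl (measure_iUnion_fintype_le _ _))
        _ ≤ ENNReal.ofReal (2 * (δ / c)) + ∑ _i : ι, ENNReal.ofReal (2 * (δ / c)) :=
            add_le_add hAμ (Finset.sum_le_sum fun i _ => hA'μ i)
        _ = ENNReal.ofReal (((Fintype.card ι : ℝ) + 1) * (2 * (δ / c))) := by
            rw [Finset.sum_const, Finset.card_univ, nsmul_eq_mul,
              ENNReal.ofReal_mul (p := (Fintype.card ι : ℝ) + 1) (by positivity),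
              ENNReal.ofReal_add (by positivity) zero_le_one,
              ENNReal.ofReal_natCast, ENNReal.ofReal_one]
            ring
        _ ≤ ENNReal.ofReal δ := by
            refine ENNReal.ofReal_le_ofReal ?_
            calc ((Fintype.card ι : ℝ) + 1) * (2 * (δ / c))
                = 2 * ((Fintype.card ι : ℝ) + 1) * δ / c := by ring
              _ ≤ c * δ / c := by gcongr
              _ = δ := by field_simp
    rw [prob_compl_eq_one_sub (hAm.union (MeasurableSet.iUnion hA'm)),
      ENNReal.ofReal_sub _ hδ.le, ENNReal.ofReal_one]
    exact tsub_le_tsub_left hbad _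
  · simp only [mem_compl_iff, mem_union, mem_iUnion, not_or, not_exists] at hx
    exact ⟨not_lt.1 hx.1, fun i => not_lt.1 (hx.2 i)⟩

section Deterministic

variable {r : ℕ}

/-- Of all the gaps in the minimum, the perturbation argument uses only the last one. -/
theorem deltaR_le (hr : 1 ≤ r) : 2 * deltaR H μ r ≤ mercer H μ r - mercer H μ (r + 1) := by
  have h : deltaR H μ r ≤ (mercer H μ (r - 1 + 1) - mercer H μ (r - 1 + 2)) / 2 :=
    ciInf_le (Set.finite_range _).bddBelow (⟨r - 1, by omega⟩ : Fin r)
  rw [show r - 1 + 1 = r by omega, show r - 1 + 2 = r + 1 by omega] at h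
  linarith

variable (hc : Continuous (feature H : Z → H)) (hK : ∀ z, ‖feature H z‖ ^ 2 ≤ K)

include hc hK

theorem exists_isTopEigen_covOp (hgap : mercer H μ (r + 1) < mercer H μ r) :
    ∃ v, IsTopEigen (covOp H μ) r v :=
  exists_isTopEigen (isCompactOperator_covOp hc hK) (isPositive_covOp hc hK)
    (Or.inr ((eigval_nonneg (isPositive_covOp hc hK) _).trans_lt hgap))

theorem inner_inclusion {S : H →L[ℝ] Lp ℝ 2 μ} (hS : ∀ f : H, S f = toL2 μ f) (f g : H) :
    ⟪S f, S g⟫_ℝ = ⟪covOp H μ f, g⟫_ℝ := by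
  rw [hS, hS, inner_toL2 (memLp_coe hc hK f) (memLp_coe hc hK g), inner_covOp hc hK]

theorem norm_inclusion_le (hq : ∫ z, ‖feature H z‖ ^ 2 ∂μ = q) {S : H →L[ℝ] Lp ℝ 2 μ}
    (hS : ∀ f : H, S f = toL2 μ f) (f : H) : ‖S f‖ ≤ √q * ‖f‖ := by
  have hq0 : 0 ≤ q := hq ▸ integral_nonneg fun z => by positivity
  refine abs_le_of_sq_le_sq' ?_ (by positivity) |>.2
  rw [← real_inner_self_eq_norm_sq, inner_inclusion hc hK hS, mul_pow, Real.sq_sqrt hq0, sq,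
    ← mul_assoc]
  refine (real_inner_le_norm _ _).trans (mul_le_mul_of_nonneg_right ?_ (norm_nonneg _))
  exact (covOp H μ).le_of_opNorm_le (norm_covOp_le.trans_eq hq) f

theorem norm_sub_projR_le (hgap : mercer H μ (r + 1) < mercer H μ r) (η : H) :
    ‖toL2 μ η - projR H μ r (toL2 μ η)‖ ≤ √(mercer H μ (r + 1)) * ‖η‖ := by
  obtain ⟨S, hS⟩ := exists_inclusion (μ := μ) hc hK
  obtain ⟨v, hv⟩ := exists_isTopEigen_covOp hc hK hgap
  have := hv.norm_sub_starProjection_le (isCompactOperator_covOp hc hK) (isPositive_covOp hc hK)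
    (inner_inclusion hc hK hS) hgap η
  simp only [hS] at this
  exact this

/-- The error of the estimator `[Ĉ]_r^† Ĉ_XY` for samples with small empirical deviations. -/
theorem norm_projR_sub_estimator_le (hq : ∫ z, ‖feature H z‖ ^ 2 ∂μ = q) (hq0 : 0 < q)
    (hqK : q ≤ K) (hr : 1 ≤ r) {t : ℝ} (hqt : q ≤ t) {ε : ℝ} (hε : 0 < ε)
    (hεδ : ε < deltaR H μ r) {m : ℕ} {x : Fin m → Z}
    (hx : ‖empCov H x - covOp H μ‖ ≤ ε * √(q / (3 * K))) :
    0 < eigval (empCov H x) r ∧ ∀ R, IsTruncPinv (empCov H x) r R →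
      (∀ ψ, ‖toL2 μ (R ψ)‖ ≤ √q * ((eigval (empCov H x) r)⁻¹ * ‖ψ‖)) ∧
      ∀ y : Z → Z', (Continuous fun z => feature H' (y z)) → (∀ z, ‖feature H' z‖ ^ 2 ≤ K) →
        ‖empCross H H' x (fun k => y (x k)) - crossOp H H' μ y‖ ≤ ε * √(q / (3 * K)) →
        ∀ ψ : H', ‖projR H μ r (toL2 μ fun z => ψ (y z)) -
            toL2 μ (R (empCross H H' x (fun k => y (x k)) ψ))‖ ≤
          (1 / √(mercer H μ r) + (r + 1) / (deltaR H μ r * mercer H μ r) * (1 + t) * √q) *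
            ε * ‖ψ‖ := by
  have hgap2 := deltaR_le (H := H) (μ := μ) hr
  have hgap : mercer H μ (r + 1) < mercer H μ r := by linarith
  obtain ⟨S, hS⟩ := exists_inclusion (μ := μ) hc hK
  obtain ⟨v, hv⟩ := exists_isTopEigen_covOp hc hK hgap
  have hC := isCompactOperator_covOp (μ := μ) hc hK
  have hCp := isPositive_covOp (μ := μ) hc hK
  have hB := isCompactOperator_empCov (H := H) x
  have hBp := isPositive_empCov (H := H) x
  have hSS := inner_inclusion hc hK hS
  have hSq := norm_inclusion_le hc hK hq hS
  have hmain := fun w => norm_comp_pinv_sub_le (H' := H') (w := w) hC hCp hB hBp hSS hr hv hq0 hqK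
    hSq rfl hε hεδ hgap2 ((mercer_le hr).trans_eq hq) hqt hx
  refine ⟨(hmain v).1, fun R ⟨w, hw1, hw2, hR⟩ => ?_⟩
  have hw : IsTopEigen (empCov H x) r w := ⟨hw1, hw2⟩
  refine ⟨fun ψ => ?_, fun y hy hK' hxy ψ => ?_⟩
  · rw [← hS]
    refine (hSq _).trans (mul_le_mul_of_nonneg_left ?_ (Real.sqrt_nonneg _))
    rw [hR]
    exact ContinuousLinearMap.le_of_opNorm_le _
      (hw.isSpectralSplit hB hBp (hmain v).1).norm_inv ψ
  · have hproj : projR H μ r (toL2 μ fun z => ψ (y z)) =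
        S (diagOp v (fun j => (eigval (covOp H μ) (j + 1))⁻¹) (crossOp H H' μ y ψ)) := by
      have := hv.starProjection_eq hC hCp hSS hgap (κ := toL2 μ fun z => ψ (y z))
        (d := crossOp H H' μ y ψ) fun f => by
          rw [hS, inner_toL2 (memLp_coe hc hK f) (memLp_comp hy hK' ψ),
            inner_crossOp hc hK hy hK']
      rw [← this]
      simp only [hS]
      rfl
    have hD : ‖crossOp H H' μ y‖ ≤ √(q * K) := by
      rw [← hq]
      exact norm_crossOp_le hc hK hK'
    rw [hproj, ← hS, ← map_sub, hR]
    exact (hmain w).2 hw _ _ hD hxy ψ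

end Deterministic

end Estimator

/-! ### The normalised Lebesgue measure on `X` and `Y`. -/

section SampleMeasure

variable {d : ℕ} {X Y : Set (EuclideanSpace ℝ (Fin d))}

theorem isProbabilityMeasure_sampleMeasure (hX : IsCompact X) (hvol : volume X ≠ 0) :
    IsProbabilityMeasure (sampleMeasure X X) := by
  refine ⟨?_⟩
  rw [sampleMeasure, Measure.smul_apply, comap_subtype_coe_apply hX.measurableSet, image_univ,
    Subtype.range_coe, smul_eq_mul, ENNReal.inv_mul_cancel hvol hX.measure_lt_top.ne]

theorem integral_sampleMeasure_mono (hX : IsCompact X) (hY : IsCompact Y) (hXY : X ⊆ Y)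
    {φ : Y → ℝ} (hφ : Continuous φ) (h0 : ∀ y, 0 ≤ φ y) :
    ∫ x, φ (inclusion hXY x) ∂(sampleMeasure X X) ≤ ∫ y, φ y ∂(sampleMeasure X Y) := by
  classical
  set φ' : EuclideanSpace ℝ (Fin d) → ℝ := fun z => if h : z ∈ Y then φ ⟨z, h⟩ else 0 with hφ'
  have h1 : ∀ y : Y, φ y = φ' y := fun y => by simp [hφ']
  have h2 : ∀ x : X, φ (inclusion hXY x) = φ' x := fun x => h1 (inclusion hXY x)
  have h0' : ∀ z, 0 ≤ φ' z := fun z => by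
    simp only [hφ']
    split_ifs
    exacts [h0 _, le_rfl]
  simp_rw [h2, h1]
  rw [sampleMeasure, sampleMeasure, integral_smul_measure, integral_smul_measure,
    integral_subtype_comap hX.measurableSet, integral_subtype_comap hY.measurableSet]
  refine smul_le_smul_of_nonneg_left ?_ ENNReal.toReal_nonneg
  refine setIntegral_mono_set ?_ (Filter.Eventually.of_forall h0') hXY.eventuallyLE
  have hres : ContinuousOn φ' Y := by
    rw [continuousOn_iff_continuous_domRestrict]
    have : Y.domRestrict φ' = φ := funext fun y => (h1 y).symm
    rw [this]
    exact hφ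
  exact hres.integrableOn_compact hY

end SampleMeasure

/-! ### The vertices `0, γ_i e_i` and their affine weights. -/

section Controls

variable {n : ℕ} {U : Set (Fin n → ℝ)}

theorem exists_forall_single_mem (hU0 : 0 ∈ interior U) (i : Fin n) :
    ∃ ρ > 0, ∀ c : ℝ, 0 ≤ c → c < ρ → Pi.single i c ∈ U := by
  obtain ⟨ρ, hρ, hball⟩ := Metric.mem_nhds_iff.1 (mem_interior_iff_mem_nhds.1 hU0)
  refine ⟨ρ, hρ, fun c hc hcρ => hball ?_⟩
  rw [mem_ball_zero_iff, Pi.norm_single, Real.norm_of_nonneg hc]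
  exact hcρ

/-- Boundedness of `U` is needed along with the interior point: it makes the set in the infimum
nonempty, and `sInf ∅` would be `0`. -/
theorem gam_pos (hUc : IsCompact U) (hU0 : 0 ∈ interior U) (i : Fin n) : 0 < gam U i := by
  obtain ⟨ρ, hρ, h⟩ := exists_forall_single_mem hU0 i
  obtain ⟨R, hR⟩ := hUc.isBounded.exists_norm_le
  refine hρ.trans_le (le_csInf ⟨|R| + 1, by positivity, fun hmem => ?_⟩ ?_)
  · have := hR _ hmem
    rw [Pi.norm_single, Real.norm_of_nonneg (by positivity)] at this
    linarith [le_abs_self R]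
  · rintro c ⟨hc, hcU⟩
    by_contra hlt
    exact hcU (h c hc.le (not_le.1 hlt))

/-- Below the infimum all `c e_i` lie in `U`, and closedness adds the endpoint. -/
theorem vertex_mem (hUc : IsCompact U) (hU0 : 0 ∈ interior U) (v : Option (Fin n)) :
    vertex U v ∈ U := by
  cases v with
  | none => exact interior_subset hU0
  | some i =>
    have hpos := gam_pos hUc hU0 i
    have hmem : ∀ c ∈ Ico 0 (gam U i), (Pi.single i c : Fin n → ℝ) ∈ U := fun c hc => by
      rcases hc.1.eq_or_lt with rfl | hc0
      · rw [Pi.single_zero]; exact interior_subset hU0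
      · by_contra hcU
        have hle : gam U i ≤ c := csInf_le ⟨0, fun a ha => ha.1.le⟩ ⟨hc0, hcU⟩
        exact hle.not_gt hc.2
    have hcl : gam U i ∈ closure (Ico 0 (gam U i)) := by
      rw [closure_Ico hpos.ne]
      exact ⟨hpos.le, le_rfl⟩
    have hcont : Continuous fun c : ℝ => (Pi.single i c : Fin n → ℝ) :=
      continuous_single (A := fun _ : Fin n => ℝ) i
    exact (hUc.isClosed.preimage hcont).closure_subset_iff.2 hmem hcl

theorem exists_gamNorm_le (hUc : IsCompact U) : ∃ A, 0 ≤ A ∧ ∀ u ∈ U, gamNorm U u ≤ A := by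
  have hc : Continuous fun u : Fin n → ℝ => gamNorm U u := by
    unfold gamNorm
    fun_prop
  obtain ⟨A, hA⟩ := hUc.exists_bound_of_continuousOn hc.continuousOn
  exact ⟨max 0 A, le_max_left _ _, fun u hu =>
    (le_abs_self _).trans ((hA u hu).trans (le_max_right _ _))⟩

/-- The coefficients of the affine combination of the controls `0, γ_i e_i` that gives `u`. -/
noncomputable def vertexWeight (U : Set (Fin n → ℝ)) (u : Fin n → ℝ) : Option (Fin n) → ℝ
  | none => 1 - ∑ i, u i / gam U i
  | some i => u i / gam U i

/-- The controls `u, 0, γ_i e_i`. -/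
noncomputable def allControls (U : Set (Fin n → ℝ)) (u : Fin n → ℝ) : Option (Option (Fin n)) → Fin n → ℝ
  | none => u
  | some v => vertex U v

/-- The coefficients of an affine relation between the controls `u, 0, γ_i e_i`. -/
noncomputable def defectWeight (U : Set (Fin n → ℝ)) (u : Fin n → ℝ) :
    Option (Option (Fin n)) → ℝ
  | none => 1
  | some v => -vertexWeight U u v

theorem sum_abs_vertexWeight (u : Fin n → ℝ) :
    ∑ v, |vertexWeight U u v| = |1 - ∑ i, u i / gam U i| + gamNorm U u := by
  rw [Fintype.sum_option]
  rfl

theorem sum_abs_vertexWeight_le (u : Fin n → ℝ) :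
    ∑ v, |vertexWeight U u v| ≤ 1 + 2 * gamNorm U u := by
  rw [sum_abs_vertexWeight]
  have h1 : |1 - ∑ i, u i / gam U i| ≤ 1 + gamNorm U u := by
    refine (abs_sub _ _).trans ?_
    rw [abs_one]
    exact add_le_add le_rfl (Finset.abs_sum_le_sum_abs _ _)
  linarith

theorem sum_abs_defectWeight_le (u : Fin n → ℝ) :
    ∑ a, |defectWeight U u a| ≤ 2 + 2 * gamNorm U u := by
  rw [Fintype.sum_option]
  simp only [defectWeight, abs_one, abs_neg]
  linarith [sum_abs_vertexWeight_le (U := U) u]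

theorem sum_defectWeight (u : Fin n → ℝ) : ∑ a, defectWeight U u a = 0 := by
  simp only [Fintype.sum_option, defectWeight, vertexWeight, Finset.sum_neg_distrib]
  ring

theorem sum_defectWeight_smul (hUc : IsCompact U) (hU0 : 0 ∈ interior U) (u : Fin n → ℝ) :
    ∑ a, defectWeight U u a • allControls U u a = 0 := by
  ext j
  simp only [Fintype.sum_option, defectWeight, vertexWeight, allControls, vertex,
    Finset.sum_apply, Pi.smul_apply, smul_eq_mul, Pi.zero_apply, mul_zero, zero_add, one_mul]
  rw [Finset.sum_eq_single j]
  · rw [Pi.single_eq_same]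
    have := (gam_pos hUc hU0 j).ne'
    field_simp
    ring
  · intro i _ hij
    rw [Pi.single_eq_of_ne hij.symm, mul_zero]
  · simp

theorem allControls_mem (hUc : IsCompact U) (hU0 : 0 ∈ interior U) {u : Fin n → ℝ} (hu : u ∈ U)
    (a : Option (Option (Fin n))) : allControls U u a ∈ U := by
  cases a with
  | none => exact hu
  | some v => exact vertex_mem hUc hU0 v

theorem sum_defectWeight_smul_eq {V : Type*} [AddCommGroup V] [Module ℝ V] (u : Fin n → ℝ)
    (φ : (Fin n → ℝ) → V) : ∑ a, defectWeight U u a • φ (allControls U u a) =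
      φ u - ∑ v, vertexWeight U u v • φ (vertex U v) := by
  rw [Fintype.sum_option]
  simp only [defectWeight, allControls, one_smul, neg_smul, Finset.sum_neg_distrib, sub_eq_add_neg]

/-- This form has weights summing to `1`, the structure behind the cancellation in time and the
triangle inequalities over the vertices. -/
theorem controlEst_eq {d : ℕ} {X Y : Set (EuclideanSpace ℝ (Fin d))} {HX HY : Type*}
    [NormedAddCommGroup HX] [InnerProductSpace ℝ HX] [CompleteSpace HX] [RKHS ℝ HX X ℝ]
    [NormedAddCommGroup HY] [InnerProductSpace ℝ HY] [CompleteSpace HY] [RKHS ℝ HY Y ℝ]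
    (F : (Fin n → ℝ) → ℝ → X → Y) (t : ℝ) {m : ℕ} (x : Fin m → X) (R : HX →L[ℝ] HX)
    (u : Fin n → ℝ) :
    controlEst HY F U t x R u = ∑ v, vertexWeight U u v • kedmd HY F t x R (vertex U v) := by
  rw [controlEst, Fintype.sum_option]
  simp only [vertexWeight, smul_sub, Finset.sum_sub_distrib, sub_smul, one_smul, Finset.sum_smul]
  abel

end Controls

/-! ### From the vertex estimates to an arbitrary control. -/

section Combination

variable {Z Z' H H' : Type*} [NormedAddCommGroup H] [InnerProductSpace ℝ H] [CompleteSpace H]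
  [RKHS ℝ H Z ℝ] [NormedAddCommGroup H'] [InnerProductSpace ℝ H'] [CompleteSpace H']
  [RKHS ℝ H' Z' ℝ] [MeasurableSpace Z] {μ : Measure Z} {ι : Type*} [Fintype ι]

theorem toL2_eq_add_sum {g : Z → ℝ} (hg : MemLp g 2 μ) {h : ι → Z → ℝ}
    (hh : ∀ v, MemLp (h v) 2 μ) (w : ι → ℝ) :
    toL2 μ g = toL2 μ (g - ∑ v, w v • h v) + ∑ v, w v • toL2 μ (h v) := by
  have hsum : ∀ s : Finset ι, MemLp (∑ v ∈ s, w v • h v) 2 μ ∧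
      toL2 μ (∑ v ∈ s, w v • h v) = ∑ v ∈ s, w v • toL2 μ (h v) := by
    classical
    intro s
    induction s using Finset.induction_on with
    | empty =>
      refine ⟨by simp, ?_⟩
      have := toL2_smul hg 0
      simpa using this
    | insert a s ha ih =>
      have h1 := (hh a).const_smul (w a)
      rw [Finset.sum_insert ha, Finset.sum_insert ha]
      exact ⟨h1.add ih.1, by rw [toL2_add h1 ih.1, toL2_smul (hh a), ih.2]⟩
  rw [toL2_sub hg (hsum _).1, (hsum _).2, sub_add_cancel]

theorem norm_add_sum_sub_sum_le {E : Type*} [NormedAddCommGroup E] [NormedSpace ℝ E] {D : E}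
    {a b : ι → E} {w : ι → ℝ} {β η : ℝ} (hD : ‖D‖ ≤ η) (hab : ∀ v, ‖a v - b v‖ ≤ β) :
    ‖D + ∑ v, w v • a v - ∑ v, w v • b v‖ ≤ (∑ v, |w v|) * β + η := by
  rw [add_sub_assoc, ← Finset.sum_sub_distrib, add_comm _ η, Finset.sum_mul]
  refine (norm_add_le _ _).trans (add_le_add hD ((norm_sum_le _ _).trans
    (Finset.sum_le_sum fun v _ => ?_)))
  rw [← smul_sub, norm_smul, Real.norm_eq_abs]
  exact mul_le_mul_of_nonneg_left (hab v) (abs_nonneg _)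

theorem norm_projR_le (r : ℕ) (g : Lp ℝ 2 μ) : ‖projR H μ r g‖ ≤ ‖g‖ :=
  Submodule.norm_starProjection_apply_le _ g

variable [TopologicalSpace Z] [SecondCountableTopology Z] [BorelSpace Z] [IsProbabilityMeasure μ]
  {K : ℝ} {r : ℕ} {g : Z → ℝ} {h : ι → Z → ℝ} {w : ι → ℝ} {η : ℝ}

theorem norm_projR_sub_combination_le (hc : Continuous (feature H : Z → H))
    (hK : ∀ z, ‖feature H z‖ ^ 2 ≤ K) (hg : MemLp g 2 μ) (hh : ∀ v, MemLp (h v) 2 μ)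
    (hη : 0 ≤ η) (hgh : ∀ z, |g z - ∑ v, w v * h v z| ≤ η) {B : ι → H} {β : ℝ}
    (hB : ∀ v, ‖projR H μ r (toL2 μ (h v)) - toL2 μ (B v)‖ ≤ β) :
    ‖projR H μ r (toL2 μ g) - toL2 μ (∑ v, w v • B v : H)‖ ≤ (∑ v, |w v|) * β + η := by
  obtain ⟨S, hS⟩ := exists_inclusion (μ := μ) hc hK
  have hD : ‖toL2 μ (g - ∑ v, w v • h v)‖ ≤ η := norm_toL2_le hη fun z => by simpa using hgh z
  rw [toL2_eq_add_sum hg hh w, ← hS, map_add, map_sum, map_sum]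
  simp_rw [map_smul, hS]
  exact norm_add_sum_sub_sum_le ((norm_projR_le r _).trans hD) hB

/-- The truncation bound is applied to each `A v`, not to `g`, since `g` need not belong to the
RKHS. -/
theorem norm_sub_combination_le (hc : Continuous (feature H : Z → H))
    (hK : ∀ z, ‖feature H z‖ ^ 2 ≤ K) (hgap : mercer H μ (r + 1) < mercer H μ r)
    (hg : MemLp g 2 μ) (hη : 0 ≤ η) {A : ι → H} {α : ℝ} (hA : ∀ v, ‖A v‖ ≤ α)
    (hgA : ∀ z, |g z - ∑ v, w v * A v z| ≤ η) {B : ι → H} {β : ℝ}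
    (hB : ∀ v, ‖projR H μ r (toL2 μ (A v)) - toL2 μ (B v)‖ ≤ β) :
    ‖toL2 μ g - toL2 μ (∑ v, w v • B v : H)‖ ≤
      (∑ v, |w v|) * (√(mercer H μ (r + 1)) * α + β) + η := by
  obtain ⟨S, hS⟩ := exists_inclusion (μ := μ) hc hK
  have hD : ‖toL2 μ (g - ∑ v, w v • ⇑(A v))‖ ≤ η := norm_toL2_le hη fun z => by simpa using hgA z
  rw [toL2_eq_add_sum hg (fun v => memLp_coe hc hK (A v)) w, ← hS, map_sum]
  simp_rw [map_smul, hS]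
  refine norm_add_sum_sub_sum_le hD fun v => ?_
  rw [← sub_add_sub_cancel _ (projR H μ r (toL2 μ (A v)))]
  exact (norm_add_le _ _).trans (add_le_add ((norm_sub_projR_le hc hK hgap (A v)).trans
    (mul_le_mul_of_nonneg_left (hA v) (Real.sqrt_nonneg _))) (hB v))

/-- The defect is counted twice, once directly and once under the projection. -/
theorem norm_sub_projR_combination_le (hc : Continuous (feature H : Z → H))
    (hK : ∀ z, ‖feature H z‖ ^ 2 ≤ K) (hgap : mercer H μ (r + 1) < mercer H μ r)
    (hg : MemLp g 2 μ) (hη : 0 ≤ η) {A : ι → H} {α : ℝ} (hA : ∀ v, ‖A v‖ ≤ α)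
    (hgA : ∀ z, |g z - ∑ v, w v * A v z| ≤ η) :
    ‖toL2 μ g - projR H μ r (toL2 μ g)‖ ≤
      (∑ v, |w v|) * (√(mercer H μ (r + 1)) * α) + 2 * η := by
  have hD : ‖toL2 μ (g - ∑ v, w v • ⇑(A v))‖ ≤ η := norm_toL2_le hη fun z => by simpa using hgA z
  rw [toL2_eq_add_sum hg (fun v => memLp_coe hc hK (A v)) w, map_add, map_sum]
  simp_rw [map_smul]
  rw [← sub_sub, add_sub_right_comm]
  refine norm_add_sum_sub_sum_le ?_ fun v => (norm_sub_projR_le hc hK hgap (A v)).trans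
    (mul_le_mul_of_nonneg_left (hA v) (Real.sqrt_nonneg _))
  have hP := (norm_projR_le (H := H) r (toL2 μ (g - ∑ v, w v • ⇑(A v)))).trans hD
  exact (norm_sub_le _ _).trans (by linarith)

omit [MeasurableSpace Z] [TopologicalSpace Z] [SecondCountableTopology Z] in
theorem norm_empCross_sub_combination_le (hK : ∀ z, ‖feature H z‖ ^ 2 ≤ K) {y : Z → Z'}
    {y' : ι → Z → Z'} (hη : 0 ≤ η)
    (hy : ∀ z, ‖feature H' (y z) - ∑ v, w v • feature H' (y' v z)‖ ≤ η) {m : ℕ} (x : Fin m → Z) :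
    ‖empCross H H' x (fun k => y (x k)) - ∑ v, w v • empCross H H' x (fun k => y' v (x k))‖ ≤
      √K * η := by
  have h1 : empCross H H' x (fun k => y (x k)) -
      ∑ v, w v • empCross H H' x (fun k => y' v (x k)) =
      (m : ℝ)⁻¹ • ∑ k, InnerProductSpace.rankOne ℝ (feature H (x k))
        (feature H' (y (x k)) - ∑ v, w v • feature H' (y' v (x k))) := by
    simp only [empCross, map_sub, map_sum, map_smul, Finset.sum_sub_distrib, smul_sub]
    congr 1
    simp_rw [smul_comm (w _) ((m : ℝ)⁻¹), ← Finset.smul_sum]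
    rw [Finset.sum_comm]
    simp_rw [Finset.smul_sum]
  rw [h1]
  exact norm_inv_smul_sum_rankOne_le (Real.sqrt_nonneg _) hη
    (fun k => Real.le_sqrt_of_sq_le (hK _)) fun k => hy _

omit [MeasurableSpace Z] [TopologicalSpace Z] [SecondCountableTopology Z] in
theorem eigval_empCov_le (hK0 : 0 ≤ K) (hK : ∀ z, ‖feature H z‖ ^ 2 ≤ K) {m : ℕ} (x : Fin m → Z)
    (hr : 1 ≤ r) : eigval (empCov H x) r ≤ K := by
  rw [eigval_eq]
  refine Real.sSup_le ?_ hK0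
  rintro c ⟨v, κ, hv, h⟩
  have hK' : ∀ z, ‖feature H z‖ ≤ √K := fun z => Real.le_sqrt_of_sq_le (hK z)
  refine ((h ⟨0, hr⟩).2.trans (eigenvalue_le_norm (hv.1 _) (h _).1)).trans ?_
  exact (norm_inv_smul_sum_rankOne_le (Real.sqrt_nonneg _) (Real.sqrt_nonneg _) (fun k => hK' (x k))
    fun k => hK' (x k)).trans_eq (Real.mul_self_sqrt hK0)

/-- All estimators share the pseudo-inverse `R` and the sample points, so combining them amounts to
combining the successor features inside one cross-covariance; the defect `η` is amplified only by
`R` and one feature norm. -/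
theorem norm_sub_estimator_combination_le (hc : Continuous (feature H : Z → H))
    (hK : ∀ z, ‖feature H z‖ ^ 2 ≤ K) {R : H →L[ℝ] H} {ρ : ℝ} (hρ : 0 ≤ ρ)
    (hR : ∀ φ, ‖toL2 μ (R φ)‖ ≤ ρ * ‖φ‖) {y : Z → Z'} {y' : ι → Z → Z'} (hη : 0 ≤ η)
    (hy : ∀ z, ‖feature H' (y z) - ∑ v, w v • feature H' (y' v z)‖ ≤ η) {m : ℕ} (x : Fin m → Z)
    {a : Lp ℝ 2 μ} {β : ℝ} {ψ : H'}
    (ha : ‖a - toL2 μ (R (empCross H H' x (fun k => y (x k)) ψ))‖ ≤ β) :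
    ‖a - toL2 μ ((∑ v, w v • (R ∘L empCross H H' x (fun k => y' v (x k)))) ψ : H)‖ ≤
      β + ρ * (√K * η * ‖ψ‖) := by
  obtain ⟨S, hS⟩ := exists_inclusion (μ := μ) hc hK
  have h1 : (∑ v, w v • (R ∘L empCross H H' x (fun k => y' v (x k)))) ψ =
      R ((∑ v, w v • empCross H H' x (fun k => y' v (x k))) ψ) := by
    simp
  rw [h1, ← sub_add_sub_cancel _ (toL2 μ (R (empCross H H' x (fun k => y (x k)) ψ)))]
  refine (norm_add_le _ _).trans (add_le_add ha ?_)
  rw [← hS, ← hS, ← map_sub, ← map_sub, ← sub_apply, hS]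
  refine (hR _).trans (mul_le_mul_of_nonneg_left ?_ hρ)
  exact ContinuousLinearMap.le_of_opNorm_le _ (norm_empCross_sub_combination_le hK hη hy x) ψ

end Combination

/-! ### Defects of observables and features for the vertex weights. -/

section SystemDefect

variable {d n : ℕ} {X Y : Set (EuclideanSpace ℝ (Fin d))} {U : Set (Fin n → ℝ)} {T : ℝ}
  {f : EuclideanSpace ℝ (Fin d) → EuclideanSpace ℝ (Fin d)}
  {g : Fin n → EuclideanSpace ℝ (Fin d) → EuclideanSpace ℝ (Fin d)}
  {F : (Fin n → ℝ) → ℝ → X → Y}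

/-- A smooth observable along the flow depends on the control in an affine way up to an error of
second order in time. -/
theorem IsControlFlow.exists_abs_sub_sum_le (hF : IsControlFlow f g U T F) (hUc : IsCompact U)
    (hU0 : 0 ∈ interior U) (hY : IsCompact Y) (hf : ContDiff ℝ 1 f)
    (hg : ∀ i, ContDiff ℝ 1 (g i)) {ψ : Y → ℝ} (hψ : CnOn 2 ψ) :
    ∃ c, 0 ≤ c ∧ ∀ t ∈ Icc (0 : ℝ) T, ∀ u ∈ U, ∀ x : X,
      |ψ (F u t x) - ∑ v, vertexWeight U u v * ψ (F (vertex U v) t x)| ≤ c * t ^ 2 := by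
  obtain ⟨ψ', hψ', hψψ'⟩ := hψ
  obtain ⟨B, -, hfB⟩ := exists_field_bound hUc hY hf hg
  obtain ⟨M, hM, hψM⟩ := exists_norm_iteratedFDeriv_bound hY hψ'
  obtain ⟨A, hA, hAU⟩ := exists_gamNorm_le hUc
  refine ⟨(2 + 2 * A) * (2 * M * B ^ 2), by positivity, fun t ht u hu x => ?_⟩
  have h := hF.norm_sum_smul_le hf hg hfB hψ' hM hψM (allControls_mem hUc hU0 hu)
    (sum_defectWeight u) (sum_defectWeight_smul hUc hU0 u) ht x
  rw [sum_defectWeight_smul_eq u fun c => ψ' (F c t x)] at h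
  simp only [hψψ', Real.norm_eq_abs, smul_eq_mul] at h
  refine h.trans ?_
  rw [← mul_assoc]
  gcongr
  linarith [sum_abs_defectWeight_le (U := U) u, hAU u hu]

/-- The feature vectors of a `C²` kernel along the flow depend on the control in an affine way up
to an error of second order in time. -/
theorem IsControlFlow.exists_norm_feature_sub_sum_le (hF : IsControlFlow f g U T F)
    (hUc : IsCompact U) (hU0 : 0 ∈ interior U) (hY : IsCompact Y) (hf : ContDiff ℝ 1 f)
    (hg : ∀ i, ContDiff ℝ 1 (g i)) {HY : Type*} [NormedAddCommGroup HY] [InnerProductSpace ℝ HY]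
    [CompleteSpace HY] [RKHS ℝ HY Y ℝ] {k : Y → Y → ℝ}
    (hHY : ∀ x y : Y, RKHS.kernel HY x y 1 = k x y) (hk : IsC2Kernel k) :
    ∃ c, 0 ≤ c ∧ ∀ t ∈ Icc (0 : ℝ) T, ∀ u ∈ U, ∀ x : X,
      ‖feature HY (F u t x) - ∑ v, vertexWeight U u v • feature HY (F (vertex U v) t x)‖ ≤
        c * t ^ 2 := by
  obtain ⟨B, -, hfB⟩ := exists_field_bound hUc hY hf hg
  obtain ⟨c, hc, hcF⟩ := hF.exists_norm_sum_feature_le hY hf hg hfB hHY hk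
  obtain ⟨A, hA, hAU⟩ := exists_gamNorm_le hUc
  refine ⟨(2 + 2 * A) * c, by positivity, fun t ht u hu x => ?_⟩
  have h := hcF _ _ _ (allControls_mem hUc hU0 hu) (sum_defectWeight u)
    (sum_defectWeight_smul hUc hU0 u) t ht x
  rw [sum_defectWeight_smul_eq u fun c => feature HY (F c t x)] at h
  refine h.trans ?_
  gcongr
  linarith [sum_abs_defectWeight_le (U := U) u, hAU u hu]

end SystemDefect

end KEDMD

/-! ### Assembly of the bounds. -/

open KEDMD in
theorem theorem5p1 {d n : ℕ}
    -- the sets, the controls, the vector fields and the solutions of the control system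
    (X Y : Set (EuclideanSpace ℝ (Fin d))) (hX : IsCompact X) (hY : IsCompact Y) (hXY : X ⊆ Y)
    (hvol : volume X ≠ 0)
    (U : Set (Fin n → ℝ)) (hUc : IsCompact U) (hUconv : Convex ℝ U) (hU0 : 0 ∈ interior U)
    (f : EuclideanSpace ℝ (Fin d) → EuclideanSpace ℝ (Fin d)) (hf : CnOn 1 fun y : Y => f y)
    (g : Fin n → EuclideanSpace ℝ (Fin d) → EuclideanSpace ℝ (Fin d))
    (hg : ∀ i, CnOn 1 fun y : Y => g i y)
    (T : ℝ) (hT : 0 < T)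
    (F : (Fin n → ℝ) → ℝ → X → Y) (hF : IsControlFlow f g U T F)
    -- the kernel and its reproducing kernel Hilbert spaces on `Y` and on `X`
    (k : Y → Y → ℝ) (hk : Continuous fun p : Y × Y => k p.1 p.2)
    (HY : Type*) [NormedAddCommGroup HY] [InnerProductSpace ℝ HY] [CompleteSpace HY]
    [RKHS ℝ HY Y ℝ] (hHY : ∀ x y : Y, RKHS.kernel HY x y 1 = k x y)
    (HX : Type*) [NormedAddCommGroup HX] [InnerProductSpace ℝ HX] [CompleteSpace HX]
    [RKHS ℝ HX X ℝ]
    (hHX : ∀ x y : X, RKHS.kernel HX x y 1 = k (inclusion hXY x) (inclusion hXY y))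
    -- the compatibility assumptions
    (hC1 : ∀ ψ : Y → ℝ, MemLp ψ 2 (sampleMeasure X Y) →
      ∫ x, ∫ y, k x y * ψ x * ψ y ∂(sampleMeasure X Y) ∂(sampleMeasure X Y) = 0 →
      ∀ᵐ y ∂(sampleMeasure X Y), ψ y = 0)
    (hC2Y : ∀ ψ : HY, (∀ᵐ y ∂(sampleMeasure X Y), ψ y = 0) → ψ = 0)
    (hC2X : ∀ η : HX, (∀ᵐ x ∂(sampleMeasure X X), η x = 0) → η = 0) :
    -- the Koopman operators map into `L²`
    (∀ u ∈ U, ∀ t ∈ Icc (0 : ℝ) T, ∀ ψ : HY, MemLp (koop F u t ψ) 2 (sampleMeasure X X)) ∧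
    -- bounds for a single observable, uniform in the control
    (∀ ψ : HY, CnOn 2 (ψ : Y → ℝ) → ∃ c : ℝ, 0 ≤ c ∧
      ∀ t ∈ Icc (0 : ℝ) T, ∀ r : ℕ, 1 ≤ r →
      (∀ j : ℕ, 1 ≤ j → j ≤ r →
        mercer HX (sampleMeasure X X) (j + 1) < mercer HX (sampleMeasure X X) j) →
      ∀ ε : ℝ, 0 < ε → ε < deltaR HX (sampleMeasure X X) r →
      ∀ δ : ℝ, 0 < δ → δ < 1 →
      ∀ m : ℕ, r ≤ m →
      8 * (⨆ p : Y × Y, |k p.1 p.2|) ^ 2 * Real.log (4 * (n + 1) / δ) / ε ^ 2 ≤ m →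
      ∃ S : Set (Fin m → X), MeasurableSet S ∧
        ENNReal.ofReal (1 - δ) ≤ Measure.pi (fun _ => sampleMeasure X X) S ∧
        ∀ x ∈ S, ∀ R, IsTruncPinv (empCov HX x) r R →
          (∀ u ∈ U,
            ‖projR HX (sampleMeasure X X) r (toL2 (sampleMeasure X X) (koop F u t ψ)) -
                toL2 (sampleMeasure X X) (controlEst HY F U t x R u ψ)‖ ≤
              (1 + 2 * gamNorm U u) * (cR HX k hXY r * ε) * ‖ψ‖ + c * t ^ 2) ∧
          ((∀ v, KoopInvariant HX HY F (vertex U v) t) →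
            ∃ A : Option (Fin n) → HY →L[ℝ] HX, (∀ v, IsKoopOp F (vertex U v) t (A v)) ∧
              ∀ u ∈ U,
                ‖toL2 (sampleMeasure X X) (koop F u t ψ) -
                    toL2 (sampleMeasure X X) (controlEst HY F U t x R u ψ)‖ ≤
                  (1 + 2 * gamNorm U u) *
                    (√(mercer HX (sampleMeasure X X) (r + 1)) * (⨆ v, ‖A v‖) +
                      cR HX k hXY r * ε) * ‖ψ‖ + c * t ^ 2)) ∧
    -- bounds in the operator norm from `H_Y` to `L²`, for twice differentiable kernels
    (IsC2Kernel k → ∃ C : ℝ, 0 ≤ C ∧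
      ∀ t ∈ Icc (0 : ℝ) T, ∀ r : ℕ, 1 ≤ r →
      (∀ j : ℕ, 1 ≤ j → j ≤ r →
        mercer HX (sampleMeasure X X) (j + 1) < mercer HX (sampleMeasure X X) j) →
      ∀ ε : ℝ, 0 < ε → ε < deltaR HX (sampleMeasure X X) r →
      ∀ δ : ℝ, 0 < δ → δ < 1 →
      ∀ m : ℕ, r ≤ m →
      8 * (⨆ p : Y × Y, |k p.1 p.2|) ^ 2 * Real.log (4 / δ) / ε ^ 2 ≤ m →
      ∀ u ∈ U,
      ∃ S : Set (Fin m → X), MeasurableSet S ∧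
        ENNReal.ofReal (1 - δ) ≤ Measure.pi (fun _ => sampleMeasure X X) S ∧
        ∀ x ∈ S, 0 < eigval (empCov HX x) r ∧ ∀ R, IsTruncPinv (empCov HX x) r R →
          (∀ ψ : HY,
            ‖projR HX (sampleMeasure X X) r (toL2 (sampleMeasure X X) (koop F u t ψ)) -
                toL2 (sampleMeasure X X) (controlEst HY F U t x R u ψ)‖ ≤
              (cR HX k hXY r * ε + t ^ 2 * (C * (eigval (empCov HX x) r)⁻¹)) * ‖ψ‖) ∧
          -- invariance at the control `u` itself
          (KoopInvariant HX HY F u t →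
            ∃ A : HY →L[ℝ] HX, IsKoopOp F u t A ∧ ∀ ψ : HY,
              ‖toL2 (sampleMeasure X X) (koop F u t ψ) -
                  toL2 (sampleMeasure X X) (controlEst HY F U t x R u ψ)‖ ≤
                (√(mercer HX (sampleMeasure X X) (r + 1)) * ‖A‖ + cR HX k hXY r * ε +
                  t ^ 2 * (C * (eigval (empCov HX x) r)⁻¹)) * ‖ψ‖) ∧
          -- invariance at the controls `0, γ_1 e_1, …, γ_n e_n`; the factor in front of the
          -- maximal norm is `1` if `u` is in the convex hull of these controls
          ((∀ v, KoopInvariant HX HY F (vertex U v) t) →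
            ∃ A : Option (Fin n) → HY →L[ℝ] HX, (∀ v, IsKoopOp F (vertex U v) t (A v)) ∧
              ∀ ψ : HY,
                ‖toL2 (sampleMeasure X X) (koop F u t ψ) -
                    toL2 (sampleMeasure X X) (controlEst HY F U t x R u ψ)‖ ≤
                  ((|1 - ∑ i, u i / gam U i| + gamNorm U u) *
                      (√(mercer HX (sampleMeasure X X) (r + 1)) * (⨆ v, ‖A v‖)) +
                    cR HX k hXY r * ε + t ^ 2 * (C * (eigval (empCov HX x) r)⁻¹)) * ‖ψ‖)) := by
  have := isProbabilityMeasure_sampleMeasure hX hvol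
  have : CompactSpace Y := isCompact_iff_compactSpace.1 hY
  obtain ⟨f', hf', hff'⟩ := hf
  choose g' hg' hgg' using hg
  replace hF : IsControlFlow f' g' U T F := hF.congr hff' hgg'
  have hFc : ∀ u ∈ U, ∀ t ∈ Icc (0 : ℝ) T, Continuous (F u t) := fun u hu t ht =>
    hF.continuous hY hf' hg' hu ht
  have hV := vertex_mem hUc hU0
  set μ := sampleMeasure X X
  set K := ⨆ p : Y × Y, |k p.1 p.2| with hKdef
  have hkK : ∀ x y, k x y ≤ K := fun x y => (le_abs_self _).trans
    (le_ciSup (f := fun p : Y × Y => |k p.1 p.2|) (isCompact_range hk.abs).bddAbove (x, y))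
  have hsqX : ∀ x, ‖feature HX x‖ ^ 2 = k (inclusion hXY x) (inclusion hXY x) := fun x => by
    rw [← real_inner_self_eq_norm_sq, inner_feature_feature, hHX]
  have hsqY : ∀ y, ‖feature HY y‖ ^ 2 = k y y := fun y => by
    rw [← real_inner_self_eq_norm_sq, inner_feature_feature, hHY]
  have hK : ∀ x, ‖feature HX x‖ ^ 2 ≤ K := fun x => (hsqX x).trans_le (hkK _ _)
  have hK' : ∀ y, ‖feature HY y‖ ^ 2 ≤ K := fun y => (hsqY y).trans_le (hkK _ _)
  have hK0 : 0 ≤ K := Real.iSup_nonneg fun p => abs_nonneg _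
  have hi : Continuous (inclusion hXY) := continuous_inclusion hXY
  have hc : Continuous (feature HX : X → HX) := continuous_feature
    (k := fun x y => k (inclusion hXY x) (inclusion hXY y))
    (hk.comp ((hi.comp continuous_fst).prodMk (hi.comp continuous_snd))) hHX
  have hc' : Continuous (feature HY : Y → HY) := continuous_feature hk hHY
  have hFΦ : ∀ u ∈ U, ∀ t ∈ Icc (0 : ℝ) T, Continuous fun x => feature HY (F u t x) :=
    fun u hu t ht => hc'.comp (hFc u hu t ht)
  have hmem : ∀ u ∈ U, ∀ t ∈ Icc (0 : ℝ) T, ∀ ψ : HY, MemLp (koop F u t ψ) 2 μ :=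
    fun u hu t ht ψ => memLp_comp (hFΦ u hu t ht) hK' ψ
  set q := ∫ x, k (inclusion hXY x) (inclusion hXY x) ∂μ with hqdef
  have hq : ∫ x, ‖feature HX x‖ ^ 2 ∂μ = q := by simp_rw [hsqX, hqdef]
  have hqK : q ≤ K := by
    rw [← hq]
    refine (integral_mono (integrable_norm_feature_sq hc hK) (integrable_const K) hK).trans_eq ?_
    simp
  have hqt : q ≤ ∫ y, k y y ∂(sampleMeasure X Y) :=
    integral_sampleMeasure_mono hX hY hXY (φ := fun y => k y y)
      (hk.comp (continuous_id.prodMk continuous_id)) fun y => by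
        rw [← hsqY]
        positivity
  -- All three follow from `2 ε < 2 δ_r ≤ λ_r - λ_{r+1}` together with `λ_r ≤ q`.
  have hpre : ∀ r : ℕ, 1 ≤ r → ∀ ε : ℝ, 0 < ε → ε < deltaR HX μ r →
      0 < q ∧ ε ≤ q / 2 ∧ mercer HX μ (r + 1) < mercer HX μ r := fun r hr ε hε hεδ => by
    have h1 := deltaR_le (H := HX) (μ := μ) hr
    have h2 : 0 ≤ mercer HX μ (r + 1) := eigval_nonneg (isPositive_covOp hc hK) _
    have h3 := (mercer_le (H := HX) (μ := μ) hr).trans_eq hq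
    exact ⟨by linarith, by linarith, by linarith⟩
  refine ⟨hmem, fun ψ hψ => ?_, fun hkC2 => ?_⟩
  · obtain ⟨c, hc0, hcF⟩ := hF.exists_abs_sub_sum_le hUc hU0 hY hf' hg' hψ
    refine ⟨c, hc0, fun t ht r hr _ ε hε hεδ δ hδ _ m hrm hm => ?_⟩
    obtain ⟨hq0, hεq, hgap⟩ := hpre r hr ε hε hεδ
    -- There are `n + 2` events, for the covariance and `n + 1` vertices, and `2 (n + 2) ≤ 4 (n +
    -- 1)`. The event involves no `u`, so the bounds are uniform in the control.
    obtain ⟨S, hS, hSμ, hSx⟩ := exists_event (ι := Option (Fin n)) hc hK hq hq0 hqK hK'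
      (y := fun v => F (vertex U v) t) (fun v => hFΦ _ (hV v) t ht) hε hεq hδ
      (c := 4 * (n + 1)) (by simp; linarith) (hr.trans hrm) hm
    refine ⟨S, hS, hSμ, fun x hx R hR => ?_⟩
    obtain ⟨h1, h2⟩ := hSx x hx
    have h3 := ((norm_projR_sub_estimator_le (Z' := Y) (H' := HY) hc hK hq hq0 hqK hr hqt hε hεδ
      h1).2 R hR).2
    have hest : ∀ v, ‖projR HX μ r (toL2 μ fun z => ψ (F (vertex U v) t z)) -
        toL2 μ (kedmd HY F t x R (vertex U v) ψ)‖ ≤ cR HX k hXY r * ε * ‖ψ‖ := fun v =>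
      h3 _ (hFΦ _ (hV v) t ht) hK' (h2 v) ψ
    have hβ : 0 ≤ cR HX k hXY r * ε * ‖ψ‖ := (norm_nonneg _).trans (hest none)
    have hKu : ∀ u, controlEst HY F U t x R u ψ =
        ∑ v, vertexWeight U u v • kedmd HY F t x R (vertex U v) ψ := fun u => by
      rw [controlEst_eq]
      simp
    refine ⟨fun u hu => ?_, fun hinv => ?_⟩
    · rw [hKu]
      refine (norm_projR_sub_combination_le hc hK (hmem u hu t ht ψ)
        (fun v => hmem _ (hV v) t ht ψ) (by positivity) (hcF t ht u hu) hest).trans ?_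
      rw [mul_assoc (1 + 2 * gamNorm U u)]
      gcongr
      exact sum_abs_vertexWeight_le u
    · choose A hA using fun v => exists_compositionOperator (F (vertex U v) t) (hinv v)
      refine ⟨A, hA, fun u hu => ?_⟩
      have hAn : ∀ v, ‖A v ψ‖ ≤ (⨆ v, ‖A v‖) * ‖ψ‖ := fun v =>
        (A v).le_of_opNorm_le (le_ciSup (f := fun v => ‖A v‖) (finite_range _).bddAbove v) ψ
      rw [hKu]
      refine (norm_sub_combination_le (w := vertexWeight U u) hc hK hgap (hmem u hu t ht ψ)
        (mul_nonneg hc0 (sq_nonneg t)) (A := fun v => A v ψ) hAn (fun z => ?_)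
        (β := cR HX k hXY r * ε * ‖ψ‖) fun v => ?_).trans ?_
      · simp only [hA]
        exact hcF t ht u hu z
      · rw [hA]
        exact hest v
      · have hα : 0 ≤ (⨆ v, ‖A v‖) * ‖ψ‖ := (norm_nonneg _).trans (hAn none)
        rw [mul_assoc (1 + 2 * gamNorm U u), add_mul (√_ * _), mul_assoc (√_)]
        gcongr
        exact sum_abs_vertexWeight_le u
  · obtain ⟨e, he0, heF⟩ := hF.exists_norm_feature_sub_sum_le hUc hU0 hY hf' hg' hHY hkC2
    -- One share of `K e` pays for the feature defect in the estimator; the other two pay for the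
    -- doubled defect `2 e t²` of the projection error under invariance at the vertices.
    refine ⟨3 * K * e, by positivity, fun t ht r hr _ ε hε hεδ δ hδ _ m hrm hm u hu => ?_⟩
    obtain ⟨hq0, hεq, hgap⟩ := hpre r hr ε hε hεδ
    -- Only the covariance and the cross-covariance for `u` itself must concentrate: two events, so
    -- `c = 4`.
    obtain ⟨S, hS, hSμ, hSx⟩ := exists_event (ι := Unit) hc hK hq hq0 hqK hK'
      (y := fun _ => F u t) (fun _ => hFΦ u hu t ht) hε hεq hδ (c := 4) (by norm_num)
      (hr.trans hrm) hm
    refine ⟨S, hS, hSμ, fun x hx => ?_⟩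
    obtain ⟨h1, h2⟩ := hSx x hx
    obtain ⟨hpos, h3⟩ := norm_projR_sub_estimator_le (Z' := Y) (H' := HY) hc hK hq hq0 hqK hr hqt
      hε hεδ h1
    refine ⟨hpos, fun R hR => ?_⟩
    obtain ⟨hRn, h4⟩ := h3 R hR
    set l := eigval (empCov HX x) r with hl
    -- Since `λ̂_r ≤ K`, defects without the factor `λ̂_r⁻¹` can be absorbed into the term that
    -- carries it.
    have hlK : 1 ≤ K * l⁻¹ := by
      rw [← div_eq_mul_inv, one_le_div hpos]
      exact eigval_empCov_le hK0 hK x hr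
    have hη : 0 ≤ e * t ^ 2 := by positivity
    have hest : ∀ ψ : HY, ‖projR HX μ r (toL2 μ (koop F u t ψ)) -
        toL2 μ (controlEst HY F U t x R u ψ)‖ ≤
          (cR HX k hXY r * ε + K * l⁻¹ * (e * t ^ 2)) * ‖ψ‖ := fun ψ => by
      rw [controlEst_eq]
      refine (norm_sub_estimator_combination_le hc hK (ρ := √q * l⁻¹) (by positivity)
        (β := cR HX k hXY r * ε * ‖ψ‖)
        (fun φ => (hRn φ).trans_eq (mul_assoc _ _ _).symm) hη (heF t ht u hu) x
        (h4 _ (hFΦ u hu t ht) hK' (h2 ()) ψ)).trans ?_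
      rw [add_mul]
      refine add_le_add (le_refl _) ?_
      calc √q * l⁻¹ * (√K * (e * t ^ 2) * ‖ψ‖) ≤ √K * l⁻¹ * (√K * (e * t ^ 2) * ‖ψ‖) := by
            gcongr
        _ = √K * √K * l⁻¹ * (e * t ^ 2) * ‖ψ‖ := by ring
        _ = K * l⁻¹ * (e * t ^ 2) * ‖ψ‖ := by rw [Real.mul_self_sqrt hK0]
    have hC : K * l⁻¹ * (e * t ^ 2) + 2 * (e * t ^ 2) ≤ t ^ 2 * (3 * K * e * l⁻¹) := by
      nlinarith [mul_le_mul_of_nonneg_right hlK hη]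
    have hC' : K * l⁻¹ * (e * t ^ 2) ≤ t ^ 2 * (3 * K * e * l⁻¹) := by linarith
    refine ⟨fun ψ => (hest ψ).trans ?_, fun hinv => ?_, fun hinv => ?_⟩
    · gcongr
    · obtain ⟨A, hA⟩ := exists_compositionOperator (F u t) hinv
      refine ⟨A, hA, fun ψ => ?_⟩
      have h5 := norm_sub_projR_le (μ := μ) hc hK hgap (A ψ)
      rw [show ⇑(A ψ) = koop F u t ψ from hA ψ] at h5
      rw [← sub_add_sub_cancel _ (projR HX μ r (toL2 μ (koop F u t ψ)))]
      refine (norm_add_le _ _).trans ((add_le_add h5 (hest ψ)).trans ?_)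
      calc √(mercer HX μ (r + 1)) * ‖A ψ‖ + (cR HX k hXY r * ε + K * l⁻¹ * (e * t ^ 2)) * ‖ψ‖
          ≤ √(mercer HX μ (r + 1)) * (‖A‖ * ‖ψ‖) +
            (cR HX k hXY r * ε + t ^ 2 * (3 * K * e * l⁻¹)) * ‖ψ‖ := by
            gcongr
            exact A.le_opNorm ψ
        _ = _ := by ring
    · choose A hA using fun v => exists_compositionOperator (F (vertex U v) t) (hinv v)
      refine ⟨A, hA, fun ψ => ?_⟩
      have hAn : ∀ v, ‖A v ψ‖ ≤ (⨆ v, ‖A v‖) * ‖ψ‖ := fun v =>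
        (A v).le_of_opNorm_le (le_ciSup (f := fun v => ‖A v‖) (finite_range _).bddAbove v) ψ
      have h5 := norm_sub_projR_combination_le (w := vertexWeight U u) hc hK hgap
        -- By the reproducing property the feature defect bounds the pointwise defect of every `ψ`,
        -- with the factor `‖ψ‖`.
        (hmem u hu t ht ψ) (mul_nonneg hη (norm_nonneg ψ)) (A := fun v => A v ψ) hAn fun z => by
          simp only [hA]
          have h6 : koop F u t ψ z - ∑ v, vertexWeight U u v * ψ (F (vertex U v) t z) =
              inner ℝ (feature HY (F u t z) -
                ∑ v, vertexWeight U u v • feature HY (F (vertex U v) t z)) ψ := by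
            simp only [inner_sub_left, sum_inner, real_inner_smul_left, inner_feature, koop]
          rw [h6]
          exact (abs_real_inner_le_norm _ _).trans
            (mul_le_mul_of_nonneg_right (heF t ht u hu z) (norm_nonneg _))
      rw [sum_abs_vertexWeight] at h5
      rw [← sub_add_sub_cancel _ (projR HX μ r (toL2 μ (koop F u t ψ)))]
      refine (norm_add_le _ _).trans ((add_le_add h5 (hest ψ)).trans ?_)
      nlinarith [mul_le_mul_of_nonneg_right hC (norm_nonneg ψ)]
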